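/- **Setting.** Let $\mathbb{R}^{n_1\times\cdots\times n_d}$ carry the entrywise inner product and the Frobenius norm $\|\cdot\|_F$, and put $N=n_3\cdots n_d$. For a tensor $\mathcal X$ let $\overline{\mathcal X}$ be its (unnormalized) discrete Fourier transform along the modes $3,\dots,d$, let $\overline{X}^{(i)}\in\mathbb{C}^{n_1\times n_2}$, $i=(i_3,\dots,i_d)$, be the frontal slices of $\overline{\mathcal X}$, and let $\overline X$ be the block diagonal matrix with these slices as blocks. $\sigma_j(M)$ is the $j$-th largest singular value of a matrix $M$ and $\#\sigma_1(M)$ the multiplicity of the largest one. The tensor nuclear norm is $\|\mathcal X\|_*=\frac1N\sum_i\sum_{j\le\min\{n_1,n_2\}}\sigma_j(\overline X^{(i)})$; let $\mathcal B=\{\|\mathcal X\|_*\le1\}$ and let $\Pi_{\mathcal B}$ be the Euclidean projection onto $\mathcal B$. A t-SVD of $\mathcal X$ consists of SVDs $\overline X^{(i)}=\overline U^{(i)}\overline S^{(i)}(\overline V^{(i)})^{\mathrm H}$ of all slices (singular values in decreasing order) such that $\overline U^{(i)},\overline V^{(i)}$ are the slices of the Fourier transforms of real tensors $\mathcal U,\mathcal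 V$. The rank-$r$ truncated projection of $\mathcal X$ onto $\mathcal B$ is computed from the leading $r$ components of the SVDs of the slices only: find $s\ge0$ with $\frac1N\sum_i\sum_{j\le r}\max\{0,\sigma_j(\overline X^{(i)})-s\}=1$ and return the tensor $\mathcal Y$ with $\overline Y^{(i)}=\sum_{j\le r}\max\{0,\sigma_j(\overline X^{(i)})-s\}\,u^{(i)}_j(v^{(i)}_j)^{\mathrm H}$, where $u_j^{(i)},v_j^{(i)}$ are the columns of $\overline U^{(i)},\overline V^{(i)}$. Let $f:\mathbb{R}^{n_1\times\cdots\times n_d}\to\mathbb{R}$ be convex, differentiable on $\mathcal B$, and $\beta$-smooth there, i.e. $\|\nabla f(\mathcal X)-\nabla f(\mathcal Y)\|_F\le\beta\|\mathcal X-\mathcal Y\|_F$ for $\mathcal X,\mathcal Y\in\mathcal B$, with $\beta>0$. Let $\mathcal X^*$ be a minimizer of $f$ over $\mathcal B$, and assume $G:=\nabla f(\mathcal X^*)\ne0$. Put $$m=\max_{i:\ \overline G^{(i)}\ne0}\#\sigma_1(\overline G^{(i)}),\qquad \mathrm{nnzb}=\#\{i:\overline G^{(i)}\neq 0\},\qquad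 \delta(r)=\sigma_1(\overline G)-\max_i\sigma_{r+1}(\overline G^{(i)}),$$ $$R_0(r)=\frac{1}{2\beta\sqrt N}\max\left\{\frac{\delta(r)}{1+\frac{\sqrt{m\cdot\mathrm{nnzb}}}{\#\sigma_1(\overline G)}},\ \frac{\delta(r-m+1)}{\frac1{\sqrt{m}}+\frac{\sqrt{m\cdot\mathrm{nnzb}}}{\#\sigma_1(\overline G)}}\right\}.$$ Projected gradient descent starts at some $\mathcal X_1\in\mathcal B$ and iterates $\mathcal X_{t+1}=\Pi_{\mathcal B}[\mathcal X_t-\frac1\beta\nabla f(\mathcal X_t)]$, $t\ge1$. **Theorem (local convergence of projected gradient descent).** (1) Let $m\le r<\min\{n_1,n_2\}$ and $\|\mathcal X_1-\mathcal X^*\|_F\le R_0(r)$. Then for every $t\ge1$ the rank-$r$ truncated projection of $\mathcal X_t-\frac1\beta\nabla f(\mathcal X_t)$ onto $\mathcal B$ exists, does not depend on the choice of the t-SVD or of $s$, and equals $\mathcal X_{t+1}$; so all the projections can be replaced by rank-$r$ truncated projections without changing the sequence $(\mathcal X_t)_{t\ge1}$. In particular, for all $t\ge2$, $$f(\mathcal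 X_t)-f(\mathcal X^*)\le\frac{\beta\|\mathcal X_1-\mathcal X^*\|_F^2}{2(t-1)}.$$ (2) Suppose moreover that $f(\mathcal X)=g(\mathcal A(\mathcal X))+\langle\mathcal C,\mathcal X\rangle$, where $\mathcal A:\mathbb{R}^{n_1\times\cdots\times n_d}\to\mathbb{R}^{q}$ is linear and $g:\mathbb{R}^q\to\mathbb{R}$ is $\alpha$-strongly convex, $\alpha>0$, and that $\mathcal X^*$ is the unique minimizer of $f$ over $\mathcal B$ and satisfies strict complementarity, i.e. $-\nabla f(\mathcal X^*)$ lies in the relative interior of the normal cone of $\mathcal B$ at $\mathcal X^*$. Then there is a $\gamma>0$, independent of $\mathcal X_1$, such that $f(\mathcal X)-f(\mathcal X^*)\ge\gamma\|\mathcal X-\mathcal X^*\|_F^2$ for all $\mathcal X\in\mathcal B$, and such that for every run of projected gradient descent (from any $\mathcal X_1\in\mathcal B$) and all $t\ge2$, $$f(\mathcal X_t)-f(\mathcal X^*)\le\frac{\beta\|\mathcal X_1-\mathcal X^*\|_F^2}{2}\left(\frac1{1+\frac{2\gamma}{\beta}}\right)^{t-1}.$$ -/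

import Mathlib

namespace TNN

/-- The multi-indices `(i_3, …, i_d)` of the frontal slices; here `k = d - 2` and
`n j` is the size of the `(j + 3)`-rd mode. -/
abbrev SliceIdx {k : ℕ} (n : Fin k → ℕ) : Type := (j : Fin k) → Fin (n j)

/-- Real tensors of size `n₁ × n₂ × n 0 × ⋯ × n (k-1)`, with the entrywise inner product and
the Frobenius norm. -/
abbrev Tensor (n₁ n₂ : ℕ) {k : ℕ} (n : Fin k → ℕ) : Type :=
  EuclideanSpace ℝ (Fin n₁ × Fin n₂ × SliceIdx n)

variable {n₁ n₂ k : ℕ} {n : Fin k → ℕ}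

/-- `N = n_3 ⋯ n_d`, the number of frontal slices. -/
def numSlices (n : Fin k → ℕ) : ℕ := ∏ j, n j

/-- The frontal slice with index `i` of the discrete Fourier transform of `X` along all modes but
the first two (the unnormalized transform, with `ω_j = exp (-2π√-1 / n_j)`). -/
noncomputable def fslice (X : Tensor n₁ n₂ n) (i : SliceIdx n) :
    Matrix (Fin n₁) (Fin n₂) ℂ :=
  Matrix.of fun a b => ∑ l : SliceIdx n, ((X (a, b, l) : ℝ) : ℂ) *
    ∏ j, Complex.exp (-(2 * Real.pi * Complex.I) / (n j : ℂ)) ^ ((i j : ℕ) * (l j : ℕ))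

/-- The block diagonal matrix whose diagonal blocks are the frontal slices of the Fourier
transform of `X`. -/
noncomputable def bdiag (X : Tensor n₁ n₂ n) :
    Matrix (Fin n₁ × SliceIdx n) (Fin n₂ × SliceIdx n) ℂ :=
  Matrix.blockDiagonal (fslice X)

/-- The singular values of a complex matrix in decreasing order, counted from `0`:
`sv M j` is `σ_{j+1}(M)`. -/
noncomputable def sv {p q : Type*} [Fintype p] [Fintype q] [DecidableEq q]
    (M : Matrix p q ℂ) (j : ℕ) : ℝ :=
  (Matrix.toEuclideanLin M).singularValues j

/-- `#σ_1(M)`: the multiplicity of the largest singular value, among the `min p q` singular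
values of a `p × q` matrix. -/
noncomputable def topMult {p q : Type*} [Fintype p] [Fintype q] [DecidableEq q]
    (M : Matrix p q ℂ) : ℕ :=
  Set.ncard {j : ℕ | j < min (Fintype.card p) (Fintype.card q) ∧ sv M j = sv M 0}

/-- The tensor nuclear norm: the sum of the singular values of all frontal slices of the Fourier
transform, divided by `N`. -/
noncomputable def tnn (X : Tensor n₁ n₂ n) : ℝ :=
  (1 / (numSlices n : ℝ)) * ∑ i : SliceIdx n, ∑ j ∈ Finset.range (min n₁ n₂), sv (fslice X i) j

/-- The ball of radius `τ` of the tensor nuclear norm. -/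
def ball (n₁ n₂ : ℕ) {k : ℕ} (n : Fin k → ℕ) (τ : ℝ) : Set (Tensor n₁ n₂ n) :=
  {X | tnn X ≤ τ}

/-- `Y` is a Euclidean projection of `X` onto the set `K`. -/
def IsProj {E : Type*} [NormedAddCommGroup E] (K : Set E) (X Y : E) : Prop :=
  Y ∈ K ∧ ∀ Z ∈ K, ‖X - Y‖ ≤ ‖X - Z‖

/-- The real tensors `U` and `V` are the orthogonal factors of a t-SVD of `X`: in the Fourier
domain each frontal slice is factored by a matrix SVD with decreasingly ordered singular values.
That `U` and `V` are real is the conjugate symmetry of the SVDs of the slices. -/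
def IsTSVD (X : Tensor n₁ n₂ n) (U : Tensor n₁ n₁ n) (V : Tensor n₂ n₂ n) : Prop :=
  ∀ i : SliceIdx n,
    fslice U i ∈ Matrix.unitaryGroup (Fin n₁) ℂ ∧
    fslice V i ∈ Matrix.unitaryGroup (Fin n₂) ℂ ∧
    fslice X i = fslice U i *
      (Matrix.of fun (a : Fin n₁) (b : Fin n₂) =>
        if (a : ℕ) = (b : ℕ) then ((sv (fslice X i) a : ℝ) : ℂ) else 0) *
      (fslice V i).conjTranspose

/-- `Y` is an output of the rank-`r` truncated projection of `X` onto the tensor nuclear norm ball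
of radius `τ`: take a t-SVD, keep only the leading `r` components of each frontal slice in the
Fourier domain, and soft-threshold their singular values by an `s ≥ 0` for which the thresholded
values have sum `N τ`. -/
def IsTruncProj (r : ℕ) (τ : ℝ) (X Y : Tensor n₁ n₂ n) : Prop :=
  ∃ (U : Tensor n₁ n₁ n) (V : Tensor n₂ n₂ n) (s : ℝ), IsTSVD X U V ∧ 0 ≤ s ∧
    (1 / (numSlices n : ℝ)) *
      ∑ i : SliceIdx n, ∑ j ∈ Finset.range r, max 0 (sv (fslice X i) j - s) = τ ∧
    ∀ i : SliceIdx n, fslice Y i = fslice U i *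
      (Matrix.of fun (a : Fin n₁) (b : Fin n₂) =>
        if (a : ℕ) = (b : ℕ) ∧ (a : ℕ) < r then
          ((max 0 (sv (fslice X i) a - s) : ℝ) : ℂ) else 0) *
      (fslice V i).conjTranspose

/-- Iterates `X 1, X 2, …` of projected gradient descent with step size `1 / β` over the unit
ball of the tensor nuclear norm (`X 0` is not used). -/
def IsPGD (f : Tensor n₁ n₂ n → ℝ) (β : ℝ) (X : ℕ → Tensor n₁ n₂ n) : Prop :=
  X 1 ∈ ball n₁ n₂ n 1 ∧
  ∀ t : ℕ, 1 ≤ t →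
    IsProj (ball n₁ n₂ n 1) (X t - (1 / β) • gradient f (X t)) (X (t + 1))

/-- The largest multiplicity `#σ_1^max` of the top singular value of a frontal slice of the
Fourier transform of `G`. Only nonzero slices are taken into account: the zero slices carry no top
singular vectors. -/
noncomputable def maxTopMult (G : Tensor n₁ n₂ n) : ℕ :=
  ⨆ i : {i : SliceIdx n // fslice G i ≠ 0}, topMult (fslice G i.1)

/-- The number of nonzero frontal slices of the Fourier transform of `G`. -/
noncomputable def nnzb (G : Tensor n₁ n₂ n) : ℕ :=
  Set.ncard {i : SliceIdx n | fslice G i ≠ 0}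

/-- The generalized complementarity measure
`δ(r) = σ_1(Ḡ) - max_i σ_{r+1}(Ḡ^{(i)})`, for `G` the gradient at the optimum. -/
noncomputable def gap (G : Tensor n₁ n₂ n) (r : ℕ) : ℝ :=
  sv (bdiag G) 0 - ⨆ i : SliceIdx n, sv (fslice G i) r

/-- The radius `R_0(r)` for the step size `1 / β`, where `G` is the gradient at the optimum. -/
noncomputable def radius (β : ℝ) (G : Tensor n₁ n₂ n) (r : ℕ) : ℝ :=
  1 / (2 * β * √(numSlices n : ℝ)) *
    max
      (gap G r /
        (1 + √((maxTopMult G : ℝ) * (nnzb G : ℝ)) / (topMult (bdiag G) : ℝ)))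
      (gap G (r - maxTopMult G + 1) /
        (1 / √(maxTopMult G : ℝ) +
          √((maxTopMult G : ℝ) * (nnzb G : ℝ)) / (topMult (bdiag G) : ℝ)))

/-- The normal cone of the set `K` at the point `x`. -/
def normalCone {E : Type*} [NormedAddCommGroup E] [InnerProductSpace ℝ E] (K : Set E) (x : E) :
    Set E :=
  {y | ∀ z ∈ K, inner ℝ y (z - x) ≤ 0}

/-- Strict complementarity at `Xs`: `0 ∈ ∇f(Xs) + ri (N(Xs))`, with `N(Xs)` the normal cone of the
unit ball of the tensor nuclear norm. -/
def StrictCompl (f : Tensor n₁ n₂ n → ℝ) (Xs : Tensor n₁ n₂ n) : Prop :=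
  -gradient f Xs ∈ intrinsicInterior ℝ (normalCone (ball n₁ n₂ n 1) Xs)

end TNN

/-! Let `G` be the gradient at the optimum `X*` and `g = σ₁(Ḡ)`. By Parseval the entrywise inner
product is `1/N` times the sum of the Hilbert-Schmidt products of the Fourier slices, so the
operator norm of the block diagonal matrix is dual to the tensor nuclear norm. Hence optimality
means that `X*` has nuclear norm 1, that `⟨G, X*⟩ = -g`, and that each slice of `X*` is aligned with
the contraction `W_i = -G_i / g` (`optimality_structure`). Equality in trace duality then gives
`X*_i = W_i H_i` with `H_i` positive and supported where `W_i` is isometric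
(`exists_factor_of_hs_eq_nuc`): `X*_i` lives on the right singular vectors of `G_i` with singular
value exactly `g`.

Truncation. Projecting soft-thresholds all singular values by a common `s`, so truncating to rank
`r` is harmless as soon as `s` dominates every `σ_{r+1}`. A gradient step from `X` is `P = X* - G/β
+ D` with `‖D‖ ≤ 2‖X - X*‖`. A Weyl-type inequality (`sv_le_add_of_certificate`) keeps `s₀ = max_i
σ_{r+1}(P_i)` below `g/β`, while trace duality against a partial isometry (`le_sum_threshold`) shows
that the mass of slice `i` above `s₀` is at least `‖X*_i‖_* + (g/β - s₀) m_i - √m_i ‖D_i‖_F`, where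
`m_i` is the multiplicity of `g` in `G_i`. Within the radius these add up to at least `N`
(`exists_threshold`), so every admissible threshold is at least `s₀` (`isTruncProj_iff`). Splitting
the index `r` as `(r - μ) + μ` with `μ = 0` or `μ = m - 1` gives the two members of the maximum in
`R₀`. Projected gradient steps never increase the distance to `X*`, so the radius condition
persists.

Linear rate. Strong convexity of `g ∘ A` gives `f(X) - f(X*) ≥ ⟨G, X - X*⟩ + (α/2)‖A(X - X*)‖²`, and
it remains to bound `‖X - X*‖²` by the right side. The squared distance of `X` from the span of the
face exposed by `-G` is `O(⟨G, X - X*⟩)`, by an approximate version of the alignment argument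
(`exists_factor_dist_le`). On that span the pair `(A, ⟨G, ·⟩)` is injective: by strict
complementarity `X*` can be moved both ways along a kernel direction, where `f` is affine, and
uniqueness of the minimizer excludes this. The resulting quadratic growth contracts the squared
distances geometrically. -/

namespace TNN

open Module InnerProductSpace

/-! ### Courant-Fischer bounds and the singular value decomposition of linear maps -/

section SingularValues

variable {𝕜 : Type*} [RCLike 𝕜]
  {E : Type*} [NormedAddCommGroup E] [InnerProductSpace 𝕜 E]
  {F : Type*} [NormedAddCommGroup F] [InnerProductSpace 𝕜 F]

theorem norm_sq_apply_eq_sum {ι : Type*} [Fintype ι] (b : OrthonormalBasis ι 𝕜 E)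
    (T : E →ₗ[𝕜] F) (hT : ∀ j k, j ≠ k → inner 𝕜 (T (b j)) (T (b k)) = 0) (x : E) :
    ‖T x‖ ^ 2 = ∑ j, ‖inner 𝕜 (b j) x‖ ^ 2 * ‖T (b j)‖ ^ 2 := by
  have hx : T x = ∑ j, inner 𝕜 (b j) x • T (b j) := by
    conv_lhs => rw [← b.sum_repr' x]
    simp
  have h : inner 𝕜 (T x) (T x) =
      ((∑ j, ‖inner 𝕜 (b j) x‖ ^ 2 * ‖T (b j)‖ ^ 2 : ℝ) : 𝕜) := by
    rw [hx]
    simp only [inner_sum, sum_inner, inner_smul_left, inner_smul_right]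
    push_cast
    refine Finset.sum_congr rfl fun j _ => ?_
    rw [Finset.sum_eq_single j (fun k _ hk => by rw [hT k j hk]; ring) (by simp),
      inner_self_eq_norm_sq_to_K, ← mul_assoc, RCLike.mul_conj]
  rw [inner_self_eq_norm_sq_to_K] at h
  exact_mod_cast h

/-- The span of the first `j` vectors of an orthonormal basis. -/
def headSpan {p : ℕ} (b : OrthonormalBasis (Fin p) 𝕜 E) (j : ℕ) : Submodule 𝕜 E :=
  Submodule.span 𝕜 (b '' {k | (k : ℕ) < j})

theorem finrank_headSpan {p : ℕ} (b : OrthonormalBasis (Fin p) 𝕜 E) (j : ℕ) :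
    finrank 𝕜 (headSpan b j) = min p j := by
  classical
  have h := finrank_span_set_eq_card (R := 𝕜) (s := b '' {k | (k : ℕ) < j})
    (b.orthonormal.linearIndependent.linearIndepOn_id.mono (Set.image_subset_range _ _))
  rw [headSpan, h, Set.toFinset_image,
    Finset.card_image_of_injective _ b.orthonormal.linearIndependent.injective]
  simpa using Fin.card_filter_val_lt (n := p) (m := j)

theorem inner_eq_zero_of_mem_headSpan {p : ℕ} {b : OrthonormalBasis (Fin p) 𝕜 E} {j : ℕ} {x : E}
    (hx : x ∈ headSpan b j) {k : Fin p} (hk : j ≤ k) : inner 𝕜 (b k) x = 0 := by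
  induction hx using Submodule.span_induction with
  | mem x hx =>
    obtain ⟨l, hl, rfl⟩ := hx
    refine b.orthonormal.2 fun h => ?_
    subst h
    exact absurd hl (not_lt.2 hk)
  | zero => simp
  | add x y _ _ hx hy => rw [inner_add_right, hx, hy, add_zero]
  | smul a x _ hx => rw [inner_smul_right, hx, mul_zero]

theorem mem_headSpan_of_inner_eq_zero {p : ℕ} {b : OrthonormalBasis (Fin p) 𝕜 E} {j : ℕ} {x : E}
    (hx : ∀ k : Fin p, j ≤ k → inner 𝕜 (b k) x = 0) : x ∈ headSpan b j := by
  rw [← b.sum_repr' x]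
  refine Submodule.sum_mem _ fun k _ => ?_
  by_cases hk : j ≤ k
  · rw [hx k hk, zero_smul]; exact Submodule.zero_mem _
  · exact Submodule.smul_mem _ _ (Submodule.subset_span ⟨k, not_le.1 hk, rfl⟩)

theorem inner_eq_zero_of_mem_headSpan_orthogonal {p : ℕ} {b : OrthonormalBasis (Fin p) 𝕜 E} {j : ℕ}
    {x : E} (hx : x ∈ (headSpan b j)ᗮ) {k : Fin p} (hk : (k : ℕ) < j) : inner 𝕜 (b k) x = 0 :=
  hx _ (Submodule.subset_span ⟨k, hk, rfl⟩)

/-- The dimension count behind both halves of the min-max principle: `Sᗮ` has codimension less than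
the dimension of `U`. -/
theorem exists_mem_inf_orthogonal [FiniteDimensional 𝕜 E] {S U : Submodule 𝕜 E}
    (h : finrank 𝕜 S < finrank 𝕜 U) : ∃ x ∈ U, x ∈ Sᗮ ∧ x ≠ 0 := by
  by_contra! hc
  have hbot : U ⊓ Sᗮ = ⊥ := by
    rw [Submodule.eq_bot_iff]
    exact fun x hx => hc x hx.1 hx.2
  have h1 := Submodule.finrank_sup_add_finrank_inf_eq U Sᗮ
  have h2 := S.finrank_add_finrank_orthogonal
  have h3 := Submodule.finrank_le (U ⊔ Sᗮ)
  rw [hbot, finrank_bot] at h1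
  omega

theorem norm_apply_le_of_mem_headSpan_orthogonal {p : ℕ} {b : OrthonormalBasis (Fin p) 𝕜 E}
    {T : E →ₗ[𝕜] F} (hT : ∀ j k, j ≠ k → inner 𝕜 (T (b j)) (T (b k)) = 0) {j : ℕ} {c : ℝ}
    (hc0 : 0 ≤ c) (hc : ∀ k : Fin p, j ≤ k → ‖T (b k)‖ ≤ c) {x : E} (hx : x ∈ (headSpan b j)ᗮ) :
    ‖T x‖ ≤ c * ‖x‖ := by
  refine le_of_sq_le_sq ?_ (by positivity)
  rw [norm_sq_apply_eq_sum b T hT, mul_pow, ← b.sum_sq_norm_inner_right x, Finset.mul_sum]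
  refine Finset.sum_le_sum fun k _ => ?_
  rcases lt_or_ge (k : ℕ) j with hk | hk
  · simp [inner_eq_zero_of_mem_headSpan_orthogonal hx hk]
  · rw [mul_comm]
    gcongr
    exact hc k hk

theorem le_norm_apply_of_mem_headSpan {p : ℕ} {b : OrthonormalBasis (Fin p) 𝕜 E}
    {T : E →ₗ[𝕜] F} (hT : ∀ j k, j ≠ k → inner 𝕜 (T (b j)) (T (b k)) = 0) {j : ℕ} {c : ℝ}
    (hc0 : 0 ≤ c) (hc : ∀ k : Fin p, (k : ℕ) < j → c ≤ ‖T (b k)‖) {x : E} (hx : x ∈ headSpan b j) :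
    c * ‖x‖ ≤ ‖T x‖ := by
  refine le_of_sq_le_sq ?_ (norm_nonneg _)
  rw [norm_sq_apply_eq_sum b T hT, mul_pow, ← b.sum_sq_norm_inner_right x, Finset.mul_sum]
  refine Finset.sum_le_sum fun k _ => ?_
  rcases lt_or_ge (k : ℕ) j with hk | hk
  · rw [mul_comm]
    gcongr
    exact hc k hk
  · simp [inner_eq_zero_of_mem_headSpan hx hk]

variable [FiniteDimensional 𝕜 E] [FiniteDimensional 𝕜 F]

theorem exists_rightSingularBasis {p : ℕ} (hp : finrank 𝕜 E = p) (T : E →ₗ[𝕜] F) :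
    ∃ b : OrthonormalBasis (Fin p) 𝕜 E, (∀ j k, j ≠ k → inner 𝕜 (T (b j)) (T (b k)) = 0) ∧
      ∀ j, ‖T (b j)‖ = T.singularValues j := by
  have key : ∀ j k, inner 𝕜 (T (T.isSymmetric_adjoint_comp_self.eigenvectorBasis hp j))
      (T (T.isSymmetric_adjoint_comp_self.eigenvectorBasis hp k)) =
      if j = k then ((T.singularValues j ^ 2 : ℝ) : 𝕜) else 0 := by
    intro j k
    rw [← LinearMap.adjoint_inner_left, ← LinearMap.comp_apply,
      T.isSymmetric_adjoint_comp_self.apply_eigenvectorBasis hp, inner_smul_left,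
      OrthonormalBasis.inner_eq_ite, T.sq_singularValues_fin hp]
    split_ifs <;> simp
  refine ⟨T.isSymmetric_adjoint_comp_self.eigenvectorBasis hp, fun j k h => ?_, fun j => ?_⟩
  · rw [key, if_neg h]
  · have h := key j j
    rw [if_pos rfl, inner_self_eq_norm_sq_to_K] at h
    have h' : ‖T (T.isSymmetric_adjoint_comp_self.eigenvectorBasis hp j)‖ ^ 2
      = T.singularValues j ^ 2 := by exact_mod_cast h
    exact (sq_eq_sq₀ (norm_nonneg _) (T.singularValues_nonneg _)).1 h'

/-- Lower half of Courant-Fischer: `U` is too large to avoid the orthogonal complement of the first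
`j` right singular vectors, where `T` stretches by at most its singular value of index `j`. -/
theorem le_singularValues_of_subspace (T : E →ₗ[𝕜] F) {U : Submodule 𝕜 E} {j : ℕ} {c : ℝ}
    (hU : j < finrank 𝕜 U) (h : ∀ x ∈ U, c * ‖x‖ ≤ ‖T x‖) : c ≤ T.singularValues j := by
  obtain ⟨b, hb, hn⟩ := exists_rightSingularBasis rfl T
  obtain ⟨x, hxU, hxS, hx0⟩ := exists_mem_inf_orthogonal (S := headSpan b j) (U := U)
    (by rw [finrank_headSpan]; omega)
  have h1 := norm_apply_le_of_mem_headSpan_orthogonal hb (T.singularValues_nonneg j)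
    (fun k hk => by rw [hn]; exact T.singularValues_antitone hk) hxS
  exact le_of_mul_le_mul_right ((h x hxU).trans h1) (norm_pos_iff.2 hx0)

/-- Upper half of Courant-Fischer: the span of the first `j + 1` right singular vectors must meet
`Sᗮ`. All perturbation bounds below are obtained by choosing `S` well. -/
theorem singularValues_le_of_subspace (T : E →ₗ[𝕜] F) {S : Submodule 𝕜 E} {j : ℕ} {c : ℝ}
    (hc : 0 ≤ c) (hS : finrank 𝕜 S ≤ j) (h : ∀ x ∈ Sᗮ, ‖T x‖ ≤ c * ‖x‖) :
    T.singularValues j ≤ c := by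
  rcases le_or_gt (finrank 𝕜 E) j with hj | hj
  · rwa [T.singularValues_of_finrank_le hj]
  obtain ⟨b, hb, hn⟩ := exists_rightSingularBasis rfl T
  obtain ⟨x, hxU, hxS, hx0⟩ := exists_mem_inf_orthogonal (S := S) (U := headSpan b (j + 1))
    (by rw [finrank_headSpan]; omega)
  have h1 := le_norm_apply_of_mem_headSpan hb (T.singularValues_nonneg j)
    (fun k hk => by rw [hn]; exact T.singularValues_antitone (Nat.lt_succ_iff.1 hk)) hxU
  exact le_of_mul_le_mul_right (h1.trans (h x hxS)) (norm_pos_iff.2 hx0)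

theorem singularValues_eq_norm {p : ℕ} (b : OrthonormalBasis (Fin p) 𝕜 E) (T : E →ₗ[𝕜] F)
    (hT : ∀ j k, j ≠ k → inner 𝕜 (T (b j)) (T (b k)) = 0) (hanti : Antitone fun j => ‖T (b j)‖)
    (j : Fin p) : T.singularValues j = ‖T (b j)‖ := by
  apply le_antisymm
  · refine singularValues_le_of_subspace T (norm_nonneg _) (S := headSpan b j)
      (by rw [finrank_headSpan]; omega) fun x hx => ?_
    exact norm_apply_le_of_mem_headSpan_orthogonal hT (norm_nonneg _) (fun k hk => hanti hk) hx
  · refine le_singularValues_of_subspace T (U := headSpan b (j + 1))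
      (by rw [finrank_headSpan]; omega) fun x hx => ?_
    exact le_norm_apply_of_mem_headSpan hT (norm_nonneg _)
      (fun k hk => hanti (Nat.lt_succ_iff.1 hk)) hx

theorem norm_apply_le_singularValues_zero (T : E →ₗ[𝕜] F) (x : E) :
    ‖T x‖ ≤ T.singularValues 0 * ‖x‖ := by
  obtain ⟨b, hb, hn⟩ := exists_rightSingularBasis rfl T
  refine norm_apply_le_of_mem_headSpan_orthogonal (j := 0) hb (T.singularValues_nonneg 0)
    (fun k hk => by rw [hn]; exact T.singularValues_antitone hk) ?_
  simp [headSpan]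

theorem singularValues_eq_zero_of_finrank_le (T : E →ₗ[𝕜] F) {j : ℕ} (hj : finrank 𝕜 F ≤ j) :
    T.singularValues j = 0 :=
  T.singularValues_eq_zero_iff_le_finrank_range.2 ((Submodule.finrank_le _).trans hj)

/-- The images of the right singular vectors are orthogonal; those that do not vanish are normalized
and completed to a basis `a`. At indices `j ≥ q` the singular value is zero, hence so is the image.
-/
theorem exists_svd {p q : ℕ} (hp : finrank 𝕜 E = p) (hq : finrank 𝕜 F = q) (T : E →ₗ[𝕜] F) :
    ∃ (b : OrthonormalBasis (Fin p) 𝕜 E) (a : OrthonormalBasis (Fin q) 𝕜 F),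
      ∀ j : Fin p, T (b j) = if h : (j : ℕ) < q then
        (T.singularValues j : 𝕜) • a ⟨j, h⟩ else 0 := by
  obtain ⟨b, hb, hn⟩ := exists_rightSingularBasis hp T
  have hrp : ∀ j : ℕ, 0 < T.singularValues j → j < p := by
    intro j hj
    by_contra! h
    exact hj.ne' (T.singularValues_of_finrank_le (hp.le.trans h))
  set v : Fin q → F := fun j => if h : (j : ℕ) < p then
    ((T.singularValues j)⁻¹ : 𝕜) • T (b ⟨j, h⟩) else 0 with hv
  have hvo : Orthonormal 𝕜 ({j : Fin q | 0 < T.singularValues j}.domRestrict v) := by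
    rw [orthonormal_iff_ite]
    rintro ⟨j, hj⟩ ⟨k, hk⟩
    simp only [Set.mem_ofPred_eq] at hj hk
    simp only [Set.domRestrict_apply, hv, dif_pos (hrp _ hj), dif_pos (hrp _ hk), inner_smul_left,
      inner_smul_right, Subtype.mk.injEq]
    split_ifs with h
    · subst h
      have : (T.singularValues j : 𝕜) ≠ 0 := by exact_mod_cast hj.ne'
      rw [inner_self_eq_norm_sq_to_K, hn]
      simp
      field_simp
    · rw [hb _ _ (fun hh => h (Fin.ext (by simpa using hh)))]
      ring
  obtain ⟨a, ha⟩ := hvo.exists_orthonormalBasis_extension_of_card_eq (by simpa using hq)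
  refine ⟨b, a, fun j => ?_⟩
  have hz : T.singularValues j = 0 → T (b j) = 0 := fun h => by rw [← norm_eq_zero, hn, h]
  split_ifs with h
  · rcases (T.singularValues_nonneg j).eq_or_lt with h0 | h0
    · rw [hz h0.symm, ← h0]; simp
    · have : (T.singularValues j : 𝕜) ≠ 0 := by exact_mod_cast h0.ne'
      rw [ha ⟨j, h⟩ h0]
      simp [hv, smul_smul, this]
  · exact hz (singularValues_eq_zero_of_finrank_le T (by omega))

end SingularValues

/-! ### Trace duality between the operator norm and the nuclear norm -/

section HilbertSchmidt

set_option linter.unusedSectionVars false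

variable {E : Type*} [NormedAddCommGroup E] [InnerProductSpace ℂ E] [FiniteDimensional ℂ E]
  {F : Type*} [NormedAddCommGroup F] [InnerProductSpace ℂ F] [FiniteDimensional ℂ F]

/-- The real part of the Hilbert-Schmidt inner product. -/
noncomputable def hs (T S : E →ₗ[ℂ] F) : ℝ :=
  (LinearMap.trace ℂ E (LinearMap.adjoint T ∘ₗ S)).re

theorem hs_eq_sum {ι : Type*} [Fintype ι] (b : OrthonormalBasis ι ℂ E) (T S : E →ₗ[ℂ] F) :
    hs T S = ∑ j, (inner ℂ (T (b j)) (S (b j))).re := by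
  rw [hs, LinearMap.trace_eq_sum_inner _ b, Complex.re_sum]
  simp [LinearMap.adjoint_inner_right]

theorem hs_comm (T S : E →ₗ[ℂ] F) : hs T S = hs S T := by
  rw [hs_eq_sum (stdOrthonormalBasis ℂ E), hs_eq_sum (stdOrthonormalBasis ℂ E)]
  exact Finset.sum_congr rfl fun j _ => by rw [← inner_conj_symm, Complex.conj_re]

theorem hs_add_right (T S R : E →ₗ[ℂ] F) : hs T (S + R) = hs T S + hs T R := by
  simp [hs, LinearMap.comp_add]

theorem hs_smul_right (c : ℝ) (T S : E →ₗ[ℂ] F) : hs T ((c : ℂ) • S) = c * hs T S := by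
  simp [hs, LinearMap.comp_smul]

theorem hs_add_left (T S R : E →ₗ[ℂ] F) : hs (T + S) R = hs T R + hs S R := by
  rw [hs_comm, hs_add_right, hs_comm R, hs_comm R]

theorem hs_smul_left (c : ℝ) (T S : E →ₗ[ℂ] F) : hs ((c : ℂ) • T) S = c * hs T S := by
  rw [hs_comm, hs_smul_right, hs_comm]

theorem hs_neg_right (T S : E →ₗ[ℂ] F) : hs T (-S) = -hs T S := by
  simp [hs, LinearMap.comp_neg]

theorem hs_neg_left (T S : E →ₗ[ℂ] F) : hs (-T) S = -hs T S := by
  rw [hs_comm, hs_neg_right, hs_comm]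

theorem hs_sub_right (T S R : E →ₗ[ℂ] F) : hs T (S - R) = hs T S - hs T R := by
  rw [sub_eq_add_neg, hs_add_right, hs_neg_right, sub_eq_add_neg]

theorem hs_self_eq_sum {ι : Type*} [Fintype ι] (b : OrthonormalBasis ι ℂ E) (T : E →ₗ[ℂ] F) :
    hs T T = ∑ j, ‖T (b j)‖ ^ 2 := by
  rw [hs_eq_sum b]
  refine Finset.sum_congr rfl fun j _ => ?_
  rw [inner_self_eq_norm_sq_to_K]
  norm_cast

theorem hs_self_nonneg (T : E →ₗ[ℂ] F) : 0 ≤ hs T T := by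
  rw [hs_self_eq_sum (stdOrthonormalBasis ℂ E)]
  positivity

theorem re_inner_le (x y : F) : (inner ℂ x y).re ≤ ‖x‖ * ‖y‖ :=
  re_inner_le_norm (𝕜 := ℂ) x y

theorem hs_le_sqrt_mul_sqrt (T S : E →ₗ[ℂ] F) : hs T S ≤ √(hs T T) * √(hs S S) := by
  have b := stdOrthonormalBasis ℂ E
  rw [hs_eq_sum b, hs_self_eq_sum b, hs_self_eq_sum b]
  exact (Finset.sum_le_sum fun j _ => re_inner_le _ _).trans
    (Real.sum_mul_le_sqrt_mul_sqrt _ _ _)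

theorem norm_apply_le_sqrt_hs (T : E →ₗ[ℂ] F) (x : E) : ‖T x‖ ≤ √(hs T T) * ‖x‖ := by
  refine (norm_apply_le_singularValues_zero T x).trans ?_
  gcongr
  obtain ⟨b, -, hn⟩ := exists_rightSingularBasis rfl T
  apply Real.le_sqrt_of_sq_le
  rw [hs_self_eq_sum b]
  rcases Nat.eq_zero_or_pos (finrank ℂ E) with h | h
  · rw [T.singularValues_of_finrank_le h.le, zero_pow two_ne_zero]
    exact Finset.sum_nonneg fun j _ => sq_nonneg _
  · have := Finset.single_le_sum (f := fun j => ‖T (b j)‖ ^ 2) (fun j _ => sq_nonneg _)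
      (Finset.mem_univ ⟨0, h⟩)
    simpa [hn] using this

/-- The nuclear norm of a linear map. -/
noncomputable def nuc (T : E →ₗ[ℂ] F) : ℝ := ∑ j ∈ Finset.range (finrank ℂ E), T.singularValues j

theorem nuc_nonneg (T : E →ₗ[ℂ] F) : 0 ≤ nuc T :=
  Finset.sum_nonneg fun j _ => T.singularValues_nonneg j

/-- Singular values beyond the smaller dimension are zero, so for `φ 0 = 0` the upper summation
limit is immaterial. This reconciles the limits `finrank ℂ E`, `min n₁ n₂` and `n₂` used in
different places. -/
theorem sum_range_singularValues {φ : ℝ → ℝ} (hφ : φ 0 = 0) (T : E →ₗ[ℂ] F) {K : ℕ}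
    (hK : min (finrank ℂ F) (finrank ℂ E) ≤ K) :
    ∑ j ∈ Finset.range (finrank ℂ E), φ (T.singularValues j) =
      ∑ j ∈ Finset.range K, φ (T.singularValues j) := by
  have hz : ∀ j, min (finrank ℂ F) (finrank ℂ E) ≤ j → φ (T.singularValues j) = 0 := by
    intro j hj
    rcases min_le_iff.1 hj with h | h
    · rw [singularValues_eq_zero_of_finrank_le T h, hφ]
    · rw [T.singularValues_of_finrank_le h, hφ]
  have h1 : ∀ L, min (finrank ℂ F) (finrank ℂ E) ≤ L →
      ∑ j ∈ Finset.range (min (finrank ℂ F) (finrank ℂ E)), φ (T.singularValues j) =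
      ∑ j ∈ Finset.range L, φ (T.singularValues j) := fun L hL =>
    Finset.sum_subset (Finset.range_subset_range.2 hL) fun j _ hj =>
      hz j (not_lt.1 fun h => hj (Finset.mem_range.2 h))
  rw [← h1 _ (min_le_right _ _), h1 K hK]

theorem nuc_eq_sum_basis {b : OrthonormalBasis (Fin (finrank ℂ E)) ℂ E} {T : E →ₗ[ℂ] F}
    (hn : ∀ j, ‖T (b j)‖ = T.singularValues j) : nuc T = ∑ j, ‖T (b j)‖ := by
  rw [nuc, Finset.sum_range]
  simp [hn]

theorem hs_le_mul_nuc {W : E →ₗ[ℂ] F} {c : ℝ} (hW : ∀ x, ‖W x‖ ≤ c * ‖x‖) (T : E →ₗ[ℂ] F) :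
    hs W T ≤ c * nuc T := by
  obtain ⟨b, -, hn⟩ := exists_rightSingularBasis rfl T
  rw [hs_eq_sum b, nuc_eq_sum_basis hn, Finset.mul_sum]
  refine Finset.sum_le_sum fun j _ => (re_inner_le _ _).trans ?_
  have := hW (b j)
  rw [b.norm_eq_one, mul_one] at this
  gcongr

theorem hs_le_nuc {W : E →ₗ[ℂ] F} (hW : ∀ x, ‖W x‖ ≤ ‖x‖) (T : E →ₗ[ℂ] F) :
    hs W T ≤ nuc T := by
  simpa using hs_le_mul_nuc (c := 1) (by simpa using hW) T

theorem hs_self_eq_sum_sq (T : E →ₗ[ℂ] F) :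
    hs T T = ∑ j ∈ Finset.range (finrank ℂ E), T.singularValues j ^ 2 := by
  obtain ⟨b, -, hn⟩ := exists_rightSingularBasis rfl T
  rw [hs_self_eq_sum b, Finset.sum_range]
  simp [hn]

/-- The first `m + 1` squared singular values are all at least the last of them. With `m` replaced
by `#σ₁^max - 1` this produces the `1/√m` in the radius. -/
theorem singularValues_le_sqrt_hs_div (T : E →ₗ[ℂ] F) (m : ℕ) :
    T.singularValues m ≤ √(hs T T) / √((m : ℝ) + 1) := by
  rw [← Real.sqrt_div (hs_self_nonneg T)]
  apply Real.le_sqrt_of_sq_le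
  rw [le_div_iff₀ (by positivity), hs_self_eq_sum_sq,
    sum_range_singularValues (φ := fun x => x ^ 2) (by simp) T
      -- The sum is padded with zeros so that it has at least `m + 1` terms even if `m` exceeds the
      -- dimension.
      (K := max (finrank ℂ E) (m + 1)) ((min_le_right _ _).trans (le_max_left _ _))]
  calc T.singularValues m ^ 2 * ((m : ℝ) + 1)
      = ∑ j ∈ Finset.range (m + 1), T.singularValues m ^ 2 := by
        simp; ring
    _ ≤ ∑ j ∈ Finset.range (m + 1), T.singularValues j ^ 2 := by
        refine Finset.sum_le_sum fun j hj => ?_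
        have := T.singularValues_nonneg m
        gcongr
        exact T.singularValues_antitone (Nat.lt_succ_iff.1 (Finset.mem_range.1 hj))
    _ ≤ _ := Finset.sum_le_sum_of_subset_of_nonneg
        (Finset.range_subset_range.2 (le_max_right _ _)) fun j _ _ => sq_nonneg _

section DiagMap

variable {p q : ℕ} (b : OrthonormalBasis (Fin p) ℂ E) (a : OrthonormalBasis (Fin q) ℂ F)

/-- The linear map `∑ j, c j • a j (b j)ᴴ`. -/
noncomputable def diagMap (c : ℕ → ℝ) : E →ₗ[ℂ] F :=
  b.toBasis.constr ℂ fun j => if h : (j : ℕ) < q then (c j : ℂ) • a ⟨j, h⟩ else 0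

theorem diagMap_basis (c : ℕ → ℝ) (j : Fin p) :
    diagMap b a c (b j) = if h : (j : ℕ) < q then (c j : ℂ) • a ⟨j, h⟩ else 0 := by
  rw [diagMap, ← b.coe_toBasis, Basis.constr_basis]

theorem eq_diagMap {T : E →ₗ[ℂ] F} {c : ℕ → ℝ}
    (hT : ∀ j : Fin p, T (b j) = if h : (j : ℕ) < q then (c j : ℂ) • a ⟨j, h⟩ else 0) :
    T = diagMap b a c :=
  b.toBasis.ext fun j => by rw [b.coe_toBasis, hT, diagMap_basis]

theorem diagMap_add (c d : ℕ → ℝ) :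
    diagMap b a (fun j => c j + d j) = diagMap b a c + diagMap b a d := by
  symm
  refine eq_diagMap b a fun j => ?_
  rw [LinearMap.add_apply, diagMap_basis, diagMap_basis]
  split_ifs <;> simp [add_smul]

theorem diagMap_smul (t : ℝ) (c : ℕ → ℝ) :
    diagMap b a (fun j => t * c j) = (t : ℂ) • diagMap b a c := by
  symm
  refine eq_diagMap b a fun j => ?_
  rw [LinearMap.smul_apply, diagMap_basis]
  split_ifs
  · rw [smul_smul, Complex.ofReal_mul]
  · simp

theorem norm_diagMap_basis_le (c : ℕ → ℝ) (j : Fin p) : ‖diagMap b a c (b j)‖ ≤ |c j| := by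
  rw [diagMap_basis]
  split_ifs
  · simp [norm_smul]
  · simp

theorem inner_diagMap_basis (c : ℕ → ℝ) (j k : Fin p) (h : j ≠ k) :
    inner ℂ (diagMap b a c (b j)) (diagMap b a c (b k)) = 0 := by
  rw [diagMap_basis, diagMap_basis]
  split_ifs <;> simp [OrthonormalBasis.inner_eq_ite]
  rintro h'
  exact absurd (Fin.ext h') h

theorem norm_diagMap_le {c : ℕ → ℝ} {t : ℝ} (ht : 0 ≤ t) (hc : ∀ j < min q p, |c j| ≤ t) (x : E) :
    ‖diagMap b a c x‖ ≤ t * ‖x‖ := by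
  refine norm_apply_le_of_mem_headSpan_orthogonal (j := 0) (b := b)
    (inner_diagMap_basis b a c) ht (fun k _ => ?_) (by simp [headSpan])
  rw [diagMap_basis]
  split_ifs with h
  · simpa [norm_smul] using hc k (lt_min h k.2)
  · simpa using ht

theorem sum_fin_dite {φ : (j : Fin p) → (j : ℕ) < q → ℝ} {ψ : ℕ → ℝ}
    (h : ∀ j hj, φ j hj = ψ j) :
    ∑ j : Fin p, (if hj : (j : ℕ) < q then φ j hj else 0) = ∑ j ∈ Finset.range (min q p), ψ j := by
  have h1 : ∀ j : Fin p, (if hj : (j : ℕ) < q then φ j hj else 0) =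
      (fun j : ℕ => if j < q then ψ j else 0) j := by
    intro j
    by_cases hj : (j : ℕ) < q <;> simp [hj, h]
  rw [Finset.sum_congr rfl fun j _ => h1 j,
    ← Finset.sum_range (fun j : ℕ => if j < q then ψ j else 0), ← Finset.sum_filter]
  congr 1
  ext j
  simp [and_comm]

theorem hs_diagMap_diagMap (c d : ℕ → ℝ) :
    hs (diagMap b a c) (diagMap b a d) = ∑ j ∈ Finset.range (min q p), c j * d j := by
  rw [hs_eq_sum b, ← sum_fin_dite (φ := fun j _ => c j * d j) (fun _ _ => rfl)]
  refine Finset.sum_congr rfl fun j _ => ?_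
  rw [diagMap_basis, diagMap_basis]
  split_ifs
  · simp [inner_self_eq_norm_sq_to_K, mul_comm]
  · simp

theorem hs_diagMap_le {W : E →ₗ[ℂ] F} (hW : ∀ x, ‖W x‖ ≤ ‖x‖) {c : ℕ → ℝ} (hc : ∀ j, 0 ≤ c j) :
    hs W (diagMap b a c) ≤ ∑ j ∈ Finset.range (min q p), c j := by
  rw [hs_eq_sum b, ← sum_fin_dite (φ := fun j _ => c j) (fun _ _ => rfl)]
  refine Finset.sum_le_sum fun j _ => ?_
  rw [diagMap_basis]
  split_ifs with h
  · refine (re_inner_le _ _).trans ?_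
    rw [norm_smul, a.norm_eq_one, mul_one, Complex.norm_real, Real.norm_of_nonneg (hc _)]
    have := hW (b j)
    rw [b.norm_eq_one] at this
    exact mul_le_of_le_one_left (hc _) this
  · simp

end DiagMap

theorem exists_eq_diagMap (T : E →ₗ[ℂ] F) :
    ∃ (b : OrthonormalBasis (Fin (finrank ℂ E)) ℂ E) (a : OrthonormalBasis (Fin (finrank ℂ F)) ℂ F),
      T = diagMap b a T.singularValues := by
  obtain ⟨b, a, h⟩ := exists_svd rfl rfl T
  exact ⟨b, a, eq_diagMap b a h⟩

theorem exists_hs_eq_nuc (T : E →ₗ[ℂ] F) :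
    ∃ W : E →ₗ[ℂ] F, (∀ x, ‖W x‖ ≤ ‖x‖) ∧ hs W T = nuc T := by
  obtain ⟨b, a, h⟩ := exists_eq_diagMap T
  refine ⟨diagMap b a fun _ => 1, fun x => ?_, ?_⟩
  · simpa using norm_diagMap_le b a zero_le_one (by simp) x
  · conv_lhs => rw [h]
    rw [hs_diagMap_diagMap, nuc, sum_range_singularValues (φ := fun x => x) rfl T le_rfl]
    simp

/-- The nuclear norm is a maximum of the linear functionals `hs W` over contractions `W`, so the
triangle inequality, scaling and all later upper bounds reduce to linear estimates. -/
theorem nuc_le_of_forall_hs_le {T : E →ₗ[ℂ] F} {t : ℝ}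
    (h : ∀ W : E →ₗ[ℂ] F, (∀ x, ‖W x‖ ≤ ‖x‖) → hs W T ≤ t) : nuc T ≤ t := by
  obtain ⟨W, hW, hWT⟩ := exists_hs_eq_nuc T
  exact hWT ▸ h W hW

theorem nuc_add_le (T S : E →ₗ[ℂ] F) : nuc (T + S) ≤ nuc T + nuc S :=
  nuc_le_of_forall_hs_le fun W hW => by
    rw [hs_add_right]
    exact add_le_add (hs_le_nuc hW T) (hs_le_nuc hW S)

theorem nuc_smul_le {c : ℝ} (hc : 0 ≤ c) (T : E →ₗ[ℂ] F) : nuc ((c : ℂ) • T) ≤ c * nuc T :=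
  nuc_le_of_forall_hs_le fun W hW => by
    rw [hs_smul_right]
    exact mul_le_mul_of_nonneg_left (hs_le_nuc hW T) hc

theorem nuc_diagMap_le {p q : ℕ} (b : OrthonormalBasis (Fin p) ℂ E)
    (a : OrthonormalBasis (Fin q) ℂ F) {c : ℕ → ℝ} (hc : ∀ j, 0 ≤ c j) :
    nuc (diagMap b a c) ≤ ∑ j ∈ Finset.range (min q p), c j :=
  nuc_le_of_forall_hs_le fun _ hW => hs_diagMap_le b a hW hc

/-- A duality bound for the sum of the singular values after soft thresholding by `s`. -/
theorem hs_le_sum_threshold {W : E →ₗ[ℂ] F} (hW : ∀ x, ‖W x‖ ≤ ‖x‖) (T : E →ₗ[ℂ] F) {s : ℝ}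
    (hs0 : 0 ≤ s) :
    hs W T ≤ ∑ j ∈ Finset.range (finrank ℂ E), max 0 (T.singularValues j - s) + s * nuc W := by
  obtain ⟨b, a, h⟩ := exists_eq_diagMap T
  -- Each singular value is `σ = max 0 (σ - s) + min σ s`. The first part is tested against the
  -- contraction `W`; the second has operator norm at most `s` and is paired with `nuc W`.
  have hsplit : T = diagMap b a (fun j => max 0 (T.singularValues j - s)) +
      diagMap b a (fun j => min (T.singularValues j) s) := by
    rw [← diagMap_add]
    conv_lhs => rw [h]
    congr 1
    ext j
    rcases le_total (T.singularValues j) s with h1 | h1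
    · rw [min_eq_left h1, max_eq_left (by linarith)]; ring
    · rw [min_eq_right h1, max_eq_right (by linarith)]; ring
  rw [sum_range_singularValues (φ := fun x => max 0 (x - s)) (by simpa using hs0) T le_rfl]
  conv_lhs => rw [hsplit, hs_add_right]
  refine add_le_add (hs_diagMap_le b a hW fun j => le_max_left _ _) ?_
  rw [hs_comm]
  refine hs_le_mul_nuc (norm_diagMap_le b a hs0 fun j _ => ?_) W
  rw [abs_of_nonneg (le_min (T.singularValues_nonneg j) hs0)]
  exact min_le_right _ _

end HilbertSchmidt

/-! ### Equality in trace duality, and positivity of factors -/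

section Contraction

set_option linter.unusedSectionVars false

variable {E : Type*} [NormedAddCommGroup E] [InnerProductSpace ℂ E] [FiniteDimensional ℂ E]
  {F : Type*} [NormedAddCommGroup F] [InnerProductSpace ℂ F] [FiniteDimensional ℂ F]

theorem norm_sub_sq_re (x y : F) : ‖x - y‖ ^ 2 = ‖x‖ ^ 2 - 2 * (inner ℂ x y).re + ‖y‖ ^ 2 :=
  norm_sub_sq (𝕜 := ℂ) x y

theorem norm_adjoint_le {W : E →ₗ[ℂ] F} (hW : ∀ x, ‖W x‖ ≤ ‖x‖) (y : F) :
    ‖LinearMap.adjoint W y‖ ≤ ‖y‖ := by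
  have h1 : ‖LinearMap.adjoint W y‖ ^ 2 ≤ ‖y‖ * ‖LinearMap.adjoint W y‖ := by
    have h2 : ‖LinearMap.adjoint W y‖ ^ 2 = (inner ℂ y (W (LinearMap.adjoint W y))).re := by
      rw [← LinearMap.adjoint_inner_left, inner_self_eq_norm_sq_to_K]
      norm_cast
    rw [h2]
    exact (re_inner_le _ _).trans (by gcongr; exact hW _)
  rcases (norm_nonneg (LinearMap.adjoint W y)).eq_or_lt with h | h
  · rw [← h]; positivity
  · nlinarith

theorem adjoint_comp_self_apply_of_norm_eq {W : E →ₗ[ℂ] F} (hW : ∀ x, ‖W x‖ ≤ ‖x‖) {x : E}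
    (hx : ‖x‖ ≤ ‖W x‖) : LinearMap.adjoint W (W x) = x := by
  have h1 := norm_sub_sq_re (LinearMap.adjoint W (W x)) x
  rw [LinearMap.adjoint_inner_left, inner_self_eq_norm_sq_to_K] at h1
  have h2 : ((((‖W x‖ : ℝ) : ℂ)) ^ 2).re = ‖W x‖ ^ 2 := by norm_cast
  have h3 := norm_adjoint_le hW (W x)
  have h4 := hW x
  have h5 : ‖LinearMap.adjoint W (W x) - x‖ ^ 2 ≤ 0 := by
    erw [h1, h2]
    nlinarith [norm_nonneg (LinearMap.adjoint W (W x)), norm_nonneg (W x)]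
  rw [← sub_eq_zero, ← norm_eq_zero]
  exact pow_eq_zero_iff two_ne_zero |>.1 (le_antisymm h5 (sq_nonneg _))

theorem diagMap_self_basis {p : ℕ} (b : OrthonormalBasis (Fin p) ℂ E) (c : ℕ → ℝ) (j : Fin p) :
    diagMap b b c (b j) = (c j : ℂ) • b j := by
  rw [diagMap_basis, dif_pos j.2]

theorem diagMap_self_isSymmetric {p : ℕ} (b : OrthonormalBasis (Fin p) ℂ E) (c : ℕ → ℝ) :
    (diagMap b b c).IsSymmetric := by
  rw [LinearMap.isSymmetric_iff_isSelfAdjoint, LinearMap.isSelfAdjoint_iff']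
  refine ((LinearMap.eq_adjoint_iff_basis b.toBasis b.toBasis _ _).2 fun j k => ?_).symm
  simp only [OrthonormalBasis.coe_toBasis, diagMap_self_basis, inner_smul_left, inner_smul_right,
    OrthonormalBasis.inner_eq_ite]
  split_ifs with h
  · subst h; simp
  · simp

theorem inner_diagMap_self {p : ℕ} (b : OrthonormalBasis (Fin p) ℂ E) (c : ℕ → ℝ) (x : E) :
    (inner ℂ (diagMap b b c x) x).re = ∑ j : Fin p, c j * ‖inner ℂ (b j) x‖ ^ 2 := by
  conv_lhs => rw [← b.sum_inner_mul_inner]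
  rw [Complex.re_sum]
  refine Finset.sum_congr rfl fun j _ => ?_
  rw [diagMap_self_isSymmetric, diagMap_self_basis, inner_smul_right, mul_assoc,
    ← inner_conj_symm x (b j)]
  have : (starRingEnd ℂ) (inner ℂ (b j) x) * inner ℂ (b j) x =
    ((‖inner ℂ (b j) x‖ ^ 2 : ℝ) : ℂ) := by rw [RCLike.conj_mul]; norm_cast
  rw [this, ← Complex.ofReal_mul, Complex.ofReal_re]

theorem diagMap_self_isPositive {p : ℕ} (b : OrthonormalBasis (Fin p) ℂ E) {c : ℕ → ℝ}
    (hc : ∀ j, 0 ≤ c j) : (diagMap b b c).IsPositive := by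
  refine ⟨diagMap_self_isSymmetric b c, fun x => ?_⟩
  have := inner_diagMap_self b c x
  simp only [RCLike.re_to_complex, this]
  exact Finset.sum_nonneg fun j _ => mul_nonneg (hc _) (sq_nonneg _)

theorem IsPositive.apply_eq_zero {H : E →ₗ[ℂ] E} (hH : H.IsPositive) {x : E}
    (hx : (inner ℂ (H x) x).re = 0) : H x = 0 := by
  by_contra h
  have ha : 0 < ‖H x‖ ^ 2 := by positivity
  set a := ‖H x‖ ^ 2
  set c := (inner ℂ (H (H x)) (H x)).re with hc
  have hc0 : 0 ≤ c := hH.2 (H x)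
  have key : ∀ t : ℝ, 0 ≤ 2 * t * a + t ^ 2 * c := by
    intro t
    have h1 := hH.2 (x + (t : ℂ) • H x)
    have h2 : inner ℂ (H x) (H x) = (a : ℂ) := by
      rw [inner_self_eq_norm_sq_to_K]; norm_cast
    have h3 : inner ℂ (H (H x)) x = (a : ℂ) := by rw [hH.1, h2]
    simp only [map_add, map_smul, inner_add_left, inner_add_right, inner_smul_left,
      inner_smul_right, h2, h3, RCLike.re_to_complex, Complex.add_re, hx, Complex.conj_ofReal,
      Complex.re_ofReal_mul, Complex.ofReal_re, ← hc] at h1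
    linarith
  -- Near the minimizer `-a / c` of the quadratic; the `+ 1` covers `c = 0`. The value there is
  -- negative when `a > 0`.
  have h1 := key (-(a / (c + 1)))
  have h2 : a / (c + 1) * (c + 1) = a := by field_simp
  set t := a / (c + 1)
  have ht : 0 < t := by positivity
  nlinarith

/-- If a contraction `W` is dual to `T` for the nuclear norm, then `T = W H` with `H` positive and
supported in the subspace on which `W` is isometric. -/
theorem exists_factor_of_hs_eq_nuc {W T : E →ₗ[ℂ] F} (hW : ∀ x, ‖W x‖ ≤ ‖x‖)
    (h : hs W T = nuc T) :
    ∃ H : E →ₗ[ℂ] E, H.IsPositive ∧ T = W ∘ₗ H ∧ LinearMap.adjoint W ∘ₗ W ∘ₗ H = H := by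
  obtain ⟨b, -, hn⟩ := exists_rightSingularBasis rfl T
  have hle : ∀ j, (inner ℂ (W (b j)) (T (b j))).re ≤ ‖T (b j)‖ := by
    intro j
    refine (re_inner_le _ _).trans (mul_le_of_le_one_left (norm_nonneg _) ?_)
    simpa using hW (b j)
  rw [hs_eq_sum b, nuc_eq_sum_basis hn] at h
  have heq := (Finset.sum_eq_sum_iff_of_le fun j _ => hle j).1 h
  -- Equality holds termwise, and equality in Cauchy-Schwarz with `‖W (b j)‖ ≤ 1` forces `T (b j)`
  -- to be the multiple `σ_j W (b j)`. So `H` can be taken as the modulus of `T`.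
  have hT : ∀ j, T (b j) = (T.singularValues j : ℂ) • W (b j) := by
    intro j
    have h1 := norm_sub_sq_re ((T.singularValues j : ℂ) • W (b j)) (T (b j))
    have hb : ‖W (b j)‖ ≤ 1 := by simpa using hW (b j)
    have h0 := T.singularValues_nonneg j
    rw [inner_smul_left, Complex.conj_ofReal, Complex.re_ofReal_mul, heq j (Finset.mem_univ j),
      norm_smul, Complex.norm_real, Real.norm_of_nonneg h0, hn, mul_pow] at h1
    have h2 : ‖(T.singularValues j : ℂ) • W (b j) - T (b j)‖ ^ 2 ≤ 0 := by
      rw [h1]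
      have : T.singularValues j ^ 2 * ‖W (b j)‖ ^ 2 ≤ T.singularValues j ^ 2 * 1 := by
        gcongr
        exact pow_le_one₀ (norm_nonneg _) hb
      nlinarith
    symm
    rw [← sub_eq_zero, ← norm_eq_zero]
    exact pow_eq_zero_iff two_ne_zero |>.1 (le_antisymm h2 (sq_nonneg _))
  refine ⟨diagMap b b T.singularValues, diagMap_self_isPositive b T.singularValues_nonneg,
    b.toBasis.ext fun j => ?_, b.toBasis.ext fun j => ?_⟩
  · simp [diagMap_self_basis, hT]
  · simp only [OrthonormalBasis.coe_toBasis, LinearMap.comp_apply, diagMap_self_basis, map_smul]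
    rcases (T.singularValues_nonneg j).eq_or_lt with h0 | h0
    · simp [← h0]
    · rw [adjoint_comp_self_apply_of_norm_eq hW]
      have h1 := hn j
      rw [hT, norm_smul, Complex.norm_real, Real.norm_of_nonneg h0.le] at h1
      rw [b.norm_eq_one]
      exact (mul_right_eq_self₀.1 h1).elim (fun h => h.ge) (fun h => absurd h h0.ne')

/-- Converse of the factorization: in an eigenbasis of `H`, vectors with nonzero eigenvalue are
fixed by `W* W`, so each summand of `hs W (W H)` is the full eigenvalue. -/
theorem nuc_comp_le_hs {W : E →ₗ[ℂ] F} (hW : ∀ x, ‖W x‖ ≤ ‖x‖) {H : E →ₗ[ℂ] E}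
    (hH : H.IsPositive) (hWH : LinearMap.adjoint W ∘ₗ W ∘ₗ H = H) :
    nuc (W ∘ₗ H) ≤ hs W (W ∘ₗ H) := by
  refine nuc_le_of_forall_hs_le fun V hV => ?_
  have b := hH.1.eigenvectorBasis rfl
  rw [hs_eq_sum (hH.1.eigenvectorBasis rfl), hs_eq_sum (hH.1.eigenvectorBasis rfl)]
  refine Finset.sum_le_sum fun j _ => ?_
  have h0 := hH.nonneg_eigenvalues rfl j
  have h1 : inner ℂ (W (hH.1.eigenvectorBasis rfl j)) ((W ∘ₗ H) (hH.1.eigenvectorBasis rfl j)) =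
      ((hH.1.eigenvalues rfl j : ℝ) : ℂ) := by
    rw [← LinearMap.adjoint_inner_right]
    have h2 := LinearMap.congr_fun hWH (hH.1.eigenvectorBasis rfl j)
    simp only [LinearMap.comp_apply] at h2 ⊢
    rw [h2, hH.1.apply_eigenvectorBasis, inner_smul_right, inner_self_eq_norm_sq_to_K,
      OrthonormalBasis.norm_eq_one]
    simp
  rw [h1, LinearMap.comp_apply, hH.1.apply_eigenvectorBasis, map_smul]
  refine (re_inner_le _ _).trans ?_
  have hV' := hV (hH.1.eigenvectorBasis rfl j)
  have hW' := hW (hH.1.eigenvectorBasis rfl j)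
  rw [OrthonormalBasis.norm_eq_one] at hV' hW'
  rw [norm_smul, Complex.ofReal_re]
  have : ‖((hH.1.eigenvalues rfl j : ℝ) : ℂ)‖ = hH.1.eigenvalues rfl j := by
    rw [Complex.norm_real, Real.norm_of_nonneg h0]
  erw [this]
  have h3 : hH.1.eigenvalues rfl j * ‖W (hH.1.eigenvectorBasis rfl j)‖ ≤
      hH.1.eigenvalues rfl j := mul_le_of_le_one_right h0 hW'
  calc _ ≤ 1 * (hH.1.eigenvalues rfl j * ‖W (hH.1.eigenvectorBasis rfl j)‖) := by gcongr
    _ ≤ _ := by linarith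

/-- A positive operator that is definite on a subspace containing its range stays positive
under small symmetric perturbations supported in that subspace. -/
theorem exists_isPositive_add_smul {V : Submodule ℂ E} {H K : E →ₗ[ℂ] E} (hH : H.IsPositive)
    (hK : K.IsSymmetric) (hHV : ∀ x, H x ∈ V) (hKV : ∀ x, K x ∈ V)
    (hV : ∀ x ∈ V, H x = 0 → x = 0) :
    ∃ ε : ℝ, 0 < ε ∧ ∀ t : ℝ, 0 ≤ t → t ≤ ε → (H + (t : ℂ) • K).IsPositive := by
  have : ProperSpace E := FiniteDimensional.proper ℂ E
  have hHc : Continuous H := LinearMap.continuous_of_finiteDimensional H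
  obtain ⟨κ, hκ, hκV⟩ : ∃ κ : ℝ, 0 < κ ∧ ∀ x ∈ V, κ * ‖x‖ ^ 2 ≤ (inner ℂ (H x) x).re := by
    have hcomp : IsCompact (Metric.sphere (0 : E) 1 ∩ (V : Set E)) :=
      (isCompact_sphere 0 1).inter_right V.closed_of_finiteDimensional
    have hcont : ContinuousOn (fun x => (inner ℂ (H x) x).re)
        (Metric.sphere (0 : E) 1 ∩ (V : Set E)) := by fun_prop
    have hscale : ∀ κ : ℝ, (∀ x ∈ Metric.sphere (0 : E) 1 ∩ (V : Set E),
        κ ≤ (inner ℂ (H x) x).re) → ∀ x ∈ V, κ * ‖x‖ ^ 2 ≤ (inner ℂ (H x) x).re := by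
      intro κ h x hx
      rcases eq_or_ne x 0 with rfl | hx0
      · simp
      · have hn : ‖x‖ ≠ 0 := norm_ne_zero_iff.2 hx0
        have h1 := h (((‖x‖⁻¹ : ℝ) : ℂ) • x) ⟨by simp [norm_smul, hn], V.smul_mem _ hx⟩
        rw [map_smul, inner_smul_left, inner_smul_right, Complex.conj_ofReal,
          Complex.re_ofReal_mul, Complex.re_ofReal_mul] at h1
        have h2 : 0 < ‖x‖ := by positivity
        calc κ * ‖x‖ ^ 2 ≤ ‖x‖⁻¹ * (‖x‖⁻¹ * (inner ℂ (H x) x).re) * ‖x‖ ^ 2 := by gcongr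
          _ = _ := by field_simp
    rcases (Metric.sphere (0 : E) 1 ∩ (V : Set E)).eq_empty_or_nonempty with he | hne
    -- The unit sphere of `V` is empty only for `V = 0`, where any constant serves.
    · exact ⟨1, one_pos, hscale 1 (by simp [he])⟩
    · obtain ⟨x₀, hx₀, hmin⟩ := hcomp.exists_isMinOn hne hcont
      refine ⟨_, lt_of_le_of_ne (hH.2 x₀) fun h0 => ?_, hscale _ fun x hx => hmin hx⟩
      have := hV x₀ hx₀.2 (IsPositive.apply_eq_zero hH h0.symm)
      simp [this] at hx₀
  set M := √(hs K K)
  have hM : ∀ x, -(M * ‖x‖ ^ 2) ≤ (inner ℂ (K x) x).re := by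
    intro x
    have h1 := re_inner_le (-(K x)) x
    rw [inner_neg_left, norm_neg, Complex.neg_re] at h1
    have h2 := norm_apply_le_sqrt_hs K x
    nlinarith [norm_nonneg x]
  refine ⟨κ / (M + 1), by positivity, fun t ht0 ht => ?_⟩
  have hsymm : (H + (t : ℂ) • K).IsSymmetric := by
    intro x y
    rw [LinearMap.add_apply, LinearMap.add_apply, LinearMap.smul_apply, LinearMap.smul_apply,
      inner_add_left, inner_add_right, inner_smul_left, inner_smul_right, hH.1 x y, hK x y,
      Complex.conj_ofReal]
  refine ⟨hsymm, fun x => ?_⟩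
  obtain ⟨y, hy, z, hz, rfl⟩ := V.exists_add_mem_mem_orthogonal x
  have hzero : ∀ L : E →ₗ[ℂ] E, L.IsSymmetric → (∀ x, L x ∈ V) → L z = 0 := by
    intro L hL hLV
    -- A symmetric map with range in `V` kills `Vᗮ`, so only the component in `V` matters.
    rw [← inner_self_eq_zero (𝕜 := ℂ), hL]
    exact Submodule.inner_left_of_mem_orthogonal (hLV _) hz
  have hz' : (H + (t : ℂ) • K) z = 0 := by
    simp [hzero H hH.1 hHV, hzero K hK hKV]
  have hyz : inner ℂ ((H + (t : ℂ) • K) (y + z)) (y + z) =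
      inner ℂ ((H + (t : ℂ) • K) y) y := by
    rw [map_add, hz', add_zero, inner_add_right, hsymm y z, hz', inner_zero_right, add_zero]
  rw [hyz, LinearMap.add_apply, LinearMap.smul_apply, inner_add_left, inner_smul_left,
    Complex.conj_ofReal, RCLike.re_to_complex, Complex.add_re, Complex.re_ofReal_mul]
  have h1 := hκV y hy
  have h2 := hM y
  have h3 : t * (M + 1) ≤ κ := by rwa [le_div_iff₀ (by positivity)] at ht
  have hM0 : 0 ≤ M := Real.sqrt_nonneg _
  have h4 : t * (M * ‖y‖ ^ 2) ≤ κ * ‖y‖ ^ 2 := by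
    nlinarith [sq_nonneg ‖y‖, mul_nonneg ht0 (sq_nonneg ‖y‖)]
  nlinarith

end Contraction

/-! ### Approximate alignment with a contraction -/

section ErrorBound

variable {E : Type*} [NormedAddCommGroup E] [InnerProductSpace ℂ E] [FiniteDimensional ℂ E]
  {F : Type*} [NormedAddCommGroup F] [InnerProductSpace ℂ F] [FiniteDimensional ℂ F]

/-- The orthogonal projection `P` onto the subspace where the contraction `W` is isometric, with a
quantitative gap on the orthogonal complement. -/
theorem exists_isometric_projection {W : E →ₗ[ℂ] F} (hW : ∀ x, ‖W x‖ ≤ ‖x‖) :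
    ∃ (κ : ℝ) (P : E →ₗ[ℂ] E), 0 < κ ∧ P.IsSymmetric ∧ LinearMap.adjoint W ∘ₗ W ∘ₗ P = P ∧
      (∀ x, ‖P x‖ ≤ ‖x‖) ∧ ∀ x, κ * ‖x - P x‖ ^ 2 ≤ ‖x‖ ^ 2 - ‖W x‖ ^ 2 := by
  classical
  obtain ⟨b, hb, hn⟩ := exists_rightSingularBasis rfl W
  -- The singular values are eventually zero, so a first one below 1 exists; `P` projects onto the
  -- vectors before it and the gap is `κ = 1 - σ_m²`.
  have hex : ∃ j, W.singularValues j < 1 :=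
    ⟨_, by rw [W.singularValues_of_finrank_le le_rfl]; exact one_pos⟩
  set m := Nat.find hex
  have hm : W.singularValues m < 1 := Nat.find_spec hex
  have hlt : ∀ j < m, 1 ≤ W.singularValues j := fun j hj => not_lt.1 (Nat.find_min hex hj)
  have hσ : ∀ j : Fin (finrank ℂ E), W.singularValues j ≤ 1 := by
    intro j
    simpa [hn] using hW (b j)
  set P := diagMap b b fun j => if j < m then 1 else 0
  set Q := diagMap b b fun j => if j < m then 0 else 1
  have hPQ : ∀ x, x - P x = Q x := by
    intro x
    have h1 : (LinearMap.id : E →ₗ[ℂ] E) = P + Q := by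
      rw [← diagMap_add]
      refine eq_diagMap b b fun j => ?_
      rw [dif_pos j.2]
      split_ifs <;> simp
    have h2 := LinearMap.congr_fun h1 x
    simp only [LinearMap.id_apply, LinearMap.add_apply] at h2
    nth_rewrite 1 [h2]
    abel
  refine ⟨1 - W.singularValues m ^ 2, P, ?_, diagMap_self_isSymmetric b _,
    b.toBasis.ext fun j => ?_, fun x => ?_, fun x => ?_⟩
  · nlinarith [W.singularValues_nonneg m]
  · simp only [OrthonormalBasis.coe_toBasis, LinearMap.comp_apply, P, diagMap_self_basis, map_smul]
    split_ifs with h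
    · rw [adjoint_comp_self_apply_of_norm_eq hW]
      rw [hn, b.norm_eq_one]
      exact hlt j h
    · simp
  · simpa using norm_diagMap_le b b (c := fun j => if j < m then 1 else 0) zero_le_one
      (fun j _ => by split_ifs <;> simp) x
  · rw [hPQ, norm_sq_apply_eq_sum b W hb, norm_sq_apply_eq_sum b Q (inner_diagMap_basis b b _),
      ← b.sum_sq_norm_inner_right x, Finset.mul_sum, ← Finset.sum_sub_distrib]
    refine Finset.sum_le_sum fun j _ => ?_
    rw [hn]
    simp only [Q, diagMap_self_basis]
    have h0 := W.singularValues_nonneg j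
    have h2 := sq_nonneg ‖inner ℂ (b j) x‖
    split_ifs with h
    · have := hσ j
      simp only [Complex.ofReal_zero, zero_smul, norm_zero]
      have h3 : W.singularValues j ^ 2 ≤ 1 := pow_le_one₀ h0 this
      nlinarith
    · have h3 : W.singularValues j ≤ W.singularValues m := W.singularValues_antitone (not_lt.1 h)
      have h4 : W.singularValues j ^ 2 ≤ W.singularValues m ^ 2 := by gcongr
      simp only [Complex.ofReal_one, one_smul, b.norm_eq_one]
      nlinarith

theorem hs_comp_conj (Q W : E →ₗ[ℂ] F) {P A : E →ₗ[ℂ] E} (hP : P.IsSymmetric) :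
    hs Q (W ∘ₗ P ∘ₗ A ∘ₗ P) = hs (Q ∘ₗ P) (W ∘ₗ P ∘ₗ A) := by
  have hadj : LinearMap.adjoint P = P :=
    LinearMap.isSelfAdjoint_iff'.1 ((LinearMap.isSymmetric_iff_isSelfAdjoint _).1 hP)
  rw [hs, hs, LinearMap.adjoint_comp, hadj, ← LinearMap.comp_assoc, ← LinearMap.comp_assoc, ← LinearMap.comp_assoc,
    LinearMap.trace_comp_comm']
  simp only [LinearMap.comp_assoc]

/-- Approximate alignment: if `hs W T` is close to the nuclear norm of `T`, then `T` is close to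
the linear span of the face exposed by the contraction `W`. -/
theorem exists_factor_dist_le {W : E →ₗ[ℂ] F} (hW : ∀ x, ‖W x‖ ≤ ‖x‖) :
    ∃ K : ℝ, 0 ≤ K ∧ ∀ T : E →ₗ[ℂ] F, ∃ H : E →ₗ[ℂ] E, H.IsSymmetric ∧
      LinearMap.adjoint W ∘ₗ W ∘ₗ H = H ∧
      hs (T - W ∘ₗ H) (T - W ∘ₗ H) ≤ K * (nuc T * (nuc T - hs W T)) := by
  obtain ⟨κ, P, hκ, hP, hWP, hP1, hgap⟩ := exists_isometric_projection hW
  set C := √2 + 2 * √(2 / κ) with hC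
  refine ⟨C ^ 2, sq_nonneg _, fun T => ?_⟩
  obtain ⟨b, -, hn⟩ := exists_rightSingularBasis rfl T
  -- `A` is the modulus of `T`. Exact alignment would give `T = W A`; compressing `A` by `P` on both
  -- sides puts the factor into the isometric subspace of `W`.
  set A := diagMap b b T.singularValues
  refine ⟨P ∘ₗ A ∘ₗ P, ?_, ?_, ?_⟩
  · intro x y
    simp only [LinearMap.comp_apply]
    rw [hP, diagMap_self_isSymmetric, hP]
  · rw [← LinearMap.comp_assoc, ← LinearMap.comp_assoc, LinearMap.comp_assoc (f := P), hWP]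
  set R := T - W ∘ₗ P ∘ₗ A ∘ₗ P with hR
  set q := √(hs R R)
  -- The deficits `e j` add up to `nuc T - hs W T`. Each controls two errors at `b j`, of order
  -- `√(σ_j e_j)`: the distance of `b j` from the range of `P` scaled by `σ_j`, and that of `T (b
  -- j)` from `σ_j W (b j)`.
  set e : Fin (finrank ℂ E) → ℝ := fun j => ‖T (b j)‖ - (inner ℂ (W (b j)) (T (b j))).re with he
  have hWb : ∀ j, ‖W (b j)‖ ≤ 1 := fun j => by simpa using hW (b j)
  have he0 : ∀ j, 0 ≤ e j := by
    intro j
    have := re_inner_le (W (b j)) (T (b j))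
    have h2 : ‖W (b j)‖ * ‖T (b j)‖ ≤ ‖T (b j)‖ :=
      mul_le_of_le_one_left (norm_nonneg _) (hWb j)
    simp only [he]
    linarith
  have hterm : ∀ j, (inner ℂ (R (b j)) (T (b j))).re -
      (inner ℂ (R (P (b j))) ((T.singularValues j : ℂ) • W (P (b j)))).re ≤
      q * (C * (√‖T (b j)‖ * √(e j))) := by
    intro j
    set σ := ‖T (b j)‖ with hσ
    have hσ0 : 0 ≤ σ := norm_nonneg _
    rw [← hn j, ← hσ]
    set D := √(σ * e j)
    have hDsq : D ^ 2 = σ * e j := Real.sq_sqrt (mul_nonneg hσ0 (he0 j))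
    have h1 : σ * ‖b j - P (b j)‖ ≤ √(2 / κ) * D := by
      rw [← Real.sqrt_mul (by positivity)]
      apply Real.le_sqrt_of_sq_le
      have h2 := hgap (b j)
      rw [b.norm_eq_one] at h2
      have h3 : σ * (1 - ‖W (b j)‖) ≤ e j := by
        have := re_inner_le (W (b j)) (T (b j))
        simp only [he]
        rw [← hσ] at *
        linarith
      rw [mul_pow, div_mul_eq_mul_div, le_div_iff₀ hκ]
      have h4 := hWb j
      have h5 := norm_nonneg (W (b j))
      calc σ ^ 2 * ‖b j - P (b j)‖ ^ 2 * κ = σ ^ 2 * (κ * ‖b j - P (b j)‖ ^ 2) := by ring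
        _ ≤ σ ^ 2 * (1 ^ 2 - ‖W (b j)‖ ^ 2) := by gcongr
        _ ≤ σ ^ 2 * (2 * (1 - ‖W (b j)‖)) := by gcongr; nlinarith
        _ = 2 * (σ * (σ * (1 - ‖W (b j)‖))) := by ring
        _ ≤ 2 * (σ * e j) := by gcongr
    have h2 : ‖(σ : ℂ) • W (b j) - T (b j)‖ ≤ √2 * D := by
      rw [← Real.sqrt_mul (by positivity)]
      apply Real.le_sqrt_of_sq_le
      rw [norm_sub_sq_re, inner_smul_left, Complex.conj_ofReal, Complex.re_ofReal_mul, norm_smul,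
        Complex.norm_real, Real.norm_of_nonneg hσ0, ← hσ]
      have h3 : (σ * ‖W (b j)‖) ^ 2 ≤ σ ^ 2 := by
        gcongr
        exact mul_le_of_le_one_right hσ0 (hWb j)
      have h4 : σ * e j = σ ^ 2 - σ * (inner ℂ (W (b j)) (T (b j))).re := by
        simp only [he]; rw [← hσ]; ring
      rw [h4]
      linarith
    have h3 : ‖T (b j) - (σ : ℂ) • W (P (b j))‖ ≤ (√2 + √(2 / κ)) * D := by
      have h4 : T (b j) - (σ : ℂ) • W (P (b j)) =
          (σ : ℂ) • W (b j - P (b j)) - ((σ : ℂ) • W (b j) - T (b j)) := by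
        rw [map_sub, smul_sub]; abel
      rw [h4]
      refine (norm_sub_le _ _).trans ?_
      have h5 : ‖(σ : ℂ) • W (b j - P (b j))‖ ≤ σ * ‖b j - P (b j)‖ := by
        rw [norm_smul, Complex.norm_real, Real.norm_of_nonneg hσ0]
        gcongr
        exact hW _
      linarith
    have h4 : inner ℂ (R (b j)) (T (b j)) - inner ℂ (R (P (b j))) ((σ : ℂ) • W (P (b j))) =
        inner ℂ (R (b j - P (b j))) (T (b j)) +
        inner ℂ (R (P (b j))) (T (b j) - (σ : ℂ) • W (P (b j))) := by
      rw [map_sub, inner_sub_left, inner_sub_right]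
      ring
    rw [← Complex.sub_re, h4, Complex.add_re, ← Real.sqrt_mul hσ0]
    have h5 := re_inner_le (R (b j - P (b j))) (T (b j))
    have h6 := re_inner_le (R (P (b j))) (T (b j) - (σ : ℂ) • W (P (b j)))
    have h7 := norm_apply_le_sqrt_hs R (b j - P (b j))
    have h8 := norm_apply_le_sqrt_hs R (P (b j))
    have h9 : ‖P (b j)‖ ≤ 1 := by simpa using hP1 (b j)
    have hq : 0 ≤ q := Real.sqrt_nonneg _
    calc _ ≤ q * ‖b j - P (b j)‖ * σ + q * 1 * ((√2 + √(2 / κ)) * D) := by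
          refine add_le_add (h5.trans ?_) (h6.trans ?_)
          · gcongr
          · gcongr
            exact h8.trans (by gcongr)
      _ ≤ q * (√(2 / κ) * D) + q * 1 * ((√2 + √(2 / κ)) * D) := by
          gcongr ?_ + _
          rw [mul_assoc, mul_comm _ σ]
          gcongr
      _ = q * (C * D) := by rw [hC]; ring
  -- Pairing `R` with itself, moving one `P` across by `hs_comp_conj`, and Cauchy-Schwarz on `∑ √σ_j
  -- √e_j`. Dividing by `q = √(hs R R)` afterwards gives the bound.
  have hsum : hs R R ≤ q * (C * (√(nuc T) * √(nuc T - hs W T))) := by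
    have h1 : hs R R = ∑ j, ((inner ℂ (R (b j)) (T (b j))).re -
      (inner ℂ (R (P (b j))) ((T.singularValues j : ℂ) • W (P (b j)))).re) := by
      nth_rewrite 2 [hR]
      rw [hs_sub_right, hs_comp_conj R W hP, hs_eq_sum b, hs_eq_sum b, Finset.sum_sub_distrib]
      simp only [LinearMap.comp_apply, A, diagMap_self_basis, map_smul]
    rw [h1]
    refine (Finset.sum_le_sum fun j _ => hterm j).trans ?_
    rw [← Finset.mul_sum, ← Finset.mul_sum]
    have h2 : nuc T - hs W T = ∑ j, e j := by
      rw [nuc_eq_sum_basis hn, hs_eq_sum b, ← Finset.sum_sub_distrib]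
    rw [h2, nuc_eq_sum_basis hn]
    gcongr
    have := Real.sum_mul_le_sqrt_mul_sqrt Finset.univ (fun j => √‖T (b j)‖) (fun j => √(e j))
    simpa [Real.sq_sqrt, he0] using this
  have hq2 : q * q = hs R R := Real.mul_self_sqrt (hs_self_nonneg R)
  have hq0 : 0 ≤ q := Real.sqrt_nonneg _
  have hnn := nuc_nonneg T
  have hdd : 0 ≤ nuc T - hs W T := sub_nonneg.2 (hs_le_nuc hW T)
  set B := C * (√(nuc T) * √(nuc T - hs W T)) with hB
  have hB2 : B ^ 2 = C ^ 2 * (nuc T * (nuc T - hs W T)) := by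
    rw [hB, mul_pow, mul_pow, Real.sq_sqrt hnn, Real.sq_sqrt hdd]
  have hB0 : 0 ≤ B := by positivity
  rw [← hB2, ← hq2]
  rcases hq0.eq_or_lt with h | h
  · rw [← h]; simpa using sq_nonneg B
  · have : q ≤ B := le_of_mul_le_mul_left (by rw [hq2]; exact hsum) h
    nlinarith

end ErrorBound

/-! ### Fourier slices, their inversion and Parseval's identity -/

section Fourier

variable {n₁ n₂ k : ℕ} {n : Fin k → ℕ}

/-- The kernel of the discrete Fourier transform along all modes but the first two. -/
noncomputable def chi (i l : SliceIdx n) : ℂ :=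
  ∏ j, Complex.exp (-(2 * Real.pi * Complex.I) / (n j : ℂ)) ^ ((i j : ℕ) * (l j : ℕ))

theorem fslice_apply (X : Tensor n₁ n₂ n) (i : SliceIdx n) (a : Fin n₁) (b : Fin n₂) :
    fslice X i a b = ∑ l, ((X (a, b, l) : ℝ) : ℂ) * chi i l := rfl

theorem chi_comm (i l : SliceIdx n) : chi i l = chi l i := by
  simp only [chi, mul_comm]

theorem isPrimitiveRoot_exp_neg {q : ℕ} (hq : 0 < q) :
    IsPrimitiveRoot (Complex.exp (-(2 * Real.pi * Complex.I) / (q : ℂ))) q := by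
  rw [neg_div, Complex.exp_neg]
  exact (Complex.isPrimitiveRoot_exp q hq.ne').inv

theorem conj_exp_neg (q : ℕ) :
    (starRingEnd ℂ) (Complex.exp (-(2 * Real.pi * Complex.I) / (q : ℂ))) =
      (Complex.exp (-(2 * Real.pi * Complex.I) / (q : ℂ)))⁻¹ := by
  rw [← Complex.exp_neg, ← Complex.exp_conj]
  congr 1
  simp [neg_div, Complex.conj_ofNat]

/-- The sum factors into one geometric sum per mode; in a mode where `l` and `l'` differ, the ratio
is a nontrivial root of unity. -/
theorem sum_chi_mul_conj (l l' : SliceIdx n) :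
    ∑ i, chi i l * (starRingEnd ℂ) (chi i l') = if l = l' then (numSlices n : ℂ) else 0 := by
  set ω : Fin k → ℂ := fun j => Complex.exp (-(2 * Real.pi * Complex.I) / (n j : ℂ)) with hω
  have h1 : ∀ i : SliceIdx n, chi i l * (starRingEnd ℂ) (chi i l') =
      ∏ j, (ω j ^ (l j : ℕ) * (ω j)⁻¹ ^ (l' j : ℕ)) ^ (i j : ℕ) := by
    intro i
    rw [chi, chi, map_prod, ← Finset.prod_mul_distrib]
    refine Finset.prod_congr rfl fun j _ => ?_
    rw [map_pow, conj_exp_neg, mul_pow, ← pow_mul, ← pow_mul, mul_comm (i j : ℕ),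
      mul_comm (i j : ℕ)]
  have h2 : ∑ i : SliceIdx n, ∏ j, (ω j ^ (l j : ℕ) * (ω j)⁻¹ ^ (l' j : ℕ)) ^ (i j : ℕ) =
      ∏ j, ∑ x : Fin (n j), (ω j ^ (l j : ℕ) * (ω j)⁻¹ ^ (l' j : ℕ)) ^ (x : ℕ) := by
    rw [Finset.prod_univ_sum, Fintype.piFinset_univ]
  rw [Finset.sum_congr rfl fun i _ => h1 i, h2]
  have hprim : ∀ j, IsPrimitiveRoot (ω j) (n j) := fun j => isPrimitiveRoot_exp_neg (l j).pos
  have hne : ∀ j, ω j ≠ 0 := fun j => Complex.exp_ne_zero _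
  split_ifs with h
  · subst h
    simp [numSlices, hne]
  · obtain ⟨j, hj⟩ := Function.ne_iff.1 h
    refine Finset.prod_eq_zero (Finset.mem_univ j) ?_
    set z := ω j ^ (l j : ℕ) * (ω j)⁻¹ ^ (l' j : ℕ) with hz
    have hz1 : z ≠ 1 := by
      intro h1
      rw [hz, inv_pow, mul_inv_eq_one₀ (pow_ne_zero _ (hne j))] at h1
      exact hj (Fin.ext ((hprim j).pow_inj (l j).2 (l' j).2 h1))
    have hzn : z ^ n j = 1 := by
      rw [hz, mul_pow, pow_right_comm, pow_right_comm (ω j)⁻¹, inv_pow, (hprim j).pow_eq_one]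
      simp
    rw [← Finset.sum_range (fun x => z ^ x), geom_sum_eq hz1, hzn]
    simp

/-- The index `-i` modulo the mode sizes. -/
def conjIdx (i : SliceIdx n) : SliceIdx n :=
  fun j => ⟨(n j - i j) % n j, Nat.mod_lt _ (i j).pos⟩

theorem conjIdx_conjIdx (i : SliceIdx n) : conjIdx (conjIdx i) = i := by
  funext j
  apply Fin.ext
  have hi := (i j).2
  simp only [conjIdx]
  rcases Nat.eq_zero_or_pos (i j : ℕ) with h | h
  · simp [h]
  · rw [Nat.mod_eq_of_lt (show n j - (i j : ℕ) < n j by omega), Nat.mod_eq_of_lt (by omega)]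
    omega

/-- The involution `i ↦ -i` as an equivalence. -/
def conjIdxEquiv : SliceIdx n ≃ SliceIdx n :=
  ⟨conjIdx, conjIdx, conjIdx_conjIdx, conjIdx_conjIdx⟩

theorem sum_conjIdx {A : Type*} [AddCommMonoid A] (φ : SliceIdx n → A) :
    ∑ i, φ (conjIdx i) = ∑ i, φ i :=
  Equiv.sum_comp conjIdxEquiv φ

theorem chi_conjIdx (i l : SliceIdx n) : chi (conjIdx i) l = (starRingEnd ℂ) (chi i l) := by
  rw [chi, chi, map_prod]
  refine Finset.prod_congr rfl fun j _ => ?_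
  have hprim := isPrimitiveRoot_exp_neg (i j).pos
  rw [map_pow, conj_exp_neg, pow_mul, pow_mul]
  congr 1
  have hi := (i j).2
  simp only [conjIdx]
  rcases Nat.eq_zero_or_pos (i j : ℕ) with h | h
  · simp [h]
  · rw [Nat.mod_eq_of_lt (show n j - (i j : ℕ) < n j by omega), inv_pow,
      ← mul_eq_one_iff_eq_inv₀ (pow_ne_zero _ (Complex.exp_ne_zero _)), ← pow_add,
      Nat.sub_add_cancel hi.le, hprim.pow_eq_one]

theorem fslice_conjIdx (X : Tensor n₁ n₂ n) (i : SliceIdx n) :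
    fslice X (conjIdx i) = (fslice X i).map (starRingEnd ℂ) := by
  ext a b
  simp [fslice_apply, chi_conjIdx]

theorem numSlices_ne_zero (i : SliceIdx n) : (numSlices n : ℝ) ≠ 0 := by
  rw [numSlices, Nat.cast_ne_zero, Finset.prod_ne_zero_iff]
  exact fun j _ => (i j).pos.ne'

theorem numSlices_pos (i : SliceIdx n) : (0 : ℝ) < numSlices n :=
  lt_of_le_of_ne (Nat.cast_nonneg _) (numSlices_ne_zero i).symm

/-- The real tensor obtained from a family of complex slices by the inverse Fourier transform,
taking real parts. -/
noncomputable def ofSlices (M : SliceIdx n → Matrix (Fin n₁) (Fin n₂) ℂ) : Tensor n₁ n₂ n :=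
  WithLp.toLp 2 fun x => (1 / (numSlices n : ℝ)) *
    ∑ i, (M i x.1 x.2.1 * (starRingEnd ℂ) (chi i x.2.2)).re

theorem ofSlices_apply (M : SliceIdx n → Matrix (Fin n₁) (Fin n₂) ℂ) (a : Fin n₁) (b : Fin n₂)
    (l : SliceIdx n) : ofSlices M (a, b, l) = (1 / (numSlices n : ℝ)) *
      ∑ i, (M i a b * (starRingEnd ℂ) (chi i l)).re := rfl

theorem ofSlices_fslice (X : Tensor n₁ n₂ n) : ofSlices (fslice X) = X := by
  ext ⟨a, b, l⟩
  rw [ofSlices_apply]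
  have h : ∑ i, fslice X i a b * (starRingEnd ℂ) (chi i l) =
      (numSlices n : ℂ) * (X (a, b, l) : ℂ) := by
    simp only [fslice_apply, Finset.sum_mul]
    rw [Finset.sum_comm]
    simp only [mul_assoc, ← Finset.mul_sum, sum_chi_mul_conj]
    simp [mul_comm]
  rw [← Complex.re_sum, h, ← Complex.ofReal_natCast, ← Complex.ofReal_mul, Complex.ofReal_re]
  field_simp [numSlices_ne_zero l]

theorem fslice_injective {X Y : Tensor n₁ n₂ n} (h : ∀ i, fslice X i = fslice Y i) : X = Y := by
  rw [← ofSlices_fslice X, ← ofSlices_fslice Y, funext h]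

/-- Slices of real tensors satisfy `M (-i) = conj (M i)`. Taking real parts in the inverse transform
symmetrizes an arbitrary family accordingly. -/
theorem fslice_ofSlices (M : SliceIdx n → Matrix (Fin n₁) (Fin n₂) ℂ) (i : SliceIdx n) :
    fslice (ofSlices M) i =
      ((1 / 2 : ℝ) : ℂ) • (M i + (M (conjIdx i)).map (starRingEnd ℂ)) := by
  ext a b
  have h1 : ∀ l, ((ofSlices M (a, b, l) : ℝ) : ℂ) = (1 / (numSlices n : ℂ)) *
      ∑ i', (1 / 2 : ℂ) * (M i' a b + (starRingEnd ℂ) (M (conjIdx i') a b)) *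
        (starRingEnd ℂ) (chi i' l) := by
    intro l
    rw [ofSlices_apply]
    push_cast
    congr 1
    have h2 : ∑ i', (starRingEnd ℂ) (M i' a b) * chi i' l =
        ∑ i', (starRingEnd ℂ) (M (conjIdx i') a b) * (starRingEnd ℂ) (chi i' l) := by
      rw [← sum_conjIdx]
      simp only [chi_conjIdx]
    have h3 : ∀ i', (((M i' a b * (starRingEnd ℂ) (chi i' l)).re : ℝ) : ℂ) =
        (1 / 2) * (M i' a b * (starRingEnd ℂ) (chi i' l)) +
        (1 / 2) * ((starRingEnd ℂ) (M i' a b) * chi i' l) := by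
      intro i'
      rw [Complex.re_eq_add_conj, map_mul, Complex.conj_conj]
      ring
    rw [Finset.sum_congr rfl fun i' _ => h3 i', Finset.sum_add_distrib, ← Finset.mul_sum,
      ← Finset.mul_sum, h2, ← mul_add, ← Finset.sum_add_distrib, Finset.mul_sum]
    refine Finset.sum_congr rfl fun i' _ => ?_
    ring
  rw [fslice_apply]
  simp only [h1, mul_assoc, ← Finset.mul_sum, Finset.sum_mul]
  rw [Finset.sum_comm]
  have h4 : ∀ i', ∑ l, (M i' a b + (starRingEnd ℂ) (M (conjIdx i') a b)) *
      ((starRingEnd ℂ) (chi i' l) * chi i l) =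
      if i = i' then (numSlices n : ℂ) * (M i' a b + (starRingEnd ℂ) (M (conjIdx i') a b)) else 0 := by
    intro i'
    rw [← Finset.mul_sum]
    have h5 := sum_chi_mul_conj i i'
    simp only [chi_comm _ i, chi_comm _ i', mul_comm (chi i _)] at h5
    rw [h5]
    split_ifs <;> ring
  rw [Finset.sum_congr rfl fun i' _ => h4 i', Finset.sum_ite_eq, if_pos (Finset.mem_univ _)]
  have := numSlices_ne_zero i
  have h6 : (numSlices n : ℂ) ≠ 0 := by exact_mod_cast this
  simp
  field_simp

theorem fslice_ofSlices_of_conj {M : SliceIdx n → Matrix (Fin n₁) (Fin n₂) ℂ}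
    (hM : ∀ i, M (conjIdx i) = (M i).map (starRingEnd ℂ)) (i : SliceIdx n) :
    fslice (ofSlices M) i = M i := by
  rw [fslice_ofSlices, hM]
  ext a b
  simp
  ring

theorem fslice_add (X Y : Tensor n₁ n₂ n) (i : SliceIdx n) :
    fslice (X + Y) i = fslice X i + fslice Y i := by
  ext a b
  simp [fslice_apply, add_mul, Finset.sum_add_distrib]

theorem fslice_smul (c : ℝ) (X : Tensor n₁ n₂ n) (i : SliceIdx n) :
    fslice (c • X) i = (c : ℂ) • fslice X i := by
  ext a b
  simp [fslice_apply, mul_assoc, Finset.mul_sum]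

/-- The frontal slices in the Fourier domain, as linear maps. -/
noncomputable def slice (X : Tensor n₁ n₂ n) (i : SliceIdx n) :
    EuclideanSpace ℂ (Fin n₂) →ₗ[ℂ] EuclideanSpace ℂ (Fin n₁) :=
  Matrix.toEuclideanLin (fslice X i)

theorem slice_add (X Y : Tensor n₁ n₂ n) (i : SliceIdx n) :
    slice (X + Y) i = slice X i + slice Y i := by
  rw [slice, fslice_add, map_add]; rfl

theorem slice_smul (c : ℝ) (X : Tensor n₁ n₂ n) (i : SliceIdx n) :
    slice (c • X) i = (c : ℂ) • slice X i := by
  rw [slice, fslice_smul, map_smul]; rfl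

theorem slice_neg (X : Tensor n₁ n₂ n) (i : SliceIdx n) : slice (-X) i = -slice X i := by
  have := slice_smul (-1) X i
  simpa using this

theorem slice_sub (X Y : Tensor n₁ n₂ n) (i : SliceIdx n) :
    slice (X - Y) i = slice X i - slice Y i := by
  rw [sub_eq_add_neg, slice_add, slice_neg, sub_eq_add_neg]

theorem sv_fslice (X : Tensor n₁ n₂ n) (i : SliceIdx n) (j : ℕ) :
    sv (fslice X i) j = (slice X i).singularValues j := rfl

theorem hs_toEuclideanLin (A B : Matrix (Fin n₁) (Fin n₂) ℂ) :
    hs (Matrix.toEuclideanLin A) (Matrix.toEuclideanLin B) =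
      ∑ a, ∑ b, ((starRingEnd ℂ) (A a b) * B a b).re := by
  rw [hs_eq_sum (EuclideanSpace.basisFun (Fin n₂) ℂ), Finset.sum_comm]
  refine Finset.sum_congr rfl fun b _ => ?_
  rw [PiLp.inner_apply, Complex.re_sum]
  refine Finset.sum_congr rfl fun a _ => ?_
  simp [Matrix.toLpLin_apply]
  ring

/-- Parseval without any symmetry of `M`: the real part discarded by `ofSlices` is invisible when
paired with a real tensor. This permits test tensors built from a single slice. -/
theorem inner_ofSlices (M : SliceIdx n → Matrix (Fin n₁) (Fin n₂) ℂ) (X : Tensor n₁ n₂ n) :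
    inner ℝ (ofSlices M) X =
      (1 / (numSlices n : ℝ)) * ∑ i, hs (Matrix.toEuclideanLin (M i)) (slice X i) := by
  rw [PiLp.inner_apply, Fintype.sum_prod_type]
  simp only [Fintype.sum_prod_type, slice, hs_toEuclideanLin]
  rw [Finset.sum_comm (s := Finset.univ (α := SliceIdx n)), Finset.mul_sum]
  refine Finset.sum_congr rfl fun a _ => ?_
  rw [Finset.sum_comm (s := Finset.univ (α := SliceIdx n)), Finset.mul_sum]
  refine Finset.sum_congr rfl fun b _ => ?_
  simp only [ofSlices_apply, fslice_apply, Finset.mul_sum, Complex.re_sum]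
  simp only [inner, starRingEnd_apply, star_trivial, Finset.mul_sum]
  rw [Finset.sum_comm]
  refine Finset.sum_congr rfl fun i _ => ?_
  refine Finset.sum_congr rfl fun l _ => ?_
  simp
  ring

theorem inner_eq_sum_hs (X Y : Tensor n₁ n₂ n) :
    inner ℝ X Y = (1 / (numSlices n : ℝ)) * ∑ i, hs (slice X i) (slice Y i) := by
  conv_lhs => rw [← ofSlices_fslice X]
  exact inner_ofSlices _ _

theorem tnn_eq_sum_nuc (X : Tensor n₁ n₂ n) :
    tnn X = (1 / (numSlices n : ℝ)) * ∑ i, nuc (slice X i) := by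
  rw [tnn]
  congr 1
  refine Finset.sum_congr rfl fun i _ => ?_
  rw [nuc, sum_range_singularValues (φ := fun x => x) rfl _ (K := min n₁ n₂) (by simp)]
  rfl

end Fourier

/-! ### Entrywise conjugation preserves singular values -/

section Conjugation

variable {p q : ℕ}

/-- Entrywise complex conjugation of a vector. -/
noncomputable def conjVec (x : EuclideanSpace ℂ (Fin p)) : EuclideanSpace ℂ (Fin p) :=
  WithLp.toLp 2 fun i => (starRingEnd ℂ) (x i)

theorem inner_conjVec (x y : EuclideanSpace ℂ (Fin p)) :
    inner ℂ (conjVec x) (conjVec y) = (starRingEnd ℂ) (inner ℂ x y) := by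
  simp [conjVec, PiLp.inner_apply]

theorem norm_conjVec (x : EuclideanSpace ℂ (Fin p)) : ‖conjVec x‖ = ‖x‖ := by
  simp [conjVec, EuclideanSpace.norm_eq]

theorem toEuclideanLin_map_conj (A : Matrix (Fin q) (Fin p) ℂ) (x : EuclideanSpace ℂ (Fin p)) :
    Matrix.toEuclideanLin (A.map (starRingEnd ℂ)) (conjVec x) =
      conjVec (Matrix.toEuclideanLin A x) := by
  ext a
  simp [conjVec, Matrix.toLpLin_apply, Matrix.mulVec, dotProduct]

theorem exists_orthonormalBasis_eq {𝕜 E ι : Type*} [RCLike 𝕜] [NormedAddCommGroup E]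
    [InnerProductSpace 𝕜 E] [FiniteDimensional 𝕜 E] [Fintype ι] {v : ι → E}
    (hv : Orthonormal 𝕜 v) (hc : finrank 𝕜 E = Fintype.card ι) :
    ∃ b : OrthonormalBasis ι 𝕜 E, ∀ i, b i = v i := by
  obtain ⟨b, hb⟩ := Orthonormal.exists_orthonormalBasis_extension_of_card_eq hc
    (v := v) (s := Set.univ) (hv.comp _ Subtype.val_injective)
  exact ⟨b, fun i => hb i (Set.mem_univ i)⟩

theorem sv_map_conj (A : Matrix (Fin q) (Fin p) ℂ) (j : ℕ) :
    sv (A.map (starRingEnd ℂ)) j = sv A j := by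
  rw [sv, sv]
  rcases le_or_gt p j with hj | hj
  · rw [LinearMap.singularValues_of_finrank_le _ (by simpa using hj),
      LinearMap.singularValues_of_finrank_le _ (by simpa using hj)]
  · obtain ⟨b, hb, hn⟩ := exists_rightSingularBasis (p := p) (by simp) (Matrix.toEuclideanLin A)
    obtain ⟨c, hc⟩ := exists_orthonormalBasis_eq (𝕜 := ℂ) (v := fun j => conjVec (b j)) (by
      rw [orthonormal_iff_ite]
      intro i j
      rw [inner_conjVec, OrthonormalBasis.inner_eq_ite]
      split_ifs <;> simp) (by simp)
    have h1 : ∀ j, Matrix.toEuclideanLin (A.map (starRingEnd ℂ)) (c j) =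
        conjVec (Matrix.toEuclideanLin A (b j)) := fun j => by rw [hc, toEuclideanLin_map_conj]
    have := singularValues_eq_norm c (Matrix.toEuclideanLin (A.map (starRingEnd ℂ)))
      (fun j k hjk => by rw [h1, h1, inner_conjVec, hb j k hjk, map_zero])
      (fun j k hjk => by
        simp only [h1, norm_conjVec, hn]
        exact LinearMap.singularValues_antitone _ hjk) ⟨j, hj⟩
    simpa [h1, norm_conjVec, hn] using this

theorem nuc_map_conj (A : Matrix (Fin q) (Fin p) ℂ) :
    nuc (Matrix.toEuclideanLin (A.map (starRingEnd ℂ))) = nuc (Matrix.toEuclideanLin A) :=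
  Finset.sum_congr rfl fun j _ => sv_map_conj A j

theorem slice_ofSlices {n₁ n₂ k : ℕ} {n : Fin k → ℕ} (M : SliceIdx n → Matrix (Fin n₁) (Fin n₂) ℂ)
    (i : SliceIdx n) : slice (ofSlices M) i = ((1 / 2 : ℝ) : ℂ) • (Matrix.toEuclideanLin (M i) +
      Matrix.toEuclideanLin ((M (conjIdx i)).map (starRingEnd ℂ))) := by
  rw [slice, fslice_ofSlices, map_smul, map_add]

/-- Symmetrization averages each slice with the conjugate of the slice at `-i`, which has the same
nuclear norm. -/
theorem tnn_ofSlices_le {n₁ n₂ k : ℕ} {n : Fin k → ℕ}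
    (M : SliceIdx n → Matrix (Fin n₁) (Fin n₂) ℂ) :
    tnn (ofSlices M) ≤ (1 / (numSlices n : ℝ)) * ∑ i, nuc (Matrix.toEuclideanLin (M i)) := by
  rw [tnn_eq_sum_nuc]
  gcongr 1
  have h1 : ∀ i, nuc (slice (ofSlices M) i) ≤ (1 / 2) * nuc (Matrix.toEuclideanLin (M i)) +
      (1 / 2) * nuc (Matrix.toEuclideanLin (M (conjIdx i))) := by
    intro i
    rw [slice_ofSlices]
    refine (nuc_smul_le (by norm_num) _).trans ?_
    have := nuc_add_le (Matrix.toEuclideanLin (M i))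
      (Matrix.toEuclideanLin ((M (conjIdx i)).map (starRingEnd ℂ)))
    rw [nuc_map_conj] at this
    linarith
  refine (Finset.sum_le_sum fun i _ => h1 i).trans ?_
  rw [Finset.sum_add_distrib, ← Finset.mul_sum, ← Finset.mul_sum,
    sum_conjIdx (fun i => nuc (Matrix.toEuclideanLin (M i)))]
  linarith

end Conjugation

/-! ### Projected gradient descent on a convex set -/

section ProjectedGradient

open Filter Topology

set_option linter.unusedSectionVars false

variable {H : Type*} [NormedAddCommGroup H] [InnerProductSpace ℝ H] [CompleteSpace H]
  {f : H → ℝ} {K : Set H} {β : ℝ}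

theorem hasDerivAt_line {x v : H} {t : ℝ} (h : DifferentiableAt ℝ f (x + t • v)) :
    HasDerivAt (fun s : ℝ => f (x + s • v)) (inner ℝ (gradient f (x + t • v)) v) t := by
  have h1 : HasDerivAt (fun s : ℝ => x + s • v) v t := by
    simpa using ((hasDerivAt_id t).smul_const v).const_add x
  rw [inner_gradient_left]
  exact h.hasFDerivAt.comp_hasDerivAt t h1

theorem tendsto_slope_line {x v : H} (h : DifferentiableAt ℝ f x) :
    Tendsto (fun t : ℝ => t⁻¹ * (f (x + t • v) - f x)) (𝓝[>] 0) (𝓝 (inner ℝ (gradient f x) v)) := by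
  have h1 := hasDerivAt_line (f := f) (x := x) (v := v) (t := 0) (by simpa using h)
  simpa using h1.tendsto_slope_zero_right

/-- Divide by `t` and let `t ↓ 0`. The weight `(1 - t) * c` is the form in which strong convexity
appears along a segment; `c = 0` is plain convexity. -/
theorem inner_gradient_le_of_forall_line_le {x v : H} (h : DifferentiableAt ℝ f x) {D c : ℝ}
    (hle : ∀ t : ℝ, 0 < t → t < 1 → f (x + t • v) ≤ f x + t * (D - (1 - t) * c)) :
    inner ℝ (gradient f x) v ≤ D - c := by
  have h2 : Tendsto (fun t : ℝ => D - (1 - t) * c) (𝓝[>] 0) (𝓝 (D - c)) := by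
    have : Continuous fun t : ℝ => D - (1 - t) * c := by fun_prop
    simpa using (this.tendsto 0).mono_left nhdsWithin_le_nhds
  refine le_of_tendsto_of_tendsto (tendsto_slope_line h) h2 ?_
  have hmem : Set.Ioo (0 : ℝ) 1 ∈ 𝓝[>] (0 : ℝ) := Ioo_mem_nhdsGT one_pos
  filter_upwards [hmem] with t ht
  have := hle t ht.1 ht.2
  rw [inv_mul_le_iff₀ ht.1]
  linarith

theorem convexOn_inner_gradient_le (hconv : ConvexOn ℝ Set.univ f) {x : H}
    (h : DifferentiableAt ℝ f x) (y : H) : inner ℝ (gradient f x) (y - x) ≤ f y - f x := by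
  have := inner_gradient_le_of_forall_line_le (c := 0) (D := f y - f x) (v := y - x) h
    fun t ht0 ht1 => by
      have h1 := hconv.2 (Set.mem_univ x) (Set.mem_univ y) (sub_nonneg.2 ht1.le) ht0.le (by ring)
      have h2 : (1 - t) • x + t • y = x + t • (y - x) := by module
      rw [h2, smul_eq_mul, smul_eq_mul] at h1
      linarith
  simpa using this

theorem inner_gradient_nonneg_of_isMin (hK : Convex ℝ K) {x : H} (hx : x ∈ K)
    (h : DifferentiableAt ℝ f x) (hopt : ∀ y ∈ K, f x ≤ f y) {y : H} (hy : y ∈ K) :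
    0 ≤ inner ℝ (gradient f x) (y - x) := by
  refine ge_of_tendsto (tendsto_slope_line h) ?_
  filter_upwards [Ioo_mem_nhdsGT (one_pos (α := ℝ))] with t ht
  have h1 : x + t • (y - x) ∈ K := hK.add_smul_sub_mem hx hy ⟨ht.1.le, ht.2.le⟩
  exact mul_nonneg (inv_nonneg.2 ht.1.le) (sub_nonneg.2 (hopt _ h1))

theorem descent_lemma (hK : Convex ℝ K) (hdiff : ∀ x ∈ K, DifferentiableAt ℝ f x)
    (hsmooth : ∀ x ∈ K, ∀ y ∈ K, ‖gradient f x - gradient f y‖ ≤ β * ‖x - y‖) {x y : H}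
    (hx : x ∈ K) (hy : y ∈ K) :
    f y ≤ f x + inner ℝ (gradient f x) (y - x) + β / 2 * ‖y - x‖ ^ 2 := by
  set v := y - x
  set ψ : ℝ → ℝ := fun t => f (x + t • v) - t * inner ℝ (gradient f x) v - β / 2 * t ^ 2 * ‖v‖ ^ 2
  have hmem : ∀ t ∈ Set.Icc (0 : ℝ) 1, x + t • v ∈ K := fun t ht => hK.add_smul_sub_mem hx hy ht
  have hder : ∀ t ∈ Set.Icc (0 : ℝ) 1, HasDerivAt ψ (inner ℝ (gradient f (x + t • v)) v -
      inner ℝ (gradient f x) v - β * t * ‖v‖ ^ 2) t := by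
    intro t ht
    have h1 := hasDerivAt_line (v := v) (hdiff _ (hmem t ht))
    have h2 : HasDerivAt (fun t : ℝ => t * inner ℝ (gradient f x) v)
        (inner ℝ (gradient f x) v) t := by
      simpa using (hasDerivAt_id t).mul_const (inner ℝ (gradient f x) v)
    have h3 : HasDerivAt (fun t : ℝ => β / 2 * t ^ 2 * ‖v‖ ^ 2) (β * t * ‖v‖ ^ 2) t := by
      have := (((hasDerivAt_id t).pow 2).const_mul (β / 2)).mul_const (‖v‖ ^ 2)
      refine this.congr_deriv ?_
      simp only [id_eq, Nat.cast_ofNat, Nat.add_one_sub_one, pow_one, mul_one]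
      ring
    exact (h1.sub h2).sub h3
  -- The Lipschitz bound on the gradient makes `ψ' ≤ 0`; comparing the endpoints is the claim, with
  -- no integration.
  have hanti : AntitoneOn ψ (Set.Icc 0 1) := by
    refine antitoneOn_of_deriv_nonpos (convex_Icc 0 1)
      (fun t ht => (hder t ht).continuousAt.continuousWithinAt)
      (fun t ht => (hder t (interior_subset ht)).differentiableAt.differentiableWithinAt)
      fun t ht => ?_
    have ht' := interior_subset ht
    rw [(hder t ht').deriv, ← inner_sub_left]
    have h1 := real_inner_le_norm (gradient f (x + t • v) - gradient f x) v
    have h2 := hsmooth _ (hmem t ht') x hx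
    rw [add_sub_cancel_left, norm_smul, Real.norm_of_nonneg ht'.1] at h2
    nlinarith [norm_nonneg v]
  have := hanti (Set.left_mem_Icc.2 zero_le_one) (Set.right_mem_Icc.2 zero_le_one) zero_le_one
  simp only [ψ, one_smul, zero_smul, add_zero] at this
  have hxy : x + v = y := by simp [v]
  rw [hxy] at this
  linarith

theorem IsProj.inner_le_zero {P Y : H} (hK : Convex ℝ K) (h : IsProj K P Y) {Z : H}
    (hZ : Z ∈ K) : inner ℝ (P - Y) (Z - Y) ≤ 0 := by
  have hne : Nonempty K := ⟨⟨Y, h.1⟩⟩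
  refine (norm_eq_iInf_iff_real_inner_le_zero hK h.1).1 (le_antisymm ?_ ?_) Z hZ
  · exact le_ciInf fun w => h.2 w w.2
  · exact ciInf_le ⟨0, by rintro _ ⟨w, rfl⟩; exact norm_nonneg _⟩ (⟨Y, h.1⟩ : K)

theorem IsProj.eq_of_inner_le_zero {P Y Y' : H} (hK : Convex ℝ K) (h : IsProj K P Y) (hY' : Y' ∈ K)
    (h' : ∀ Z ∈ K, inner ℝ (P - Y') (Z - Y') ≤ 0) : Y' = Y := by
  have h1 := h.inner_le_zero hK hY'
  have h2 := h' Y h.1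
  have h3 : inner ℝ (Y' - Y) (Y' - Y) =
      inner ℝ (P - Y) (Y' - Y) + inner ℝ (P - Y') (Y - Y') := by
    have : inner ℝ (P - Y') (Y - Y') = -inner ℝ (P - Y') (Y' - Y) := by
      rw [← inner_neg_right, neg_sub]
    rw [this, ← sub_eq_add_neg, ← inner_sub_left]
    congr 1
    abel
  rw [real_inner_self_eq_norm_sq] at h3
  have h4 : ‖Y' - Y‖ ^ 2 ≤ 0 := by linarith
  rw [← sub_eq_zero, ← norm_eq_zero]
  exact pow_eq_zero_iff two_ne_zero |>.1 (le_antisymm h4 (sq_nonneg _))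

/-- The projection inequality for one gradient step. -/
theorem inner_gradient_le_of_step (hβ : 0 < β) (hK : Convex ℝ K) {x y z : H}
    (hproj : IsProj K (x - (1 / β) • gradient f x) y) (hz : z ∈ K) :
    inner ℝ (gradient f x) (y - z) ≤ β * inner ℝ (x - y) (y - z) := by
  have h := hproj.inner_le_zero hK hz
  have h1 : x - (1 / β) • gradient f x - y = (x - y) - (1 / β) • gradient f x := by abel
  have h2 : z - y = -(y - z) := by abel
  rw [h1, h2, inner_neg_right, inner_sub_left, real_inner_smul_left] at h
  have h3 : inner ℝ (gradient f x) (y - z) / β ≤ inner ℝ (x - y) (y - z) := by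
    rw [div_eq_inv_mul, ← one_div]
    linarith
  rwa [div_le_iff₀ hβ, mul_comm] at h3

theorem two_mul_inner_sub (x y z : H) :
    2 * inner ℝ (x - y) (y - z) = ‖x - z‖ ^ 2 - ‖y - z‖ ^ 2 - ‖y - x‖ ^ 2 := by
  have h : x - z = (x - y) + (y - z) := by abel
  rw [h, norm_add_sq_real, norm_sub_rev y x]
  ring

/-- Descent lemma, convexity and the projection inequality are added; the three-point identity
cancels the term `β/2 ‖y - x‖²`. -/
theorem step_sub_le (hβ : 0 < β) (hK : Convex ℝ K) (hconv : ConvexOn ℝ Set.univ f)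
    (hdiff : ∀ x ∈ K, DifferentiableAt ℝ f x)
    (hsmooth : ∀ x ∈ K, ∀ y ∈ K, ‖gradient f x - gradient f y‖ ≤ β * ‖x - y‖) {x y z : H}
    (hx : x ∈ K) (hproj : IsProj K (x - (1 / β) • gradient f x) y) (hz : z ∈ K) :
    f y - f z ≤ β / 2 * (‖x - z‖ ^ 2 - ‖y - z‖ ^ 2) := by
  have h1 := descent_lemma hK hdiff hsmooth hx hproj.1
  have h2 := convexOn_inner_gradient_le hconv (hdiff x hx) z
  have h3 := inner_gradient_le_of_step hβ hK hproj hz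
  have h4 := two_mul_inner_sub x y z
  have h5 : inner ℝ (gradient f x) (y - x) =
      inner ℝ (gradient f x) (y - z) + inner ℝ (gradient f x) (z - x) := by
    rw [← inner_add_right]; congr 1; abel
  have h6 : β * inner ℝ (x - y) (y - z) =
      β / 2 * (‖x - z‖ ^ 2 - ‖y - z‖ ^ 2) - β / 2 * ‖y - x‖ ^ 2 := by
    linear_combination (β / 2) * h4
  linarith

/-- Gains a fixed factor below 1 over the bound `β/2 ‖x - z‖²`. This supplies the last power of the
linear rate, which the contraction of the distances alone would miss. -/
theorem step_sub_le_min (hβ : 0 < β) (hK : Convex ℝ K) (hconv : ConvexOn ℝ Set.univ f)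
    (hdiff : ∀ x ∈ K, DifferentiableAt ℝ f x)
    (hsmooth : ∀ x ∈ K, ∀ y ∈ K, ‖gradient f x - gradient f y‖ ≤ β * ‖x - y‖) {x y z : H}
    (hx : x ∈ K) (hproj : IsProj K (x - (1 / β) • gradient f x) y) (hz : z ∈ K) :
    f y - f z ≤ β / 2 * (195 / 196 * ‖x - z‖ ^ 2) := by
  have h0 := step_sub_le hβ hK hconv hdiff hsmooth hx hproj hz
  have h1 := descent_lemma hK hdiff hsmooth hz hproj.1
  have h2 := inner_gradient_le_of_step hβ hK hproj hz
  have h3 : inner ℝ (gradient f z) (y - z) = inner ℝ (gradient f x) (y - z) +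
      inner ℝ (gradient f z - gradient f x) (y - z) := by
    rw [← inner_add_left]; congr 1; abel
  have h4 := real_inner_le_norm (gradient f z - gradient f x) (y - z)
  have h5 := hsmooth z hz x hx
  rw [norm_sub_rev z x] at h5
  have h6 := real_inner_le_norm (x - y) (y - z)
  have h7 : ‖x - y‖ ≤ ‖x - z‖ + ‖y - z‖ := by
    rw [norm_sub_rev y z]; exact norm_sub_le_norm_sub_add_norm_sub x z y
  set p := ‖x - z‖
  set q := ‖y - z‖
  have hp : 0 ≤ p := norm_nonneg _
  have hq : 0 ≤ q := norm_nonneg _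
  have h8 : f y - f z ≤ β * ((p + q) * q) + β * p * q + β / 2 * q ^ 2 := by
    have h9 : inner ℝ (x - y) (y - z) ≤ (p + q) * q := h6.trans (by gcongr)
    have h10 : inner ℝ (gradient f z - gradient f x) (y - z) ≤ β * p * q := h4.trans (by gcongr)
    have h11 : β * inner ℝ (x - y) (y - z) ≤ β * ((p + q) * q) := by gcongr
    linarith
  -- If `q ≤ p/14`, the new point is so close to `z` that smoothness at `z` gives `β/2 (4pq + 3q²)`
  -- with `4/14 + 3/196 < 195/196`. Otherwise the term `-q²` in `step_sub_le` already saves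
  -- `p²/196`.
  rcases le_or_gt (196 * q ^ 2) (p ^ 2) with h | h
  · have h9 : 14 * q ≤ p := by
      refine le_of_sq_le_sq ?_ hp
      nlinarith
    have h10 : 4 * p * q + 3 * q ^ 2 ≤ 195 / 196 * p ^ 2 := by nlinarith
    calc f y - f z ≤ β / 2 * (4 * p * q + 3 * q ^ 2) := by linarith
      _ ≤ _ := by gcongr
  · refine h0.trans ?_
    gcongr
    linarith

variable {X : ℕ → H} {z : H}

theorem pgd_mem (h1 : X 1 ∈ K)
    (hX : ∀ t, 1 ≤ t → IsProj K (X t - (1 / β) • gradient f (X t)) (X (t + 1))) :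
    ∀ t, 1 ≤ t → X t ∈ K := by
  intro t ht
  induction t, ht using Nat.le_induction with
  | base => exact h1
  | succ t ht _ => exact (hX t ht).1

theorem pgd_dist_le (hβ : 0 < β) (hK : Convex ℝ K) (hconv : ConvexOn ℝ Set.univ f)
    (hdiff : ∀ x ∈ K, DifferentiableAt ℝ f x)
    (hsmooth : ∀ x ∈ K, ∀ y ∈ K, ‖gradient f x - gradient f y‖ ≤ β * ‖x - y‖)
    (h1 : X 1 ∈ K) (hX : ∀ t, 1 ≤ t → IsProj K (X t - (1 / β) • gradient f (X t)) (X (t + 1)))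
    (hz : z ∈ K) (hopt : ∀ w ∈ K, f z ≤ f w) :
    ∀ t, 1 ≤ t → ‖X t - z‖ ≤ ‖X 1 - z‖ := by
  intro t ht
  induction t, ht using Nat.le_induction with
  | base => exact le_rfl
  | succ t ht ih =>
    refine le_trans ?_ ih
    have h2 := step_sub_le hβ hK hconv hdiff hsmooth (pgd_mem h1 hX t ht) (hX t ht) hz
    have h3 := hopt _ (hX t ht).1
    refine le_of_sq_le_sq ?_ (norm_nonneg _)
    have h4 : 0 ≤ β / 2 * (‖X t - z‖ ^ 2 - ‖X (t + 1) - z‖ ^ 2) := by linarith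
    have h5 := nonneg_of_mul_nonneg_right h4 (half_pos hβ)
    linarith

/-- The potential `(t - 1)(f (X t) - f z) + β/2 ‖X t - z‖²` never increases, because the values of
`f` decrease along the run. -/
theorem pgd_sublinear (hβ : 0 < β) (hK : Convex ℝ K) (hconv : ConvexOn ℝ Set.univ f)
    (hdiff : ∀ x ∈ K, DifferentiableAt ℝ f x)
    (hsmooth : ∀ x ∈ K, ∀ y ∈ K, ‖gradient f x - gradient f y‖ ≤ β * ‖x - y‖)
    (h1 : X 1 ∈ K) (hX : ∀ t, 1 ≤ t → IsProj K (X t - (1 / β) • gradient f (X t)) (X (t + 1)))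
    (hz : z ∈ K) (t : ℕ) (ht : 2 ≤ t) :
    f (X t) - f z ≤ β * ‖X 1 - z‖ ^ 2 / (2 * ((t : ℝ) - 1)) := by
  have key : ∀ t : ℕ, 1 ≤ t → ((t : ℝ) - 1) * (f (X t) - f z) + β / 2 * ‖X t - z‖ ^ 2 ≤
      β / 2 * ‖X 1 - z‖ ^ 2 := by
    intro t ht
    induction t, ht using Nat.le_induction with
    | base => simp
    | succ t ht ih =>
      have hm := pgd_mem h1 hX t ht
      have h2 := step_sub_le hβ hK hconv hdiff hsmooth hm (hX t ht) hz
      have h3 := step_sub_le hβ hK hconv hdiff hsmooth hm (hX t ht) hm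
      have h4 : f (X (t + 1)) ≤ f (X t) := by
        have : 0 ≤ β / 2 * ‖X (t + 1) - X t‖ ^ 2 := by positivity
        simp only [sub_self, norm_zero] at h3
        linarith
      have ht1 : (0 : ℝ) ≤ (t : ℝ) - 1 := by
        have : (1 : ℝ) ≤ t := by exact_mod_cast ht
        linarith
      have h5 := mul_le_mul_of_nonneg_left h4 ht1
      push_cast
      linarith
  have h2 := key t (by omega)
  have ht1 : (1 : ℝ) ≤ (t : ℝ) - 1 := by
    have : (2 : ℝ) ≤ t := by exact_mod_cast ht
    linarith
  rw [le_div_iff₀ (by linarith)]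
  have : 0 ≤ β / 2 * ‖X t - z‖ ^ 2 := by positivity
  linarith

/-- Growth turns `step_sub_le` into contraction of squared distances by `ρ = 1/(1 + 2γ/β)`, which
yields `ρ ^ (t - 2)` at the penultimate iterate. The final step contributes `195/196`, and this is
at most `ρ` exactly because `γ ≤ β/390`. -/
theorem pgd_linear (hβ : 0 < β) (hK : Convex ℝ K) (hconv : ConvexOn ℝ Set.univ f)
    (hdiff : ∀ x ∈ K, DifferentiableAt ℝ f x)
    (hsmooth : ∀ x ∈ K, ∀ y ∈ K, ‖gradient f x - gradient f y‖ ≤ β * ‖x - y‖)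
    (h1 : X 1 ∈ K) (hX : ∀ t, 1 ≤ t → IsProj K (X t - (1 / β) • gradient f (X t)) (X (t + 1)))
    (hz : z ∈ K) {γ : ℝ} (hγ : 0 < γ) (hγβ : γ ≤ β / 390)
    (hgrow : ∀ x ∈ K, γ * ‖x - z‖ ^ 2 ≤ f x - f z) (t : ℕ) (ht : 2 ≤ t) :
    f (X t) - f z ≤ β * ‖X 1 - z‖ ^ 2 / 2 * (1 / (1 + 2 * γ / β)) ^ (t - 1) := by
  set ρ := 1 / (1 + 2 * γ / β) with hρ
  have hρ0 : 0 < ρ := by positivity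
  have hρ1 : 195 / 196 ≤ ρ := by
    rw [hρ, le_div_iff₀ (by positivity)]
    have : γ / β ≤ 1 / 390 := by rw [div_le_iff₀ hβ]; linarith
    have h2 : 2 * γ / β = 2 * (γ / β) := by ring
    rw [h2]
    linarith
  have hdist : ∀ t : ℕ, 1 ≤ t → ‖X t - z‖ ^ 2 ≤ ρ ^ (t - 1) * ‖X 1 - z‖ ^ 2 := by
    intro t ht
    induction t, ht using Nat.le_induction with
    | base => simp
    | succ t ht ih =>
      have h2 := step_sub_le hβ hK hconv hdiff hsmooth (pgd_mem h1 hX t ht) (hX t ht) hz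
      have h3 := hgrow _ (hX t ht).1
      have h4 : ‖X (t + 1) - z‖ ^ 2 ≤ ρ * ‖X t - z‖ ^ 2 := by
        rw [hρ, one_div, ← div_eq_inv_mul, le_div_iff₀ (by positivity)]
        have h5 : ‖X (t + 1) - z‖ ^ 2 * (1 + 2 * γ / β) * (β / 2) ≤ ‖X t - z‖ ^ 2 * (β / 2) := by
          have : ‖X (t + 1) - z‖ ^ 2 * (1 + 2 * γ / β) * (β / 2) =
            ‖X (t + 1) - z‖ ^ 2 * (β / 2) + γ * ‖X (t + 1) - z‖ ^ 2 := by
            field_simp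
          rw [this]
          linarith
        exact le_of_mul_le_mul_right h5 (half_pos hβ)
      obtain ⟨s, rfl⟩ : ∃ s, t = s + 1 := ⟨t - 1, by omega⟩
      simp only [Nat.add_sub_cancel] at ih ⊢
      calc _ ≤ ρ * ‖X (s + 1) - z‖ ^ 2 := h4
        _ ≤ ρ * (ρ ^ s * ‖X 1 - z‖ ^ 2) := by gcongr
        _ = _ := by ring
  obtain ⟨s, rfl⟩ : ∃ s, t = s + 1 + 1 := ⟨t - 2, by omega⟩
  have h2 := step_sub_le_min hβ hK hconv hdiff hsmooth (pgd_mem h1 hX (s + 1) (by omega))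
    (hX (s + 1) (by omega)) hz
  have h3 := hdist (s + 1) (by omega)
  simp only [Nat.add_sub_cancel] at h3 ⊢
  calc _ ≤ β / 2 * (195 / 196 * ‖X (s + 1) - z‖ ^ 2) := h2
    _ ≤ β / 2 * (ρ * (ρ ^ s * ‖X 1 - z‖ ^ 2)) := by gcongr
    _ = _ := by ring

end ProjectedGradient

/-! ### Matrix singular value decompositions, complex and real -/

section MatrixSVD

/-- The rectangular diagonal matrix with diagonal `s`. -/
def rectDiag (𝕜 : Type*) [RCLike 𝕜] (p q : ℕ) (s : ℕ → ℝ) : Matrix (Fin p) (Fin q) 𝕜 :=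
  Matrix.of fun a b => if (a : ℕ) = (b : ℕ) then ((s a : ℝ) : 𝕜) else 0

variable {p q : ℕ}

theorem mul_rectDiag {𝕜 : Type*} [RCLike 𝕜] (U : Matrix (Fin p) (Fin p) 𝕜) (s : ℕ → ℝ)
    (i : Fin p) (j : Fin q) : (U * rectDiag 𝕜 p q s) i j =
      if h : (j : ℕ) < p then (s j : 𝕜) * U i ⟨j, h⟩ else 0 := by
  rw [Matrix.mul_apply]
  split_ifs with h
  · rw [Finset.sum_eq_single ⟨j, h⟩]
    · simp [rectDiag, mul_comm]
    · intro k _ hk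
      have : (k : ℕ) ≠ j := fun h' => hk (Fin.ext h')
      simp [rectDiag, this]
    · simp
  · refine Finset.sum_eq_zero fun k _ => ?_
    have : (k : ℕ) ≠ j := by have := k.2; omega
    simp [rectDiag, this]

theorem exists_matrix_svd {𝕜 : Type*} [RCLike 𝕜] (M : Matrix (Fin p) (Fin q) 𝕜) :
    ∃ U ∈ Matrix.unitaryGroup (Fin p) 𝕜, ∃ V ∈ Matrix.unitaryGroup (Fin q) 𝕜,
      M = U * rectDiag 𝕜 p q (Matrix.toEuclideanLin M).singularValues * V.conjTranspose := by
  obtain ⟨b, a, h⟩ := exists_svd (p := q) (q := p) (by simp) (by simp) (Matrix.toEuclideanLin M)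
  have hunit : ∀ {m : ℕ} (c : OrthonormalBasis (Fin m) 𝕜 (EuclideanSpace 𝕜 (Fin m))),
      Matrix.of (fun i j => c j i) ∈ Matrix.unitaryGroup (Fin m) 𝕜 := by
    intro m c
    rw [Matrix.mem_unitaryGroup_iff']
    ext j k
    have := c.inner_eq_ite j k
    rw [PiLp.inner_apply] at this
    rw [Matrix.mul_apply, Matrix.one_apply, ← this]
    simp [Matrix.star_apply, mul_comm]
  refine ⟨_, hunit a, _, hunit b, ?_⟩
  have hMV : M * Matrix.of (fun i j => b j i) =
      Matrix.of (fun i j => a j i) * rectDiag 𝕜 p q (Matrix.toEuclideanLin M).singularValues := by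
    ext i j
    rw [mul_rectDiag]
    have h1 := congrArg (fun v => v i) (h j)
    simp only [Matrix.toLpLin_apply] at h1
    have h2 : (M * Matrix.of (fun i j => b j i)) i j = M.mulVec (b j).ofLp i := rfl
    rw [h2, h1]
    split_ifs
    · simp [RCLike.real_smul_eq_coe_mul]
    · simp
  rw [← hMV, Matrix.mul_assoc]
  have := (Matrix.mem_unitaryGroup_iff).1 (hunit b)
  rw [Matrix.star_eq_conjTranspose] at this
  rw [this, Matrix.mul_one]

theorem exists_basis_of_unitary {m : ℕ} {U : Matrix (Fin m) (Fin m) ℂ}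
    (hU : U ∈ Matrix.unitaryGroup (Fin m) ℂ) :
    ∃ a : OrthonormalBasis (Fin m) ℂ (EuclideanSpace ℂ (Fin m)), ∀ i j, a j i = U i j := by
  obtain ⟨a, ha⟩ := exists_orthonormalBasis_eq (𝕜 := ℂ)
    (v := fun j => (WithLp.toLp 2 fun i => U i j : EuclideanSpace ℂ (Fin m))) (by
      rw [orthonormal_iff_ite]
      intro j k
      have := congrFun (congrFun (Matrix.mem_unitaryGroup_iff'.1 hU) j) k
      rw [Matrix.mul_apply, Matrix.one_apply] at this
      rw [← this, PiLp.inner_apply]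
      simp [Matrix.star_apply, mul_comm]) (by simp)
  exact ⟨a, fun i j => by rw [ha]⟩

theorem exists_toEuclideanLin_eq_diagMap {U : Matrix (Fin p) (Fin p) ℂ}
    {V : Matrix (Fin q) (Fin q) ℂ} (hU : U ∈ Matrix.unitaryGroup (Fin p) ℂ)
    (hV : V ∈ Matrix.unitaryGroup (Fin q) ℂ) :
    ∃ (b : OrthonormalBasis (Fin q) ℂ (EuclideanSpace ℂ (Fin q)))
      (a : OrthonormalBasis (Fin p) ℂ (EuclideanSpace ℂ (Fin p))), ∀ s : ℕ → ℝ,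
      Matrix.toEuclideanLin (U * rectDiag ℂ p q s * V.conjTranspose) = diagMap b a s := by
  obtain ⟨a, ha⟩ := exists_basis_of_unitary hU
  obtain ⟨b, hb⟩ := exists_basis_of_unitary hV
  refine ⟨b, a, fun s => eq_diagMap b a fun j => ?_⟩
  have h1 : U * rectDiag ℂ p q s * V.conjTranspose * V = U * rectDiag ℂ p q s := by
    have := (Matrix.mem_unitaryGroup_iff').1 hV
    rw [Matrix.star_eq_conjTranspose] at this
    rw [Matrix.mul_assoc, this, Matrix.mul_one]
  ext i
  have h2 : Matrix.toEuclideanLin (U * rectDiag ℂ p q s * V.conjTranspose) (b j) i =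
      (U * rectDiag ℂ p q s * V.conjTranspose * V) i j := by
    rw [Matrix.toLpLin_apply, Matrix.mul_apply]
    simp only [Matrix.mulVec, dotProduct, hb]
  rw [h2, h1, mul_rectDiag]
  split_ifs <;> simp [ha]

theorem sv_eq_of_svd {U : Matrix (Fin p) (Fin p) ℂ}
    {V : Matrix (Fin q) (Fin q) ℂ} (hU : U ∈ Matrix.unitaryGroup (Fin p) ℂ)
    (hV : V ∈ Matrix.unitaryGroup (Fin q) ℂ) {s : ℕ → ℝ} (hs0 : ∀ j, 0 ≤ s j) (hs : Antitone s)
    {j : ℕ} (hjp : j < p) (hjq : j < q) :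
    sv (U * rectDiag ℂ p q s * V.conjTranspose) j = s j := by
  obtain ⟨b, a, h⟩ := exists_toEuclideanLin_eq_diagMap hU hV
  have hnorm : ∀ k : Fin q, ‖diagMap b a s (b k)‖ = if (k : ℕ) < p then s k else 0 := by
    intro k
    rw [diagMap_basis]
    split_ifs
    · simp [norm_smul, abs_of_nonneg (hs0 _)]
    · simp
  rw [sv, h, singularValues_eq_norm b (diagMap b a s) (inner_diagMap_basis b a s) ?_ ⟨j, hjq⟩,
    hnorm, if_pos hjp]
  intro k l hkl
  simp only [hnorm]
  have : (k : ℕ) ≤ l := hkl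
  split_ifs
  · exact hs this
  · omega
  · exact hs0 _
  · exact le_rfl

theorem rectDiag_congr {𝕜 : Type*} [RCLike 𝕜] {s t : ℕ → ℝ} (h : ∀ j, j < p → j < q → s j = t j) :
    rectDiag 𝕜 p q s = rectDiag 𝕜 p q t := by
  ext a b
  simp only [rectDiag, Matrix.of_apply]
  split_ifs with hab
  · rw [h a a.2 (hab ▸ b.2)]
  · rfl

theorem rectDiag_map_conj (s : ℕ → ℝ) :
    (rectDiag ℂ p q s).map (starRingEnd ℂ) = rectDiag ℂ p q s := by
  ext a b
  simp only [rectDiag, Matrix.of_apply, Matrix.map_apply]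
  split_ifs <;> simp

/-- Needed at the self-conjugate frequencies: there the slice is real and the factors of a t-SVD
must be real too. An SVD over `ℝ` is complexified. -/
theorem exists_real_svd {M : Matrix (Fin p) (Fin q) ℂ} (hM : M.map (starRingEnd ℂ) = M) :
    ∃ U ∈ Matrix.unitaryGroup (Fin p) ℂ, ∃ V ∈ Matrix.unitaryGroup (Fin q) ℂ,
      U.map (starRingEnd ℂ) = U ∧ V.map (starRingEnd ℂ) = V ∧
      M = U * rectDiag ℂ p q (sv M) * V.conjTranspose := by
  set R : Matrix (Fin p) (Fin q) ℝ := M.map Complex.re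
  have hR : M = R.map Complex.ofRealHom := by
    ext a b
    have := congrFun (congrFun hM a) b
    simp only [Matrix.map_apply] at this
    simp [R, Complex.conj_eq_iff_re.1 this]
  obtain ⟨U, hU, V, hV, h⟩ := exists_matrix_svd R
  have hmap : ∀ {m : ℕ} {A : Matrix (Fin m) (Fin m) ℝ}, A ∈ Matrix.unitaryGroup (Fin m) ℝ →
      A.map Complex.ofRealHom ∈ Matrix.unitaryGroup (Fin m) ℂ := by
    intro m A hA
    rw [Matrix.mem_unitaryGroup_iff] at hA ⊢
    have h1 : star (A.map Complex.ofRealHom) = (star A).map Complex.ofRealHom := by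
      ext i j
      simp [Matrix.star_apply]
    rw [h1, ← Matrix.map_mul, hA]
    ext i j
    simp [Matrix.one_apply, apply_ite]
  have hconj : ∀ {m : ℕ} (A : Matrix (Fin m) (Fin m) ℝ),
      (A.map Complex.ofRealHom).map (starRingEnd ℂ) = A.map Complex.ofRealHom := by
    intro m A
    ext i j
    simp
  have hV' : (V.map Complex.ofRealHom).conjTranspose = V.conjTranspose.map Complex.ofRealHom := by
    ext i j
    simp
  have hD : ∀ s, rectDiag ℂ p q s = (rectDiag ℝ p q s).map Complex.ofRealHom := by
    intro s
    ext i j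
    simp only [rectDiag, Matrix.of_apply, Matrix.map_apply]
    split_ifs <;> simp
  set s := (Matrix.toEuclideanLin R).singularValues
  have hMs : M = U.map Complex.ofRealHom * rectDiag ℂ p q s *
      (V.map Complex.ofRealHom).conjTranspose := by
    rw [hR, hV', hD, ← Matrix.map_mul, ← Matrix.map_mul]
    exact congrArg (fun A => A.map Complex.ofRealHom) h
  refine ⟨_, hmap hU, _, hmap hV, hconj U, hconj V, ?_⟩
  have hsv : ∀ j, j < p → j < q → sv M j = s j := by
    intro j hp hq
    rw [hMs]
    exact sv_eq_of_svd (hmap hU) (hmap hV) (LinearMap.singularValues_nonneg _)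
      (LinearMap.singularValues_antitone _) hp hq
  rw [rectDiag_congr hsv]
  exact hMs

theorem map_conj_mem_unitaryGroup {m : ℕ} {A : Matrix (Fin m) (Fin m) ℂ}
    (hA : A ∈ Matrix.unitaryGroup (Fin m) ℂ) :
    A.map (starRingEnd ℂ) ∈ Matrix.unitaryGroup (Fin m) ℂ := by
  rw [Matrix.mem_unitaryGroup_iff] at hA ⊢
  have h1 : star (A.map (starRingEnd ℂ)) = (star A).map (starRingEnd ℂ) := by
    ext i j
    simp [Matrix.star_apply]
  rw [h1, ← Matrix.map_mul, hA]
  ext i j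
  simp [Matrix.one_apply, apply_ite]

theorem map_conj_svd (U : Matrix (Fin p) (Fin p) ℂ) (V : Matrix (Fin q) (Fin q) ℂ) (s : ℕ → ℝ) :
    (U * rectDiag ℂ p q s * V.conjTranspose).map (starRingEnd ℂ) =
      U.map (starRingEnd ℂ) * rectDiag ℂ p q s * (V.map (starRingEnd ℂ)).conjTranspose := by
  rw [Matrix.map_mul, Matrix.map_mul, rectDiag_map_conj]
  rfl

end MatrixSVD

/-! ### Existence of t-SVDs, and when truncation is the projection -/

section TSVD

variable {n₁ n₂ k : ℕ} {n : Fin k → ℕ}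

theorem map_conj_map_conj {α β : Type*} (A : Matrix α β ℂ) :
    (A.map (starRingEnd ℂ)).map (starRingEnd ℂ) = A := by
  ext i j
  simp

/-- An SVD is chosen at one index of each pair `{i, -i}` and conjugated at the other; when `i = -i`
a real SVD is used. Conjugate symmetry makes the factors real tensors. -/
theorem exists_isTSVD (X : Tensor n₁ n₂ n) :
    ∃ (U : Tensor n₁ n₁ n) (V : Tensor n₂ n₂ n), IsTSVD X U V := by
  have hbase : ∀ i : SliceIdx n, ∃ W : Matrix (Fin n₁) (Fin n₁) ℂ × Matrix (Fin n₂) (Fin n₂) ℂ,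
      (W.1 ∈ Matrix.unitaryGroup (Fin n₁) ℂ ∧ W.2 ∈ Matrix.unitaryGroup (Fin n₂) ℂ ∧
      fslice X i = W.1 * rectDiag ℂ n₁ n₂ (sv (fslice X i)) * W.2.conjTranspose) ∧
      (conjIdx i = i → W.1.map (starRingEnd ℂ) = W.1 ∧ W.2.map (starRingEnd ℂ) = W.2) := by
    intro i
    by_cases hi : conjIdx i = i
    · obtain ⟨U, hU, V, hV, h1, h2, h3⟩ := exists_real_svd (M := fslice X i) (by
        rw [← fslice_conjIdx, hi])
      exact ⟨(U, V), ⟨hU, hV, h3⟩, fun _ => ⟨h1, h2⟩⟩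
    · obtain ⟨U, hU, V, hV, h3⟩ := exists_matrix_svd (fslice X i)
      exact ⟨(U, V), ⟨hU, hV, h3⟩, fun h => absurd h hi⟩
  choose W hW hWreal using hbase
  -- An arbitrary enumeration, used only to select one representative of each pair.
  set e := Fintype.equivFin (SliceIdx n)
  set A : SliceIdx n → Matrix (Fin n₁) (Fin n₁) ℂ := fun i =>
    if e i ≤ e (conjIdx i) then (W i).1 else (W (conjIdx i)).1.map (starRingEnd ℂ) with hA
  set B : SliceIdx n → Matrix (Fin n₂) (Fin n₂) ℂ := fun i =>
    if e i ≤ e (conjIdx i) then (W i).2 else (W (conjIdx i)).2.map (starRingEnd ℂ) with hB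
  have hAc : ∀ i, A (conjIdx i) = (A i).map (starRingEnd ℂ) := by
    intro i
    simp only [hA, conjIdx_conjIdx]
    rcases lt_trichotomy (e i) (e (conjIdx i)) with h | h | h
    · rw [if_neg (not_le.2 h), if_pos h.le]
    · have hi : i = conjIdx i := e.injective h
      rw [if_pos h.ge, if_pos h.le, ← hi]
      exact ((hWreal i hi.symm).1).symm
    · rw [if_pos h.le, if_neg (not_le.2 h), map_conj_map_conj]
  have hBc : ∀ i, B (conjIdx i) = (B i).map (starRingEnd ℂ) := by
    intro i
    simp only [hB, conjIdx_conjIdx]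
    rcases lt_trichotomy (e i) (e (conjIdx i)) with h | h | h
    · rw [if_neg (not_le.2 h), if_pos h.le]
    · have hi : i = conjIdx i := e.injective h
      rw [if_pos h.ge, if_pos h.le, ← hi]
      exact ((hWreal i hi.symm).2).symm
    · rw [if_pos h.le, if_neg (not_le.2 h), map_conj_map_conj]
  refine ⟨ofSlices A, ofSlices B, fun i => ?_⟩
  rw [fslice_ofSlices_of_conj hAc, fslice_ofSlices_of_conj hBc]
  obtain ⟨h1, h2, h3⟩ := hW i
  by_cases hi : e i ≤ e (conjIdx i)
  · simp only [hA, hB, if_pos hi]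
    exact ⟨h1, h2, h3⟩
  · simp only [hA, hB, if_neg hi]
    obtain ⟨h1, h2, h3⟩ := hW (conjIdx i)
    refine ⟨map_conj_mem_unitaryGroup h1, map_conj_mem_unitaryGroup h2, ?_⟩
    have h4 := fslice_conjIdx X (conjIdx i)
    rw [conjIdx_conjIdx] at h4
    have h5 : sv (fslice X i) = sv (fslice X (conjIdx i)) := by
      funext j
      rw [h4, sv_map_conj]
    have h6 := map_conj_svd (W (conjIdx i)).1 (W (conjIdx i)).2 (sv (fslice X (conjIdx i)))
    rw [← h3, ← h4, ← h5] at h6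
    exact h6

theorem slice_truncation {X Y : Tensor n₁ n₂ n} {U : Tensor n₁ n₁ n} {V : Tensor n₂ n₂ n}
    (hUV : IsTSVD X U V) {r : ℕ} {s : ℝ} {i : SliceIdx n} (hY : fslice Y i = fslice U i *
      (Matrix.of fun (a : Fin n₁) (b : Fin n₂) =>
        if (a : ℕ) = (b : ℕ) ∧ (a : ℕ) < r then
          ((max 0 (sv (fslice X i) a - s) : ℝ) : ℂ) else 0) *
      (fslice V i).conjTranspose) :
    ∃ (b : OrthonormalBasis (Fin n₂) ℂ (EuclideanSpace ℂ (Fin n₂)))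
      (a : OrthonormalBasis (Fin n₁) ℂ (EuclideanSpace ℂ (Fin n₁))),
      slice X i = diagMap b a (sv (fslice X i)) ∧
      slice Y i = diagMap b a fun j => if j < r then max 0 (sv (fslice X i) j - s) else 0 := by
  obtain ⟨hU, hV, hX⟩ := hUV i
  obtain ⟨b, a, h⟩ := exists_toEuclideanLin_eq_diagMap hU hV
  refine ⟨b, a, ?_, ?_⟩
  · rw [← h]
    exact congrArg Matrix.toEuclideanLin hX
  · rw [← h, slice, hY]
    congr 3
    ext x y
    simp only [rectDiag, Matrix.of_apply, ite_and]
    split_ifs <;> simp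

theorem exists_isTruncProj {X : Tensor n₁ n₂ n} {r : ℕ} {τ s : ℝ} (hs0 : 0 ≤ s)
    (hs : (1 / (numSlices n : ℝ)) *
      ∑ i : SliceIdx n, ∑ j ∈ Finset.range r, max 0 (sv (fslice X i) j - s) = τ) :
    ∃ Y, IsTruncProj r τ X Y := by
  obtain ⟨U, V, hUV⟩ := exists_isTSVD X
  refine ⟨ofSlices fun i => fslice U i *
      (Matrix.of fun (a : Fin n₁) (b : Fin n₂) =>
        if (a : ℕ) = (b : ℕ) ∧ (a : ℕ) < r then
          ((max 0 (sv (fslice X i) a - s) : ℝ) : ℂ) else 0) *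
      (fslice V i).conjTranspose, U, V, s, hUV, hs0, hs, fun i => ?_⟩
  refine fslice_ofSlices_of_conj (fun i => ?_) i
  have h1 : sv (fslice X (conjIdx i)) = sv (fslice X i) := by
    funext j
    rw [fslice_conjIdx, sv_map_conj]
  rw [Matrix.map_mul, Matrix.map_mul, h1, fslice_conjIdx, fslice_conjIdx]
  congr 2
  ext x y
  simp only [Matrix.of_apply, Matrix.map_apply]
  split_ifs <;> simp

theorem tnn_add_le (X Y : Tensor n₁ n₂ n) : tnn (X + Y) ≤ tnn X + tnn Y := by
  simp only [tnn_eq_sum_nuc, slice_add]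
  rw [← mul_add, ← Finset.sum_add_distrib]
  refine mul_le_mul_of_nonneg_left (Finset.sum_le_sum fun i _ => ?_)
    (by positivity : (0 : ℝ) ≤ 1 / (numSlices n : ℝ))
  exact nuc_add_le _ _

theorem tnn_smul_le {c : ℝ} (hc : 0 ≤ c) (X : Tensor n₁ n₂ n) : tnn (c • X) ≤ c * tnn X := by
  simp only [tnn_eq_sum_nuc, slice_smul]
  rw [mul_left_comm c, Finset.mul_sum (a := c)]
  refine mul_le_mul_of_nonneg_left (Finset.sum_le_sum fun i _ => ?_)
    (by positivity : (0 : ℝ) ≤ 1 / (numSlices n : ℝ))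
  exact nuc_smul_le hc _

theorem convex_ball (τ : ℝ) : Convex ℝ (ball n₁ n₂ n τ) := by
  intro X hX Y hY a b ha hb hab
  refine (tnn_add_le _ _).trans ?_
  have h1 := (tnn_smul_le ha X).trans (mul_le_mul_of_nonneg_left hX ha)
  have h2 := (tnn_smul_le hb Y).trans (mul_le_mul_of_nonneg_left hY hb)
  have h3 : a * τ + b * τ = τ := by rw [← add_mul, hab, one_mul]
  linarith

/-- A tensor whose slices are bounded by `c` in operator norm has dual norm at most `c`. -/
theorem inner_le_mul_tnn {G : Tensor n₁ n₂ n} {c : ℝ} (hG : ∀ i x, ‖slice G i x‖ ≤ c * ‖x‖)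
    (X : Tensor n₁ n₂ n) : inner ℝ G X ≤ c * tnn X := by
  rw [inner_eq_sum_hs, tnn_eq_sum_nuc, mul_left_comm c, Finset.mul_sum (a := c)]
  refine mul_le_mul_of_nonneg_left (Finset.sum_le_sum fun i _ => ?_)
    (by positivity : (0 : ℝ) ≤ 1 / (numSlices n : ℝ))
  exact hs_le_mul_nuc (hG i) _

/-- If the threshold dominates the discarded singular values, then the truncated projection
satisfies the variational inequality of the exact projection. -/
theorem inner_le_zero_of_truncation {X Y : Tensor n₁ n₂ n} {U : Tensor n₁ n₁ n}
    {V : Tensor n₂ n₂ n} (hUV : IsTSVD X U V) {r : ℕ} (hr : r ≤ min n₁ n₂) {s : ℝ} (hs0 : 0 ≤ s)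
    (hτ : (1 / (numSlices n : ℝ)) *
      ∑ i : SliceIdx n, ∑ j ∈ Finset.range r, max 0 (sv (fslice X i) j - s) = 1)
    (hY : ∀ i : SliceIdx n, fslice Y i = fslice U i *
      (Matrix.of fun (a : Fin n₁) (b : Fin n₂) =>
        if (a : ℕ) = (b : ℕ) ∧ (a : ℕ) < r then
          ((max 0 (sv (fslice X i) a - s) : ℝ) : ℂ) else 0) *
      (fslice V i).conjTranspose)
    (hsr : ∀ i, sv (fslice X i) r ≤ s) :
    Y ∈ ball n₁ n₂ n 1 ∧ ∀ Z ∈ ball n₁ n₂ n 1, inner ℝ (X - Y) (Z - Y) ≤ 0 := by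
  have hsum : ∀ φ : ℕ → ℝ, ∑ j ∈ Finset.range (min n₁ n₂), (if j < r then φ j else 0) =
      ∑ j ∈ Finset.range r, φ j := by
    intro φ
    rw [← Finset.sum_filter]
    congr 1
    ext j
    simp only [Finset.mem_filter, Finset.mem_range]
    omega
  choose b a hXd hYd using fun i => slice_truncation hUV (hY i)
  have hnonneg : ∀ i j, 0 ≤ sv (fslice X i) j := fun i j => LinearMap.singularValues_nonneg _ j
  have hYball : tnn Y ≤ 1 := by
    rw [tnn_eq_sum_nuc]
    refine le_trans ?_ hτ.le
    refine mul_le_mul_of_nonneg_left (Finset.sum_le_sum fun i _ => ?_)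
      (by positivity : (0 : ℝ) ≤ 1 / (numSlices n : ℝ))
    rw [hYd, ← hsum]
    exact nuc_diagMap_le _ _ fun j => by split_ifs <;> simp
  have hXY : ∀ i, slice (X - Y) i = diagMap (b i) (a i) fun j => sv (fslice X i) j +
      (-1) * (if j < r then max 0 (sv (fslice X i) j - s) else 0) := by
    intro i
    rw [diagMap_add, diagMap_smul, ← hXd, ← hYd, slice_sub, sub_eq_add_neg]
    simp
  refine ⟨hYball, fun Z hZ => ?_⟩
  -- `X - Y` has slices of operator norm at most `s`: kept singular values become `min σ s`,
  -- discarded ones are below `s` by `hsr`. Together with `⟨X - Y, Y⟩ = s` this puts `X - Y` in the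
  -- normal cone at `Y`.
  have h1 : inner ℝ (X - Y) Z ≤ s * tnn Z := by
    refine inner_le_mul_tnn (fun i x => ?_) Z
    rw [hXY]
    refine norm_diagMap_le _ _ hs0 (fun j _ => ?_) x
    have h0 := hnonneg i j
    split_ifs with hj
    · rcases le_total (sv (fslice X i) j) s with h | h
      · rw [max_eq_left (by linarith), abs_le]; constructor <;> linarith
      · rw [max_eq_right (by linarith), abs_le]; constructor <;> linarith
    · rw [mul_zero, add_zero, abs_of_nonneg h0]
      exact (LinearMap.singularValues_antitone _ (not_lt.1 hj)).trans (hsr i)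
  have h2 : inner ℝ (X - Y) Y = s := by
    rw [inner_eq_sum_hs]
    have h3 : ∀ i, hs (slice (X - Y) i) (slice Y i) =
        s * ∑ j ∈ Finset.range r, max 0 (sv (fslice X i) j - s) := by
      intro i
      rw [hXY, hYd, hs_diagMap_diagMap, Finset.mul_sum, ← hsum]
      refine Finset.sum_congr rfl fun j _ => ?_
      split_ifs
      · rcases le_total (sv (fslice X i) j) s with h | h
        · rw [max_eq_left (by linarith)]; ring
        · rw [max_eq_right (by linarith)]; ring
      · ring
    rw [Finset.sum_congr rfl fun i _ => h3 i, ← Finset.mul_sum, mul_left_comm, hτ, mul_one]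
  rw [inner_sub_right, h2]
  have h4 : s * tnn Z ≤ s * 1 := mul_le_mul_of_nonneg_left hZ hs0
  linarith

end TSVD

/-! ### Singular values of the block diagonal matrix -/

section BlockDiagonal

variable {n₁ n₂ k : ℕ} {n : Fin k → ℕ}

/-- The component with slice index `i` of a vector of the block diagonal space. -/
noncomputable def blockPart {p : ℕ} (x : EuclideanSpace ℂ (Fin p × SliceIdx n)) (i : SliceIdx n) :
    EuclideanSpace ℂ (Fin p) :=
  WithLp.toLp 2 fun b => x (b, i)

/-- The vector of the block diagonal space with the single component `v` at `i`. -/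
noncomputable def blockSingle {p : ℕ} (i : SliceIdx n) (v : EuclideanSpace ℂ (Fin p)) :
    EuclideanSpace ℂ (Fin p × SliceIdx n) :=
  WithLp.toLp 2 fun y => if y.2 = i then v y.1 else 0

theorem norm_sq_eq_sum_blockPart {p : ℕ} (x : EuclideanSpace ℂ (Fin p × SliceIdx n)) :
    ‖x‖ ^ 2 = ∑ i, ‖blockPart x i‖ ^ 2 := by
  simp only [EuclideanSpace.norm_sq_eq, blockPart]
  rw [Fintype.sum_prod_type, Finset.sum_comm]

theorem inner_blockSingle {p : ℕ} (i : SliceIdx n) (v : EuclideanSpace ℂ (Fin p))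
    (x : EuclideanSpace ℂ (Fin p × SliceIdx n)) :
    inner ℂ (blockSingle i v) x = inner ℂ v (blockPart x i) := by
  simp only [PiLp.inner_apply, blockSingle, blockPart]
  rw [Fintype.sum_prod_type]
  refine Finset.sum_congr rfl fun b _ => ?_
  rw [Finset.sum_eq_single i]
  · simp
  · intro j _ hj
    simp [hj]
  · simp

theorem norm_blockSingle {p : ℕ} (i : SliceIdx n) (v : EuclideanSpace ℂ (Fin p)) :
    ‖blockSingle i v‖ = ‖v‖ := by
  have h1 := inner_blockSingle i v (blockSingle i v)
  have h2 : blockPart (blockSingle i v) i = v := by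
    ext b
    simp [blockPart, blockSingle]
  rw [h2, inner_self_eq_norm_sq_to_K, inner_self_eq_norm_sq_to_K] at h1
  have h3 : ‖blockSingle i v‖ ^ 2 = ‖v‖ ^ 2 := by exact_mod_cast h1
  exact (sq_eq_sq₀ (norm_nonneg _) (norm_nonneg _)).1 h3

theorem blockPart_bdiag (G : Tensor n₁ n₂ n) (x : EuclideanSpace ℂ (Fin n₂ × SliceIdx n))
    (i : SliceIdx n) :
    blockPart (Matrix.toEuclideanLin (bdiag G) x) i = slice G i (blockPart x i) := by
  ext a
  simp only [blockPart, slice, Matrix.toLpLin_apply, Matrix.mulVec, dotProduct, bdiag]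
  rw [Fintype.sum_prod_type]
  refine Finset.sum_congr rfl fun b _ => ?_
  rw [Finset.sum_eq_single i]
  · simp [Matrix.blockDiagonal_apply]
  · intro j _ hj
    simp [Matrix.blockDiagonal_apply, hj.symm]
  · simp

/-- Min-max with the span of the leading `m i` right singular vectors of every block. Indices beyond
`n₂` contribute the zero vector, which does not raise the dimension. -/
theorem sv_bdiag_le (G : Tensor n₁ n₂ n) (m : SliceIdx n → ℕ) {c : ℝ} (hc : 0 ≤ c)
    (h : ∀ i, sv (fslice G i) (m i) ≤ c) : sv (bdiag G) (∑ i, m i) ≤ c := by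
  choose b hb hn using fun i => exists_rightSingularBasis (p := n₂) (by simp) (slice G i)
  set v : (Σ i : SliceIdx n, Fin (m i)) → EuclideanSpace ℂ (Fin n₂ × SliceIdx n) := fun y =>
    if hj : (y.2 : ℕ) < n₂ then blockSingle y.1 (b y.1 ⟨y.2, hj⟩) else 0 with hv
  refine singularValues_le_of_subspace _ hc (S := Submodule.span ℂ (Set.range v)) ?_ fun x hx => ?_
  · refine (finrank_range_le_card v).trans ?_
    simp
  have hpart : ∀ i, ‖slice G i (blockPart x i)‖ ≤ c * ‖blockPart x i‖ := by
    intro i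
    refine norm_apply_le_of_mem_headSpan_orthogonal (hb i) (j := m i) hc
      (fun l hl => ?_) ?_
    · rw [hn]
      exact (LinearMap.singularValues_antitone _ hl).trans (h i)
    · rw [headSpan, Submodule.mem_orthogonal]
      intro u hu
      induction hu using Submodule.span_induction with
      | mem u hu =>
        obtain ⟨l, hl, rfl⟩ := hu
        have h1 : v ⟨i, ⟨l, hl⟩⟩ = blockSingle i (b i l) := by simp [hv]
        rw [← inner_blockSingle, ← h1]
        exact hx _ (Submodule.subset_span ⟨_, rfl⟩)
      | zero => simp
      | add u w _ _ hu hw => rw [inner_add_left, hu, hw, add_zero]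
      | smul t u _ hu => rw [inner_smul_left, hu, mul_zero]
  refine le_of_sq_le_sq ?_ (by positivity)
  rw [norm_sq_eq_sum_blockPart, mul_pow, norm_sq_eq_sum_blockPart x, Finset.mul_sum]
  refine Finset.sum_le_sum fun i _ => ?_
  rw [blockPart_bdiag, ← mul_pow]
  exact pow_le_pow_left₀ (norm_nonneg _) (hpart i) 2

theorem sv_fslice_le_sv_bdiag (G : Tensor n₁ n₂ n) (i : SliceIdx n) (j : ℕ) :
    sv (fslice G i) j ≤ sv (bdiag G) 0 := by
  refine (LinearMap.singularValues_antitone _ (Nat.zero_le j)).trans ?_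
  refine singularValues_le_of_subspace _ (LinearMap.singularValues_nonneg _ _) (S := ⊥)
    (by simp) fun x _ => ?_
  have h1 := norm_apply_le_singularValues_zero (Matrix.toEuclideanLin (bdiag G)) (blockSingle i x)
  have h2 : blockPart (blockSingle i x) i = x := by
    ext b
    simp [blockPart, blockSingle]
  have h3 : ‖slice G i x‖ ≤ ‖Matrix.toEuclideanLin (bdiag G) (blockSingle i x)‖ := by
    refine le_of_sq_le_sq ?_ (norm_nonneg _)
    rw [norm_sq_eq_sum_blockPart]
    have := Finset.single_le_sum
      (f := fun i' => ‖blockPart (Matrix.toEuclideanLin (bdiag G) (blockSingle i x)) i'‖ ^ 2)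
      (fun i' _ => sq_nonneg _) (Finset.mem_univ i)
    simpa [blockPart_bdiag, h2] using this
  rw [norm_blockSingle] at h1
  exact h3.trans h1

theorem norm_slice_le_sv_bdiag (G : Tensor n₁ n₂ n) (i : SliceIdx n)
    (x : EuclideanSpace ℂ (Fin n₂)) : ‖slice G i x‖ ≤ sv (bdiag G) 0 * ‖x‖ :=
  (norm_apply_le_singularValues_zero _ x).trans
    (mul_le_mul_of_nonneg_right (sv_fslice_le_sv_bdiag G i 0) (norm_nonneg _))

theorem sv_bdiag_pos {G : Tensor n₁ n₂ n} (hG : G ≠ 0) : 0 < sv (bdiag G) 0 := by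
  refine lt_of_le_of_ne (LinearMap.singularValues_nonneg _ _) fun h => hG ?_
  refine fslice_injective fun i => ?_
  apply Matrix.toEuclideanLin.injective
  ext1 x
  have h1 := norm_slice_le_sv_bdiag G i x
  rw [← h, zero_mul] at h1
  have h2 : slice G i x = 0 := norm_le_zero_iff.1 h1
  have h3 : slice (0 : Tensor n₁ n₂ n) i x = 0 := by
    have := slice_smul 0 (0 : Tensor n₁ n₂ n) i
    simp only [zero_smul, Complex.ofReal_zero] at this
    rw [this]; rfl
  exact h2.trans h3.symm

theorem exists_sv_eq_sv_bdiag [Nonempty (SliceIdx n)] (G : Tensor n₁ n₂ n) :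
    ∃ i, sv (fslice G i) 0 = sv (bdiag G) 0 := by
  obtain ⟨i, -, hi⟩ := Finset.exists_max_image Finset.univ (fun i => sv (fslice G i) 0)
    Finset.univ_nonempty
  refine ⟨i, le_antisymm (sv_fslice_le_sv_bdiag G i 0) ?_⟩
  have := sv_bdiag_le G (fun _ => 0) (c := sv (fslice G i) 0) (LinearMap.singularValues_nonneg _ _)
    (fun i' => hi i' (Finset.mem_univ _))
  simpa using this

theorem nonempty_of_ne_zero {G : Tensor n₁ n₂ n} (hG : G ≠ 0) :
    Nonempty (Fin n₁) ∧ Nonempty (Fin n₂) ∧ Nonempty (SliceIdx n) := by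
  have h : Nonempty (Fin n₁ × Fin n₂ × SliceIdx n) := by
    by_contra hc
    rw [not_nonempty_iff] at hc
    exact hG (by ext x; exact hc.elim x)
  obtain ⟨a, b, i⟩ := h
  exact ⟨⟨a⟩, ⟨b⟩, ⟨i⟩⟩

end BlockDiagonal

/-! ### Duality on the ball and the structure of the optimum -/

section Duality

variable {n₁ n₂ k : ℕ} {n : Fin k → ℕ}

theorem nuc_zero {E F : Type*} [NormedAddCommGroup E] [InnerProductSpace ℂ E]
    [FiniteDimensional ℂ E] [NormedAddCommGroup F] [InnerProductSpace ℂ F]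
    [FiniteDimensional ℂ F] : nuc (0 : E →ₗ[ℂ] F) = 0 := by
  simp [nuc]

theorem nuc_neg_le {E F : Type*} [NormedAddCommGroup E] [InnerProductSpace ℂ E]
    [FiniteDimensional ℂ E] [NormedAddCommGroup F] [InnerProductSpace ℂ F]
    [FiniteDimensional ℂ F] (T : E →ₗ[ℂ] F) : nuc (-T) ≤ nuc T :=
  nuc_le_of_forall_hs_le fun W hW => by
    rw [hs_neg_right, ← hs_neg_left]
    exact hs_le_nuc (by simpa using hW) T

/-- The real tensor that pairs with every tensor like `L` placed in the single slice `i₀`. -/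
noncomputable def singleSlice (i₀ : SliceIdx n)
    (L : EuclideanSpace ℂ (Fin n₂) →ₗ[ℂ] EuclideanSpace ℂ (Fin n₁)) : Tensor n₁ n₂ n :=
  ofSlices fun i => if i = i₀ then Matrix.toEuclideanLin.symm L else 0

theorem inner_singleSlice (i₀ : SliceIdx n)
    (L : EuclideanSpace ℂ (Fin n₂) →ₗ[ℂ] EuclideanSpace ℂ (Fin n₁)) (X : Tensor n₁ n₂ n) :
    inner ℝ (singleSlice i₀ L) X = (1 / (numSlices n : ℝ)) * hs L (slice X i₀) := by
  rw [singleSlice, inner_ofSlices, Finset.sum_eq_single i₀]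
  · simp
  · intro i _ hi
    simp [hi, hs]
  · simp

theorem tnn_singleSlice_le (i₀ : SliceIdx n)
    (L : EuclideanSpace ℂ (Fin n₂) →ₗ[ℂ] EuclideanSpace ℂ (Fin n₁)) :
    tnn (singleSlice i₀ L) ≤ (1 / (numSlices n : ℝ)) * nuc L := by
  refine (tnn_ofSlices_le _).trans_eq ?_
  rw [Finset.sum_eq_single i₀]
  · simp
  · intro i _ hi
    simp [hi, nuc_zero]
  · simp

/-- The normalized negative gradient slices. -/
noncomputable def dualSlice (G : Tensor n₁ n₂ n) (i : SliceIdx n) :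
    EuclideanSpace ℂ (Fin n₂) →ₗ[ℂ] EuclideanSpace ℂ (Fin n₁) :=
  ((-(sv (bdiag G) 0)⁻¹ : ℝ) : ℂ) • slice G i

theorem norm_dualSlice_le {G : Tensor n₁ n₂ n} (hG : G ≠ 0) (i : SliceIdx n)
    (x : EuclideanSpace ℂ (Fin n₂)) : ‖dualSlice G i x‖ ≤ ‖x‖ := by
  have h0 := sv_bdiag_pos hG
  rw [dualSlice, LinearMap.smul_apply, norm_smul, Complex.norm_real, norm_neg,
    Real.norm_of_nonneg (by positivity), inv_mul_le_iff₀ h0]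
  exact norm_slice_le_sv_bdiag G i x

theorem slice_eq_smul_dualSlice {G : Tensor n₁ n₂ n} (hG : G ≠ 0) (i : SliceIdx n) :
    slice G i = ((-sv (bdiag G) 0 : ℝ) : ℂ) • dualSlice G i := by
  have h0 := (sv_bdiag_pos hG).ne'
  rw [dualSlice, smul_smul, ← Complex.ofReal_mul]
  have : -sv (bdiag G) 0 * -(sv (bdiag G) 0)⁻¹ = 1 := by field_simp
  rw [this]
  simp

theorem inner_eq_neg_mul_sum_dualSlice {G : Tensor n₁ n₂ n} (hG : G ≠ 0) (X : Tensor n₁ n₂ n) :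
    inner ℝ G X =
      -(sv (bdiag G) 0 * ((1 / (numSlices n : ℝ)) * ∑ i, hs (dualSlice G i) (slice X i))) := by
  rw [inner_eq_sum_hs]
  simp only [slice_eq_smul_dualSlice hG, hs_smul_left, ← Finset.mul_sum]
  ring

/-- The linear functional `⟨G, ·⟩` is at least `-g` on the ball and a rank-one tensor attains `-g`,
so `X*` does as well; equality in the sum of slicewise duality bounds is equality in each. -/
theorem optimality_structure {G Xs : Tensor n₁ n₂ n} (hG : G ≠ 0) (hXs : Xs ∈ ball n₁ n₂ n 1)
    (hvi : ∀ X ∈ ball n₁ n₂ n 1, 0 ≤ inner ℝ G (X - Xs)) :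
    tnn Xs = 1 ∧ ∀ i, hs (dualSlice G i) (slice Xs i) = nuc (slice Xs i) := by
  obtain ⟨⟨a₀⟩, ⟨b₀⟩, hne⟩ := nonempty_of_ne_zero hG
  obtain ⟨i₀, hi₀⟩ := exists_sv_eq_sv_bdiag G
  have hN := numSlices_pos i₀
  set g := sv (bdiag G) 0 with hg
  have hg0 : 0 < g := sv_bdiag_pos hG
  obtain ⟨b, a, hba⟩ := exists_eq_diagMap (slice G i₀)
  set D := diagMap b a fun j => if j = 0 then (1 : ℝ) else 0 with hD
  have hmin : 0 ∈ Finset.range (min (finrank ℂ (EuclideanSpace ℂ (Fin n₁)))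
      (finrank ℂ (EuclideanSpace ℂ (Fin n₂)))) := by
    have := a₀.pos
    have := b₀.pos
    simp
    omega
  have hDn : nuc D ≤ 1 := by
    refine (nuc_diagMap_le b a fun j => by split_ifs <;> simp).trans ?_
    rw [Finset.sum_ite_eq' _ 0, if_pos hmin]
  have hDG : hs (slice G i₀) D = g := by
    rw [hba, hs_diagMap_diagMap]
    simp only [mul_ite, mul_one, mul_zero]
    rw [Finset.sum_ite_eq' _ 0, if_pos hmin]
    exact hi₀
  -- A top singular pair of a slice attaining `g`, negated. The factor `N` offsets the `1/N` in the
  -- nuclear norm.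
  set Z := singleSlice i₀ (((numSlices n : ℝ) : ℂ) • (-D)) with hZ
  have hZball : Z ∈ ball n₁ n₂ n 1 := by
    refine (tnn_singleSlice_le _ _).trans ?_
    have h1 := nuc_smul_le hN.le (-D)
    have h2 := nuc_neg_le D
    rw [one_div, inv_mul_le_iff₀ hN]
    nlinarith
  have hGZ : inner ℝ G Z = -g := by
    rw [real_inner_comm, hZ, inner_singleSlice, hs_smul_left, hs_neg_left, hs_comm, hDG]
    field_simp
  have h1 := hvi Z hZball
  rw [inner_sub_right, hGZ, inner_eq_neg_mul_sum_dualSlice hG, ← hg] at h1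
  have hle : ∀ i, hs (dualSlice G i) (slice Xs i) ≤ nuc (slice Xs i) := fun i =>
    hs_le_nuc (norm_dualSlice_le hG i) _
  have h2 : 1 ≤ (1 / (numSlices n : ℝ)) * ∑ i, hs (dualSlice G i) (slice Xs i) := by
    by_contra! hc
    nlinarith
  have h3 : (1 / (numSlices n : ℝ)) * ∑ i, hs (dualSlice G i) (slice Xs i) ≤ tnn Xs := by
    rw [tnn_eq_sum_nuc]
    exact mul_le_mul_of_nonneg_left (Finset.sum_le_sum fun i _ => hle i) (by positivity)
  have h4 : tnn Xs ≤ 1 := hXs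
  have h5 : tnn Xs = 1 := by linarith
  refine ⟨h5, fun i => ?_⟩
  have h6 : ∑ i, hs (dualSlice G i) (slice Xs i) = ∑ i, nuc (slice Xs i) := by
    have h7 := tnn_eq_sum_nuc Xs
    have h8 : (1 / (numSlices n : ℝ)) * ∑ i, hs (dualSlice G i) (slice Xs i) =
        (1 / (numSlices n : ℝ)) * ∑ i, nuc (slice Xs i) := by linarith
    exact mul_left_cancel₀ (by positivity) h8
  exact (Finset.sum_eq_sum_iff_of_le fun i _ => hle i).1 h6 i (Finset.mem_univ i)

end Duality

/-! ### Support of a map aligned with a contraction -/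

section Weyl

variable {E : Type*} [NormedAddCommGroup E] [InnerProductSpace ℂ E] [FiniteDimensional ℂ E]
  {F : Type*} [NormedAddCommGroup F] [InnerProductSpace ℂ F] [FiniteDimensional ℂ F]

/-- A map dual to the contraction `W` vanishes where `W` strictly contracts. -/
theorem apply_eq_zero_of_hs_eq_nuc {W T : E →ₗ[ℂ] F} (hW : ∀ x, ‖W x‖ ≤ ‖x‖)
    (h : hs W T = nuc T) {q : ℕ} {b : OrthonormalBasis (Fin q) ℂ E}
    (hb : ∀ j l, j ≠ l → inner ℂ (W (b j)) (W (b l)) = 0) {p : ℕ}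
    (hp : ∀ l : Fin q, p ≤ l → ‖W (b l)‖ < 1) {x : E} (hx : x ∈ (headSpan b p)ᗮ) : T x = 0 := by
  obtain ⟨H, hH, hT, hWH⟩ := exists_factor_of_hs_eq_nuc hW h
  suffices hHx : H x = 0 by rw [hT, LinearMap.comp_apply, hHx, map_zero]
  rw [← inner_self_eq_zero (𝕜 := ℂ), ← hH.1]
  -- `‖H x‖² = ⟨H (H x), x⟩` by symmetry, so it suffices that `H (H x)` lies in the head span. It is
  -- preserved in norm by `W`, hence has no component where `W` strictly contracts.
  refine hx _ (mem_headSpan_of_inner_eq_zero fun l hl => ?_)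
  set w := H (H x) with hw
  have h1 : LinearMap.adjoint W (W w) = w := LinearMap.congr_fun hWH (H x)
  have h2 : ‖W w‖ ^ 2 = ‖w‖ ^ 2 := by
    have h3 : inner ℂ (W w) (W w) = inner ℂ w w := by
      rw [← LinearMap.adjoint_inner_left, h1]
    rw [inner_self_eq_norm_sq_to_K, inner_self_eq_norm_sq_to_K] at h3
    exact_mod_cast h3
  rw [norm_sq_apply_eq_sum b W hb, ← b.sum_sq_norm_inner_right w] at h2
  have hle : ∀ j, ‖inner ℂ (b j) w‖ ^ 2 * ‖W (b j)‖ ^ 2 ≤ ‖inner ℂ (b j) w‖ ^ 2 := by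
    intro j
    refine mul_le_of_le_one_right (sq_nonneg _) (pow_le_one₀ (norm_nonneg _) ?_)
    simpa using hW (b j)
  have h3 := (Finset.sum_eq_sum_iff_of_le fun j _ => hle j).1 h2 l (Finset.mem_univ l)
  have h4 : ‖W (b l)‖ ^ 2 < 1 := pow_lt_one₀ (norm_nonneg _) (hp l hl) two_ne_zero
  by_contra hne
  have h5 : 0 < ‖inner ℂ (b l) w‖ ^ 2 := by positivity
  nlinarith

end Weyl

/-! ### Perturbation of the optimal gradient step and the threshold -/

section Truncation

variable {n₁ n₂ k : ℕ} {n : Fin k → ℕ} {G Xs P : Tensor n₁ n₂ n} {β : ℝ}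

theorem norm_dualSlice_apply (hG : G ≠ 0) (i : SliceIdx n) (x : EuclideanSpace ℂ (Fin n₂)) :
    ‖dualSlice G i x‖ = ‖slice G i x‖ / sv (bdiag G) 0 := by
  have h0 := sv_bdiag_pos hG
  rw [dualSlice, LinearMap.smul_apply, norm_smul, Complex.norm_real, norm_neg,
    Real.norm_of_nonneg (by positivity), div_eq_inv_mul]

theorem slice_apply_eq_zero (hG : G ≠ 0) {i : SliceIdx n}
    (hcert : hs (dualSlice G i) (slice Xs i) = nuc (slice Xs i)) {q : ℕ}
    {b : OrthonormalBasis (Fin q) ℂ (EuclideanSpace ℂ (Fin n₂))}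
    (hb : ∀ j l, j ≠ l → inner ℂ (slice G i (b j)) (slice G i (b l)) = 0) {p : ℕ}
    (hp : ∀ l : Fin q, p ≤ l → ‖slice G i (b l)‖ < sv (bdiag G) 0)
    {x : EuclideanSpace ℂ (Fin n₂)} (hx : x ∈ (headSpan b p)ᗮ) : slice Xs i x = 0 := by
  refine apply_eq_zero_of_hs_eq_nuc (norm_dualSlice_le hG i) hcert (b := b) (p := p) ?_ ?_ hx
  · intro j l hjl
    rw [dualSlice, LinearMap.smul_apply, LinearMap.smul_apply, inner_smul_left, inner_smul_right,
      hb j l hjl]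
    ring
  · intro l hl
    rw [norm_dualSlice_apply hG, div_lt_one (sv_bdiag_pos hG)]
    exact hp l hl

theorem slice_eq_add_perturbation (P Xs G : Tensor n₁ n₂ n) (β : ℝ) (i : SliceIdx n) :
    slice P i = slice Xs i + ((-(1 / β) : ℝ) : ℂ) • slice G i +
      slice (P - (Xs - (1 / β) • G)) i := by
  rw [← slice_smul, ← slice_add, ← slice_add]
  congr 1
  module

/-- Min-max with the first `r - μ` right singular vectors of `G_i` together with the first `μ` of
`D`. Orthogonally to the former, `X*_i` vanishes by alignment, so `X*` does not enter the bound at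
all. -/
theorem sv_le_add_of_certificate (hβ : 0 < β) (hG : G ≠ 0) {i : SliceIdx n}
    (hcert : hs (dualSlice G i) (slice Xs i) = nuc (slice Xs i)) {r μ : ℕ} (hμ : μ ≤ r)
    (hgap : sv (fslice G i) (r - μ) < sv (bdiag G) 0) :
    sv (fslice P i) r ≤ sv (fslice G i) (r - μ) / β +
      √(hs (slice (P - (Xs - (1 / β) • G)) i) (slice (P - (Xs - (1 / β) • G)) i)) /
        √((μ : ℝ) + 1) := by
  set D := slice (P - (Xs - (1 / β) • G)) i with hD
  obtain ⟨b, hb, hn⟩ := exists_rightSingularBasis (p := n₂) (by simp) (slice G i)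
  obtain ⟨d, hd, hdn⟩ := exists_rightSingularBasis (p := n₂) (by simp) D
  have hσ0 : 0 ≤ sv (fslice G i) (r - μ) := LinearMap.singularValues_nonneg _ _
  refine singularValues_le_of_subspace _ (S := headSpan b (r - μ) ⊔ headSpan d μ)
    (by positivity) ?_ fun x hx => ?_
  · have h1 := Submodule.finrank_add_le_finrank_add_finrank (headSpan b (r - μ)) (headSpan d μ)
    rw [finrank_headSpan, finrank_headSpan] at h1
    omega
  rw [← Submodule.inf_orthogonal] at hx
  have hxs : slice Xs i x = 0 := by
    refine slice_apply_eq_zero hG hcert hb (fun l hl => ?_) hx.1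
    rw [hn]
    exact (LinearMap.singularValues_antitone _ hl).trans_lt hgap
  have hg : ‖slice G i x‖ ≤ sv (fslice G i) (r - μ) * ‖x‖ :=
    norm_apply_le_of_mem_headSpan_orthogonal hb hσ0
      (fun l hl => by rw [hn]; exact LinearMap.singularValues_antitone _ hl) hx.1
  have hdx : ‖D x‖ ≤ D.singularValues μ * ‖x‖ :=
    norm_apply_le_of_mem_headSpan_orthogonal hd (LinearMap.singularValues_nonneg _ _)
      (fun l hl => by rw [hdn]; exact LinearMap.singularValues_antitone _ hl) hx.2
  have hdσ := singularValues_le_sqrt_hs_div D μ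
  have h1 : slice P i x = ((-(1 / β) : ℝ) : ℂ) • slice G i x + D x := by
    rw [slice_eq_add_perturbation P Xs G β i]
    simp [hxs, hD]
  have h2 : ‖slice P i x‖ ≤ 1 / β * ‖slice G i x‖ + ‖D x‖ := by
    rw [h1]
    refine (norm_add_le _ _).trans ?_
    rw [norm_smul, Complex.norm_real, norm_neg, Real.norm_of_nonneg (by positivity)]
  calc ‖slice P i x‖ ≤ 1 / β * (sv (fslice G i) (r - μ) * ‖x‖) +
        √(hs D D) / √((μ : ℝ) + 1) * ‖x‖ := by
        refine h2.trans (add_le_add (by gcongr) (hdx.trans (by gcongr)))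
    _ = _ := by ring

/-- Tested against the negated partial isometry `W` on the `m` singular pairs of `G_i` with value
`g`. It agrees with the dual certificate on the support of `X*_i`, has `nuc W ≤ m` and `hs W W = m`,
so `hs_le_sum_threshold` applies and the perturbation costs `√m ‖D‖_F`. -/
theorem le_sum_threshold (hG : G ≠ 0) {i : SliceIdx n}
    (hcert : hs (dualSlice G i) (slice Xs i) = nuc (slice Xs i)) {m : ℕ}
    (hm : ∀ j < m, sv (fslice G i) j = sv (bdiag G) 0)
    (hm' : sv (fslice G i) m < sv (bdiag G) 0) {s : ℝ} (hs0 : 0 ≤ s) :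
    nuc (slice Xs i) + sv (bdiag G) 0 / β * m -
      √m * √(hs (slice (P - (Xs - (1 / β) • G)) i) (slice (P - (Xs - (1 / β) • G)) i)) ≤
      ∑ j ∈ Finset.range n₂, max 0 (sv (fslice P i) j - s) + s * m := by
  set D := slice (P - (Xs - (1 / β) • G)) i with hD
  set g := sv (bdiag G) 0 with hg
  have hg0 : 0 < g := sv_bdiag_pos hG
  have hE : finrank ℂ (EuclideanSpace ℂ (Fin n₂)) = n₂ := by simp
  have hF : finrank ℂ (EuclideanSpace ℂ (Fin n₁)) = n₁ := by simp
  obtain ⟨b, a, hba⟩ := exists_svd hE hF (slice G i)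
  replace hba := eq_diagMap b a (T := slice G i) (c := (slice G i).singularValues) hba
  have hmin : m ≤ min n₁ n₂ := by
    by_contra! hlt
    have h1 := hm _ hlt
    rw [sv_fslice] at h1
    rcases le_total n₁ n₂ with h | h
    · rw [min_eq_left h, singularValues_eq_zero_of_finrank_le _ hF.le] at h1
      exact hg0.ne h1
    · rw [min_eq_right h, LinearMap.singularValues_of_finrank_le _ hE.le] at h1
      exact hg0.ne h1
  set χ : ℕ → ℝ := fun j => if j < m then 1 else 0 with hχ
  have hsum : ∀ φ : ℕ → ℝ, ∑ j ∈ Finset.range (min n₁ n₂), (if j < m then φ j else 0) =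
      ∑ j ∈ Finset.range m, φ j := by
    intro φ
    rw [← Finset.sum_filter]
    congr 1
    ext j
    simp only [Finset.mem_filter, Finset.mem_range]
    omega
  set W := -diagMap b a χ with hW
  have hWc : ∀ x, ‖W x‖ ≤ ‖x‖ := by
    intro x
    rw [hW, LinearMap.neg_apply, norm_neg]
    simpa using norm_diagMap_le b a zero_le_one
      (fun j _ => by simp only [hχ]; split_ifs <;> simp) x
  have hWn : nuc W ≤ m := by
    refine (nuc_neg_le _).trans ((nuc_diagMap_le b a fun j => ?_).trans ?_)
    · simp only [hχ]; split_ifs <;> simp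
    · simp only [hχ]
      rw [hsum fun _ => 1]
      simp
  have hWW : hs W W = m := by
    rw [hW, hs_neg_left, hs_neg_right, neg_neg, hs_diagMap_diagMap]
    have : ∀ j, χ j * χ j = if j < m then (1 : ℝ) else 0 := by
      intro j; simp only [hχ]; split_ifs <;> simp
    simp only [this]
    rw [hsum fun _ => 1]
    simp
  have hWG : hs W (slice G i) = -(g * m) := by
    rw [hW, hs_neg_left, hba, hs_diagMap_diagMap]
    have : ∀ j, χ j * (slice G i).singularValues j = if j < m then g else 0 := by
      intro j
      simp only [hχ]
      split_ifs with hj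
      · rw [one_mul]; exact hm j hj
      · simp
    simp only [this]
    rw [hsum fun _ => g]
    simp [mul_comm]
  have hnorm : ∀ l : Fin n₂, ‖slice G i (b l)‖ ≤ sv (fslice G i) l := by
    intro l
    have h1 := norm_diagMap_basis_le b a (slice G i).singularValues l
    rw [← hba, abs_of_nonneg (LinearMap.singularValues_nonneg _ _)] at h1
    exact h1
  have horth : ∀ j l, j ≠ l → inner ℂ (slice G i (b j)) (slice G i (b l)) = 0 := by
    intro j l hjl
    have h1 := inner_diagMap_basis b a (slice G i).singularValues j l hjl
    rwa [← hba] at h1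
  have hWX : hs W (slice Xs i) = nuc (slice Xs i) := by
    rw [← hcert, hs_eq_sum b, hs_eq_sum b]
    refine Finset.sum_congr rfl fun l _ => ?_
    rcases lt_or_ge (l : ℕ) m with hl | hl
    · congr 2
      have h1 : slice G i (b l) = diagMap b a (slice G i).singularValues (b l) := by rw [← hba]
      have h2 : (slice G i).singularValues l = g := hm l hl
      rw [hW, LinearMap.neg_apply, dualSlice, LinearMap.smul_apply, h1, diagMap_basis,
        diagMap_basis, ← hg]
      split_ifs
      · rw [h2, smul_smul, ← Complex.ofReal_mul]
        have h3 : -g⁻¹ * g = -1 := by field_simp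
        simp [hχ, hl, h3]
      · simp
    · have h1 : slice Xs i (b l) = 0 := by
        refine slice_apply_eq_zero hG hcert horth (p := m) (fun l' hl' => ?_) ?_
        · exact (hnorm l').trans_lt ((LinearMap.singularValues_antitone _ hl').trans_lt hm')
        · rw [Submodule.mem_orthogonal]
          intro u hu
          rw [← inner_conj_symm, inner_eq_zero_of_mem_headSpan hu hl, map_zero]
      rw [h1]
      simp
  have hWD : -(√m * √(hs D D)) ≤ hs W D := by
    have h1 := hs_le_sqrt_mul_sqrt W (-D)
    rw [hs_neg_right W D, hs_neg_left D, hs_neg_right D D, neg_neg, hWW] at h1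
    linarith
  have key := hs_le_sum_threshold hWc (slice P i) hs0
  have hPs : hs W (slice P i) = nuc (slice Xs i) + g / β * m + hs W D := by
    rw [slice_eq_add_perturbation P Xs G β i, hs_add_right, hs_add_right, hs_smul_right, hWX, hWG]
    ring
  rw [hPs, hE] at key
  have h5 : s * nuc W ≤ s * m := by gcongr
  have h6 : ∑ j ∈ Finset.range n₂, max 0 ((slice P i).singularValues j - s) =
    ∑ j ∈ Finset.range n₂, max 0 (sv (fslice P i) j - s) := rfl
  linarith

theorem sum_hs_self (X : Tensor n₁ n₂ n) [Nonempty (SliceIdx n)] :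
    ∑ i, hs (slice X i) (slice X i) = numSlices n * ‖X‖ ^ 2 := by
  have hN := numSlices_ne_zero (n := n) (Classical.arbitrary _)
  rw [← real_inner_self_eq_norm_sq, inner_eq_sum_hs]
  field_simp

theorem sqrt_hs_self_le (X : Tensor n₁ n₂ n) (i : SliceIdx n) :
    √(hs (slice X i) (slice X i)) ≤ √(numSlices n : ℝ) * ‖X‖ := by
  have : Nonempty (SliceIdx n) := ⟨i⟩
  have h1 := Finset.single_le_sum (f := fun i => hs (slice X i) (slice X i))
    (fun i _ => hs_self_nonneg _) (Finset.mem_univ i)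
  rw [sum_hs_self] at h1
  refine (Real.sqrt_le_sqrt h1).trans_eq ?_
  rw [Real.sqrt_mul (by positivity), Real.sqrt_sq (norm_nonneg _)]

/-- The multiplicity of the singular value `σ₁(Ḡ)` in the slice `i`. -/
noncomputable def globalMult (G : Tensor n₁ n₂ n) (i : SliceIdx n) : ℕ :=
  sInf {j | sv (fslice G i) j < sv (bdiag G) 0}

theorem sv_globalMult_lt (hG : G ≠ 0) (i : SliceIdx n) :
    sv (fslice G i) (globalMult G i) < sv (bdiag G) 0 := by
  have hne : {j | sv (fslice G i) j < sv (bdiag G) 0}.Nonempty := by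
    refine ⟨n₂, ?_⟩
    have : sv (fslice G i) n₂ = 0 := LinearMap.singularValues_of_finrank_le _ (by simp)
    show sv (fslice G i) n₂ < _
    rw [this]
    exact sv_bdiag_pos hG
  exact Nat.sInf_mem hne

theorem sv_eq_of_lt_globalMult {i : SliceIdx n} {j : ℕ} (hj : j < globalMult G i) :
    sv (fslice G i) j = sv (bdiag G) 0 := by
  have h1 := Nat.notMem_of_lt_sInf hj
  exact le_antisymm (sv_fslice_le_sv_bdiag G i j) (not_lt.1 h1)

theorem globalMult_le_min (hG : G ≠ 0) (i : SliceIdx n) : globalMult G i ≤ min n₁ n₂ := by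
  by_contra! hlt
  have h1 := sv_eq_of_lt_globalMult hlt
  have h2 : sv (fslice G i) (min n₁ n₂) = 0 := by
    rw [sv_fslice]
    rcases le_total n₁ n₂ with h | h
    · rw [min_eq_left h]; exact singularValues_eq_zero_of_finrank_le _ (by simp)
    · rw [min_eq_right h]; exact LinearMap.singularValues_of_finrank_le _ (by simp)
  exact (sv_bdiag_pos hG).ne (h2.symm.trans h1)

theorem sv_zero_matrix (j : ℕ) : sv (0 : Matrix (Fin n₁) (Fin n₂) ℂ) j = 0 := by
  have h : Matrix.toEuclideanLin (0 : Matrix (Fin n₁) (Fin n₂) ℂ) = 0 := map_zero _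
  rw [sv, h, LinearMap.singularValues_zero]
  rfl

theorem topMult_set_finite {p q : Type*} [Fintype p] [Fintype q] [DecidableEq q]
    (M : Matrix p q ℂ) :
    {j : ℕ | j < min (Fintype.card p) (Fintype.card q) ∧ sv M j = sv M 0}.Finite :=
  (Set.finite_Iio (min (Fintype.card p) (Fintype.card q))).subset fun _ h => h.1

theorem topMult_le_maxTopMult {i : SliceIdx n} (hi : fslice G i ≠ 0) :
    topMult (fslice G i) ≤ maxTopMult G :=
  le_ciSup (f := fun i : {i : SliceIdx n // fslice G i ≠ 0} => topMult (fslice G i.1))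
    (Set.finite_range _).bddAbove ⟨i, hi⟩

theorem globalMult_le_maxTopMult (hG : G ≠ 0) (i : SliceIdx n) :
    globalMult G i ≤ maxTopMult G := by
  rcases Nat.eq_zero_or_pos (globalMult G i) with h | h
  · omega
  have h0 := sv_eq_of_lt_globalMult h
  have hi : fslice G i ≠ 0 := by
    intro hz
    rw [hz, sv_zero_matrix] at h0
    exact (sv_bdiag_pos hG).ne h0
  refine le_trans ?_ (topMult_le_maxTopMult hi)
  rw [topMult]
  refine le_trans ?_ (Set.ncard_le_ncard (s := (Finset.range (globalMult G i) : Set ℕ)) ?_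
    (topMult_set_finite _))
  · rw [Set.ncard_coe_finset, Finset.card_range]
  · intro j hj
    have hj' : j < globalMult G i := by simpa using hj
    refine ⟨?_, ?_⟩
    · simpa using hj'.trans_le (globalMult_le_min hG i)
    · rw [sv_eq_of_lt_globalMult hj', h0]

theorem sum_globalMult_le (hG : G ≠ 0) : ∑ i, globalMult G i ≤ maxTopMult G * nnzb G := by
  classical
  have h1 : ∀ i, globalMult G i ≤ if fslice G i ≠ 0 then maxTopMult G else 0 := by
    intro i
    split_ifs with hi
    · exact globalMult_le_maxTopMult hG i
    · push Not at hi
      by_contra! hc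
      have h0 := sv_eq_of_lt_globalMult hc
      rw [hi, sv_zero_matrix] at h0
      exact (sv_bdiag_pos hG).ne h0
  refine (Finset.sum_le_sum fun i _ => h1 i).trans ?_
  rw [← Finset.sum_filter, Finset.sum_const, smul_eq_mul, mul_comm, nnzb,
    Set.ncard_eq_toFinset_card']
  simp

/-- After index `globalMult G i` every block is strictly below `g`, and `sv_bdiag_le` adds up these
indices. With `sum_globalMult_le` this encloses the total multiplicity between the computable
quantities of the radius. -/
theorem topMult_bdiag_le (hG : G ≠ 0) : topMult (bdiag G) ≤ ∑ i, globalMult G i := by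
  obtain ⟨-, -, hne⟩ := nonempty_of_ne_zero hG
  obtain ⟨i₀, -, hi₀⟩ := Finset.exists_max_image Finset.univ
    (fun i => sv (fslice G i) (globalMult G i)) Finset.univ_nonempty
  have h1 := sv_bdiag_le G (globalMult G) (c := sv (fslice G i₀) (globalMult G i₀))
    (LinearMap.singularValues_nonneg _ _) fun i => hi₀ i (Finset.mem_univ _)
  have h2 := h1.trans_lt (sv_globalMult_lt hG i₀)
  rw [topMult]
  refine (Set.ncard_le_ncard (t := (Finset.range (∑ i, globalMult G i) : Set ℕ)) ?_
    (Finset.finite_toSet _)).trans ?_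
  · intro j hj
    rw [Finset.coe_range]
    by_contra hc
    have h3 : sv (bdiag G) j ≤ sv (bdiag G) (∑ i, globalMult G i) :=
      LinearMap.singularValues_antitone _ (not_lt.1 hc)
    rw [hj.2] at h3
    exact absurd h3 (not_le.2 h2)
  · rw [Set.ncard_coe_finset, Finset.card_range]

theorem topMult_bdiag_pos (hG : G ≠ 0) : 0 < topMult (bdiag G) := by
  obtain ⟨⟨a⟩, ⟨b⟩, ⟨i⟩⟩ := nonempty_of_ne_zero hG
  rw [topMult, Set.ncard_pos (topMult_set_finite _)]
  exact ⟨0, lt_min (Fintype.card_pos_iff.2 ⟨(a, i)⟩) (Fintype.card_pos_iff.2 ⟨(b, i)⟩), rfl⟩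

theorem sv_lt_of_maxTopMult_le (hG : G ≠ 0) {r : ℕ} (hr : maxTopMult G ≤ r)
    (hr' : r < min n₁ n₂) (i : SliceIdx n) : sv (fslice G i) r < sv (bdiag G) 0 := by
  by_cases hi : fslice G i = 0
  · rw [hi, sv_zero_matrix]
    exact sv_bdiag_pos hG
  refine lt_of_le_of_ne (sv_fslice_le_sv_bdiag G i r) fun heq => ?_
  have h1 : ∀ j ≤ r, sv (fslice G i) j = sv (bdiag G) 0 := fun j hj =>
    le_antisymm (sv_fslice_le_sv_bdiag G i j)
      (heq.ge.trans (LinearMap.singularValues_antitone _ hj))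
  have h2 : r + 1 ≤ topMult (fslice G i) := by
    rw [topMult]
    refine le_trans ?_ (Set.ncard_le_ncard (s := (Finset.range (r + 1) : Set ℕ)) ?_
      (topMult_set_finite _))
    · rw [Set.ncard_coe_finset, Finset.card_range]
    · intro j hj
      have hj' : j < r + 1 := by simpa using hj
      refine ⟨by simp; omega, ?_⟩
      rw [h1 j (by omega), h1 0 (by omega)]
  have h3 := topMult_le_maxTopMult hi
  omega

theorem maxTopMult_pos (hG : G ≠ 0) : 0 < maxTopMult G := by
  obtain ⟨-, -, hne⟩ := nonempty_of_ne_zero hG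
  obtain ⟨i, hi⟩ := exists_sv_eq_sv_bdiag G
  refine lt_of_lt_of_le ?_ (globalMult_le_maxTopMult hG i)
  by_contra! hc
  have h1 := sv_globalMult_lt hG i
  rw [Nat.le_zero.1 hc, hi] at h1
  exact lt_irrefl _ h1

theorem sv_lt_of_gap_pos {r : ℕ} (h : 0 < gap G r) (i : SliceIdx n) :
    sv (fslice G i) r < sv (bdiag G) 0 := by
  have h1 := le_ciSup (f := fun i => sv (fslice G i) r) (Set.finite_range _).bddAbove i
  rw [gap] at h
  linarith

/-- The threshold at which the truncated soft thresholding captures the whole mass. -/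
theorem exists_threshold (hβ : 0 < β) (hG : G ≠ 0) (htnn : tnn Xs = 1)
    (hcert : ∀ i, hs (dualSlice G i) (slice Xs i) = nuc (slice Xs i)) {r μ : ℕ}
    (hr : r < min n₁ n₂) (hμ : μ ≤ r)
    (hgap : ∀ i, sv (fslice G i) (r - μ) < sv (bdiag G) 0)
    (hD : β * √(numSlices n : ℝ) * ‖P - (Xs - (1 / β) • G)‖ *
      (1 / √((μ : ℝ) + 1) + √((maxTopMult G : ℝ) * (nnzb G : ℝ)) / (topMult (bdiag G) : ℝ)) ≤
      gap G (r - μ)) :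
    ∃ s : ℝ, 0 ≤ s ∧ (∀ i, sv (fslice P i) r ≤ s) ∧ (numSlices n : ℝ) ≤
      ∑ i : SliceIdx n, ∑ j ∈ Finset.range r, max 0 (sv (fslice P i) j - s) := by
  obtain ⟨-, -, hne⟩ := nonempty_of_ne_zero hG
  set D := P - (Xs - (1 / β) • G) with hDdef
  set g := sv (bdiag G) 0 with hg
  obtain ⟨i₀, -, hi₀⟩ := Finset.exists_max_image Finset.univ (fun i => sv (fslice P i) r)
    Finset.univ_nonempty
  -- The smallest threshold that removes every singular value discarded by the truncation.
  set s := sv (fslice P i₀) r with hs'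
  have hs0 : 0 ≤ s := LinearMap.singularValues_nonneg _ _
  refine ⟨s, hs0, fun i => hi₀ i (Finset.mem_univ i), ?_⟩
  set δ := √(numSlices n : ℝ) * ‖D‖ with hδ
  have hδ0 : 0 ≤ δ := by positivity
  set Q := √((maxTopMult G : ℝ) * (nnzb G : ℝ)) with hQ
  set M : ℝ := (topMult (bdiag G) : ℝ) with hM
  have hM0 : 0 < M := Nat.cast_pos.2 (topMult_bdiag_pos hG)
  have hs1 : s ≤ (g - gap G (r - μ)) / β + δ / √((μ : ℝ) + 1) := by
    refine (sv_le_add_of_certificate hβ hG (hcert i₀) hμ (hgap i₀)).trans ?_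
    gcongr
    · rw [gap, sub_sub_cancel]
      exact le_ciSup (f := fun i => sv (fslice G i) (r - μ)) (Set.finite_range _).bddAbove i₀
    · exact sqrt_hs_self_le D i₀
  have hs2 : δ * (Q / M) ≤ g / β - s := by
    have h1 : δ * (1 / √((μ : ℝ) + 1) + Q / M) ≤ gap G (r - μ) / β := by
      rw [le_div_iff₀ hβ]
      linarith
    rw [sub_div] at hs1
    have h2 : δ * (1 / √((μ : ℝ) + 1)) = δ / √((μ : ℝ) + 1) := by ring
    linarith
  set m' : ℝ := ∑ i, (globalMult G i : ℝ) with hm'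
  have hMm' : M ≤ m' := by
    rw [hm', hM]; exact_mod_cast topMult_bdiag_le hG
  have hm'Q : √m' ≤ Q := by
    apply Real.sqrt_le_sqrt
    rw [hm']; exact_mod_cast sum_globalMult_le hG
  -- The gain `(g/β - s) m'` must beat the Cauchy-Schwarz loss `√m' δ`. The lower bound `M ≤ m'`
  -- serves the gain and the upper bound `√m' ≤ Q` the loss; hence the ratio `Q / M` in the radius.
  have hs3 : δ * Q ≤ (g / β - s) * m' := by
    have hQ0 : 0 ≤ Q := Real.sqrt_nonneg _
    have h1 : 0 ≤ g / β - s := le_trans (by positivity) hs2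
    calc δ * Q = δ * (Q / M) * M := by field_simp
      _ ≤ (g / β - s) * M := by gcongr
      _ ≤ _ := by gcongr
  have hslice : ∀ i, nuc (slice Xs i) + g / β * globalMult G i -
      √(globalMult G i) * √(hs (slice D i) (slice D i)) - s * globalMult G i ≤
      ∑ j ∈ Finset.range r, max 0 (sv (fslice P i) j - s) := by
    intro i
    have h1 := le_sum_threshold (P := P) (β := β) hG (hcert i) (fun j hj => sv_eq_of_lt_globalMult hj)
      (sv_globalMult_lt hG i) hs0
    have h2 : ∑ j ∈ Finset.range n₂, max 0 (sv (fslice P i) j - s) =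
        ∑ j ∈ Finset.range r, max 0 (sv (fslice P i) j - s) := by
      symm
      refine Finset.sum_subset (Finset.range_subset_range.2 (by omega)) fun j _ hj => ?_
      have h3 : r ≤ j := not_lt.1 fun h => hj (Finset.mem_range.2 h)
      have h4 : sv (fslice P i) j ≤ s :=
        (LinearMap.singularValues_antitone _ h3).trans (hi₀ i (Finset.mem_univ i))
      exact max_eq_left (by linarith)
    rw [h2] at h1
    linarith
  refine le_trans ?_ (Finset.sum_le_sum fun i _ => hslice i)
  rw [Finset.sum_sub_distrib, Finset.sum_sub_distrib, Finset.sum_add_distrib, ← Finset.mul_sum,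
    ← Finset.mul_sum, ← hm']
  have hnuc : ∑ i, nuc (slice Xs i) = numSlices n := by
    have hN := numSlices_ne_zero i₀
    have := tnn_eq_sum_nuc Xs
    rw [htnn] at this
    field_simp at this
    linarith
  have hcs : ∑ i, √(globalMult G i : ℝ) * √(hs (slice D i) (slice D i)) ≤ Q * δ := by
    have h1 := Real.sum_mul_le_sqrt_mul_sqrt Finset.univ (fun i => √(globalMult G i : ℝ))
      (fun i => √(hs (slice D i) (slice D i)))
    simp only [Real.sq_sqrt (hs_self_nonneg _), Real.sq_sqrt (Nat.cast_nonneg _)] at h1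
    rw [sum_hs_self, Real.sqrt_mul (by positivity), Real.sqrt_sq (norm_nonneg _)] at h1
    refine h1.trans ?_
    gcongr
  rw [hnuc]
  linarith

end Truncation

/-! ### Equality of truncated and exact projection within the radius -/

section Main

variable {n₁ n₂ k : ℕ} {n : Fin k → ℕ}

/-- The mass above `s₀` is at least `N`, and the mass decreases in the threshold. So every
admissible threshold is at least `s₀`, any output satisfies the variational inequality of the
projection, and uniqueness of the latter removes all dependence on choices. -/
theorem isTruncProj_iff [Nonempty (SliceIdx n)] {P Y₀ : Tensor n₁ n₂ n}
    (hproj : IsProj (ball n₁ n₂ n 1) P Y₀) {r : ℕ} (hr : r < min n₁ n₂) {s₀ : ℝ} (hs₀ : 0 ≤ s₀)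
    (hsr : ∀ i, sv (fslice P i) r ≤ s₀)
    (hsum : (numSlices n : ℝ) ≤
      ∑ i : SliceIdx n, ∑ j ∈ Finset.range r, max 0 (sv (fslice P i) j - s₀))
    (Y : Tensor n₁ n₂ n) : IsTruncProj r 1 P Y ↔ Y = Y₀ := by
  have hN := numSlices_pos (n := n) (Classical.arbitrary _)
  set φ : ℝ → ℝ := fun s =>
    ∑ i : SliceIdx n, ∑ j ∈ Finset.range r, max 0 (sv (fslice P i) j - s) with hφ
  have hφN : ∀ s, (1 / (numSlices n : ℝ)) * φ s = 1 ↔ φ s = numSlices n := by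
    intro s
    rw [one_div, inv_mul_eq_iff_eq_mul₀ hN.ne', mul_one]
  have hfwd : ∀ Y, IsTruncProj r 1 P Y → Y = Y₀ := by
    rintro Y ⟨U, V, s, hUV, hs0, hs1, hY⟩
    -- If `s < s₀`, monotonicity forces equal mass at both, hence equality term by term. A positive
    -- term would strictly shrink, so all vanish, against mass `N > 0`.
    have hle : s₀ ≤ s := by
      by_contra! hlt
      have h1 : φ s = numSlices n := (hφN s).1 hs1
      have hterm : ∀ i j, max 0 (sv (fslice P i) j - s₀) ≤ max 0 (sv (fslice P i) j - s) :=
        fun i j => max_le_max le_rfl (by linarith)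
      have hinner : ∀ i, ∑ j ∈ Finset.range r, max 0 (sv (fslice P i) j - s₀) ≤
          ∑ j ∈ Finset.range r, max 0 (sv (fslice P i) j - s) :=
        fun i => Finset.sum_le_sum fun j _ => hterm i j
      have h2 : φ s₀ = φ s :=
        le_antisymm (Finset.sum_le_sum fun i _ => hinner i) (h1.le.trans hsum)
      have h3 := (Finset.sum_eq_sum_iff_of_le fun i _ => hinner i).1 h2
      have h4 : φ s₀ = 0 := by
        refine Finset.sum_eq_zero fun i hi => Finset.sum_eq_zero fun j hj => ?_
        have h5 := (Finset.sum_eq_sum_iff_of_le fun j _ => hterm i j).1 (h3 i hi) j hj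
        by_contra hc
        have h6 : 0 < sv (fslice P i) j - s₀ := by
          by_contra! h7
          exact hc (max_eq_left h7)
        rw [max_eq_right h6.le, max_eq_right (by linarith)] at h5
        linarith
      have h5 : (numSlices n : ℝ) ≤ φ s₀ := hsum
      linarith
    obtain ⟨h1, h2⟩ := inner_le_zero_of_truncation hUV hr.le hs0 hs1 hY
      fun i => (hsr i).trans hle
    exact hproj.eq_of_inner_le_zero (convex_ball 1) h1 h2
  refine ⟨hfwd Y, ?_⟩
  rintro rfl
  have hcont : Continuous φ := by
    refine continuous_finsetSum _ fun i _ => continuous_finsetSum _ fun j _ => ?_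
    fun_prop
  set B := s₀ + sv (bdiag P) 0
  have hB0 : 0 ≤ sv (bdiag P) 0 := LinearMap.singularValues_nonneg _ _
  have hB : φ B = 0 := by
    refine Finset.sum_eq_zero fun i _ => Finset.sum_eq_zero fun j _ => max_eq_left ?_
    have := sv_fslice_le_sv_bdiag P i j
    linarith
  -- The mass falls continuously from at least `N` at `s₀` to `0`.
  obtain ⟨s, hs, hsN⟩ := intermediate_value_Icc' (f := φ) (a := s₀) (b := B) (by linarith)
    hcont.continuousOn ⟨by rw [hB]; exact hN.le, hsum⟩
  obtain ⟨Y', hY'⟩ := exists_isTruncProj (hs₀.trans hs.1) ((hφN s).2 hsN)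
  rwa [← hfwd Y' hY']

theorem isTruncProj_iff_of_radius {f : Tensor n₁ n₂ n → ℝ} {β : ℝ} (hβ : 0 < β)
    (hdiff : ∀ X ∈ ball n₁ n₂ n 1, DifferentiableAt ℝ f X)
    (hsmooth : ∀ X ∈ ball n₁ n₂ n 1, ∀ Y ∈ ball n₁ n₂ n 1,
      ‖gradient f X - gradient f Y‖ ≤ β * ‖X - Y‖)
    {Xs : Tensor n₁ n₂ n} (hXs : Xs ∈ ball n₁ n₂ n 1)
    (hopt : ∀ X ∈ ball n₁ n₂ n 1, f Xs ≤ f X) (hgrad : gradient f Xs ≠ 0) {r : ℕ}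
    (hmr : maxTopMult (gradient f Xs) ≤ r) (hr : r < min n₁ n₂) {X X' : Tensor n₁ n₂ n}
    (hX : X ∈ ball n₁ n₂ n 1) (hrad : ‖X - Xs‖ ≤ radius β (gradient f Xs) r)
    (hproj : IsProj (ball n₁ n₂ n 1) (X - (1 / β) • gradient f X) X') (Y : Tensor n₁ n₂ n) :
    IsTruncProj r 1 (X - (1 / β) • gradient f X) Y ↔ Y = X' := by
  obtain ⟨-, -, hne⟩ := nonempty_of_ne_zero hgrad
  have hN := numSlices_pos (n := n) (Classical.arbitrary _)
  obtain ⟨htnn, hcert⟩ := optimality_structure hgrad hXs fun Z hZ =>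
    inner_gradient_nonneg_of_isMin (convex_ball 1) hXs (hdiff Xs hXs) hopt hZ
  set G := gradient f Xs with hGdef
  set R := ‖X - Xs‖
  have hR0 : 0 ≤ R := norm_nonneg _
  -- The factor 2 in the radius: one `R` from the points and one from the gradients, by smoothness.
  have hD : ‖X - (1 / β) • gradient f X - (Xs - (1 / β) • G)‖ ≤ 2 * R := by
    have h1 : X - (1 / β) • gradient f X - (Xs - (1 / β) • G) =
        (X - Xs) - (1 / β) • (gradient f X - G) := by
      rw [smul_sub]; abel
    rw [h1]
    refine (norm_sub_le _ _).trans ?_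
    rw [norm_smul, Real.norm_of_nonneg (by positivity)]
    have h2 := hsmooth X hX Xs hXs
    have h3 : 1 / β * ‖gradient f X - G‖ ≤ R := by
      rw [one_div, inv_mul_le_iff₀ hβ]
      exact h2
    linarith
  set Q := √((maxTopMult G : ℝ) * (nnzb G : ℝ)) with hQ
  set M : ℝ := (topMult (bdiag G) : ℝ) with hM
  have hQM : 0 ≤ Q / M := by positivity
  have hm := maxTopMult_pos hgrad
  have hgapr : 0 < gap G r := by
    obtain ⟨i, hi⟩ := exists_eq_ciSup_of_finite (f := fun i => sv (fslice G i) r)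
    rw [gap, ← hi, sub_pos]
    exact sv_lt_of_maxTopMult_le hgrad hmr hr i
  suffices h : ∃ μ ≤ r, (∀ i, sv (fslice G i) (r - μ) < sv (bdiag G) 0) ∧
      β * √(numSlices n : ℝ) * (2 * R) * (1 / √((μ : ℝ) + 1) + Q / M) ≤ gap G (r - μ) by
    obtain ⟨μ, hμ, hlt, hle⟩ := h
    obtain ⟨s, hs0, hsr, hsum⟩ := exists_threshold (P := X - (1 / β) • gradient f X) hβ hgrad htnn
      hcert hr hμ hlt (le_trans (by gcongr) hle)
    exact isTruncProj_iff hproj hr hs0 hsr hsum Y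
  have hscale : ∀ {d c : ℝ}, 0 < c → R ≤ 1 / (2 * β * √(numSlices n : ℝ)) * (d / c) →
      β * √(numSlices n : ℝ) * (2 * R) * c ≤ d := by
    intro d c hc h
    have h1 : 0 < √(numSlices n : ℝ) := Real.sqrt_pos.2 hN
    calc β * √(numSlices n : ℝ) * (2 * R) * c ≤ β * √(numSlices n : ℝ) *
          (2 * (1 / (2 * β * √(numSlices n : ℝ)) * (d / c))) * c := by gcongr
      _ = d := by field_simp
  have hfirst : β * √(numSlices n : ℝ) * (2 * R) * (1 + Q / M) ≤ gap G r →
      ∃ μ ≤ r, (∀ i, sv (fslice G i) (r - μ) < sv (bdiag G) 0) ∧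
      β * √(numSlices n : ℝ) * (2 * R) * (1 / √((μ : ℝ) + 1) + Q / M) ≤ gap G (r - μ) := by
    intro h
    refine ⟨0, Nat.zero_le _, fun i => ?_, ?_⟩
    · exact sv_lt_of_maxTopMult_le hgrad hmr hr i
    · simpa using h
  rw [radius] at hrad
  have hpos : 0 < 1 / (2 * β * √(numSlices n : ℝ)) := by
    have h1 : 0 < √(numSlices n : ℝ) := Real.sqrt_pos.2 hN
    positivity
  rcases le_total (gap G (r - maxTopMult G + 1) / (1 / √(maxTopMult G : ℝ) + Q / M))
    (gap G r / (1 + Q / M)) with h | h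
  · rw [max_eq_left h] at hrad
    exact hfirst (hscale (by positivity) hrad)
  · rw [max_eq_right h] at hrad
    have hc : 0 < 1 / √(maxTopMult G : ℝ) + Q / M := by
      have : 0 < √(maxTopMult G : ℝ) := Real.sqrt_pos.2 (by exact_mod_cast hm)
      positivity
    -- The second quotient can be the larger one with a nonpositive gap only if the radius is
    -- nonpositive. Then `R = 0` and the choice `μ = 0` works, since `gap G r > 0`.
    rcases le_or_gt (gap G (r - maxTopMult G + 1)) 0 with h0 | h0
    · have h1 : R = 0 := by
        refine le_antisymm (hrad.trans ?_) hR0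
        exact mul_nonpos_of_nonneg_of_nonpos hpos.le (div_nonpos_of_nonpos_of_nonneg h0 hc.le)
      refine hfirst ?_
      rw [h1]
      simpa using hgapr.le
    -- Here `μ = m - 1`; the truncated subtractions are harmless because `1 ≤ m ≤ r`.
    · have hidx : r - (maxTopMult G - 1) = r - maxTopMult G + 1 := by omega
      have hcast : (((maxTopMult G - 1 : ℕ) : ℝ) + 1) = maxTopMult G := by
        have : maxTopMult G - 1 + 1 = maxTopMult G := by omega
        exact_mod_cast this
      refine ⟨maxTopMult G - 1, by omega, fun i => ?_, ?_⟩
      · rw [hidx]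
        exact sv_lt_of_gap_pos h0 i
      · rw [hidx, hcast]
        exact hscale hc hrad

end Main

/-! ### Rank-one maps and relative interiors -/

theorem norm_sub_inner_smul_le {E : Type*} [NormedAddCommGroup E]
    [InnerProductSpace ℂ E] {v : E} (hv : ‖v‖ = 1) (x : E) :
    ‖x - inner ℂ v x • v‖ ≤ ‖x‖ := by
  have h1 : inner ℂ v (x - inner ℂ v x • v) = 0 := by
    rw [inner_sub_right, inner_smul_right, inner_self_eq_norm_sq_to_K, hv]
    simp
  have h2 := norm_add_sq_eq_norm_sq_add_norm_sq_of_inner_eq_zero (𝕜 := ℂ) (inner ℂ v x • v)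
    (x - inner ℂ v x • v) (by rw [inner_smul_left, h1, mul_zero])
  rw [add_sub_cancel] at h2
  refine le_of_sq_le_sq ?_ (norm_nonneg _)
  nlinarith [norm_nonneg (inner ℂ v x • v)]

section RankOne

variable {E : Type*} [NormedAddCommGroup E] [InnerProductSpace ℂ E] [FiniteDimensional ℂ E]
  {F : Type*} [NormedAddCommGroup F] [InnerProductSpace ℂ F] [FiniteDimensional ℂ F]

theorem hs_rankOne (w : F) (v : E) (T : E →ₗ[ℂ] F) :
    hs (rankOne ℂ w v : E →ₗ[ℂ] F) T = (inner ℂ w (T v)).re := by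
  set b := stdOrthonormalBasis ℂ E
  rw [hs_eq_sum b]
  conv_rhs => rw [← b.sum_repr v, map_sum, inner_sum, Complex.re_sum]
  refine Finset.sum_congr rfl fun j _ => ?_
  rw [map_smul, inner_smul_right, b.repr_apply_apply]
  simp
  ring

theorem nuc_rankOne_le (w : F) (v : E) : nuc (rankOne ℂ w v : E →ₗ[ℂ] F) ≤ ‖w‖ * ‖v‖ :=
  nuc_le_of_forall_hs_le fun U hU => by
    rw [hs_comm, hs_rankOne]
    exact (re_inner_le _ _).trans (mul_le_mul_of_nonneg_left (hU v) (norm_nonneg _))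

end RankOne

/-- A point of the relative interior can be moved away from any other point of the set. -/
theorem exists_pos_add_smul_sub_mem {E : Type*} [NormedAddCommGroup E] [NormedSpace ℝ E]
    {S : Set E} {x y : E} (hx : x ∈ intrinsicInterior ℝ S) (hy : y ∈ S) :
    ∃ ε : ℝ, 0 < ε ∧ x + ε • (x - y) ∈ S := by
  obtain ⟨⟨x, hxa⟩, hxi, rfl⟩ := hx
  have hya := subset_affineSpan ℝ S hy
  -- The line from `y` prolonged beyond `x` stays in the affine span, where `x` is an interior
  -- point.
  set φ : ℝ → affineSpan ℝ S := fun t => ⟨AffineMap.lineMap x y (-t),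
    AffineMap.lineMap_mem _ hxa hya⟩ with hφ
  have hφc : Continuous φ := by
    refine Continuous.subtype_mk ?_ _
    exact AffineMap.lineMap_continuous.comp continuous_neg
  have hφ0 : φ 0 = ⟨x, hxa⟩ := by simp [hφ]
  have h1 : φ ⁻¹' (interior ((↑) ⁻¹' S)) ∈ nhds (0 : ℝ) :=
    (isOpen_interior.preimage hφc).mem_nhds (by simpa [hφ0] using hxi)
  obtain ⟨ε, hε, hball⟩ := Metric.mem_nhds_iff.1 h1
  have h2 : ε / 2 ∈ Metric.ball (0 : ℝ) ε := by
    rw [Metric.mem_ball, Real.dist_eq, sub_zero, abs_of_pos (by positivity)]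
    linarith
  refine ⟨ε / 2, by positivity, ?_⟩
  have h3 := interior_subset (hball h2)
  have h4 : AffineMap.lineMap x y (-(ε / 2)) ∈ S := h3
  rw [AffineMap.lineMap_apply] at h4
  convert h4 using 1
  simp only [vsub_eq_sub, vadd_eq_add]
  module

/-! ### Conjugation of linear maps -/

section ConjMap

variable {p q : ℕ}

theorem conjVec_conjVec (x : EuclideanSpace ℂ (Fin p)) : conjVec (conjVec x) = x := by
  ext i
  simp [conjVec]

theorem conjVec_add (x y : EuclideanSpace ℂ (Fin p)) :
    conjVec (x + y) = conjVec x + conjVec y := by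
  ext i
  simp [conjVec]

theorem conjVec_smul (c : ℂ) (x : EuclideanSpace ℂ (Fin p)) :
    conjVec (c • x) = (starRingEnd ℂ) c • conjVec x := by
  ext i
  simp [conjVec]

/-- The linear map whose matrix is the entrywise conjugate of the matrix of `T`. -/
noncomputable def conjMap (T : EuclideanSpace ℂ (Fin p) →ₗ[ℂ] EuclideanSpace ℂ (Fin q)) :
    EuclideanSpace ℂ (Fin p) →ₗ[ℂ] EuclideanSpace ℂ (Fin q) where
  toFun x := conjVec (T (conjVec x))
  map_add' x y := by rw [conjVec_add, map_add, conjVec_add]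
  map_smul' c x := by simp [conjVec_smul]

theorem conjMap_apply (T : EuclideanSpace ℂ (Fin p) →ₗ[ℂ] EuclideanSpace ℂ (Fin q))
    (x : EuclideanSpace ℂ (Fin p)) : conjMap T x = conjVec (T (conjVec x)) := rfl

theorem toEuclideanLin_map_conj_eq (A : Matrix (Fin q) (Fin p) ℂ) :
    Matrix.toEuclideanLin (A.map (starRingEnd ℂ)) = conjMap (Matrix.toEuclideanLin A) := by
  ext1 x
  rw [conjMap_apply, ← toEuclideanLin_map_conj, conjVec_conjVec]

theorem inner_conjVec_left (x y : EuclideanSpace ℂ (Fin p)) :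
    inner ℂ (conjVec x) y = (starRingEnd ℂ) (inner ℂ x (conjVec y)) := by
  rw [← inner_conjVec, conjVec_conjVec]

theorem conjMap_isSymmetric {H : EuclideanSpace ℂ (Fin p) →ₗ[ℂ] EuclideanSpace ℂ (Fin p)}
    (hH : H.IsSymmetric) : (conjMap H).IsSymmetric := fun x y => by
  rw [conjMap_apply, conjMap_apply, inner_conjVec_left, hH, ← inner_conjVec, conjVec_conjVec]

theorem adjoint_conjMap (T : EuclideanSpace ℂ (Fin p) →ₗ[ℂ] EuclideanSpace ℂ (Fin q)) :
    LinearMap.adjoint (conjMap T) = conjMap (LinearMap.adjoint T) := by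
  symm
  rw [LinearMap.eq_adjoint_iff]
  intro x y
  rw [conjMap_apply, conjMap_apply, inner_conjVec_left, LinearMap.adjoint_inner_left,
    ← inner_conjVec, conjVec_conjVec]

theorem conjMap_comp {r : ℕ} (S : EuclideanSpace ℂ (Fin q) →ₗ[ℂ] EuclideanSpace ℂ (Fin r))
    (T : EuclideanSpace ℂ (Fin p) →ₗ[ℂ] EuclideanSpace ℂ (Fin q)) :
    conjMap S ∘ₗ conjMap T = conjMap (S ∘ₗ T) := by
  ext1 x
  simp [conjMap_apply, conjVec_conjVec]

end ConjMap

/-! ### The face exposed by the negative gradient -/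

section Face

variable {n₁ n₂ k : ℕ} {n : Fin k → ℕ} {G Xs : Tensor n₁ n₂ n}

theorem slice_conjIdx (X : Tensor n₁ n₂ n) (i : SliceIdx n) :
    slice X (conjIdx i) = conjMap (slice X i) := by
  rw [slice, fslice_conjIdx, toEuclideanLin_map_conj_eq]; rfl

theorem dualSlice_conjIdx (G : Tensor n₁ n₂ n) (i : SliceIdx n) :
    dualSlice G (conjIdx i) = conjMap (dualSlice G i) := by
  rw [dualSlice, slice_conjIdx]
  ext1 x
  rw [dualSlice, LinearMap.smul_apply, conjMap_apply, conjMap_apply, LinearMap.smul_apply,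
    conjVec_smul, Complex.conj_ofReal]

/-- The linear span of the face of the tensor nuclear norm ball exposed by `-G`, described by the
polar factors of the slices. -/
noncomputable def faceSpan (G : Tensor n₁ n₂ n) : Submodule ℝ (Tensor n₁ n₂ n) where
  carrier := {D | ∀ i, ∃ H : EuclideanSpace ℂ (Fin n₂) →ₗ[ℂ] EuclideanSpace ℂ (Fin n₂),
    H.IsSymmetric ∧ LinearMap.adjoint (dualSlice G i) ∘ₗ dualSlice G i ∘ₗ H = H ∧
      slice D i = dualSlice G i ∘ₗ H}
  zero_mem' i := ⟨0, LinearMap.IsSymmetric.zero, by simp, by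
    have := slice_smul 0 (0 : Tensor n₁ n₂ n) i
    simpa using this⟩
  add_mem' {X Y} hX hY i := by
    obtain ⟨H, h1, h2, h3⟩ := hX i
    obtain ⟨K, k1, k2, k3⟩ := hY i
    exact ⟨H + K, h1.add k1, by rw [LinearMap.comp_add, LinearMap.comp_add, h2, k2], by
      rw [slice_add, h3, k3, LinearMap.comp_add]⟩
  smul_mem' c X hX i := by
    obtain ⟨H, h1, h2, h3⟩ := hX i
    exact ⟨(c : ℂ) • H, h1.smul (by simp), by
      rw [LinearMap.comp_smul, LinearMap.comp_smul, h2], by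
      rw [slice_smul, h3, LinearMap.comp_smul]⟩

theorem inner_optimum (hG : G ≠ 0) (h1 : tnn Xs = 1)
    (hcert : ∀ i, hs (dualSlice G i) (slice Xs i) = nuc (slice Xs i)) :
    inner ℝ G Xs = -sv (bdiag G) 0 := by
  rw [inner_eq_neg_mul_sum_dualSlice hG, Finset.sum_congr rfl fun i _ => hcert i,
    ← tnn_eq_sum_nuc, h1, mul_one]

theorem optimum_mem_faceSpan (hG : G ≠ 0)
    (hcert : ∀ i, hs (dualSlice G i) (slice Xs i) = nuc (slice Xs i)) : Xs ∈ faceSpan G := by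
  intro i
  obtain ⟨H, hH, h1, h2⟩ := exists_factor_of_hs_eq_nuc (norm_dualSlice_le hG i) (hcert i)
  exact ⟨H, hH.1, h2, h1⟩

/-- Under strict complementarity the optimum has full rank on the face exposed by the negative
gradient. -/
theorem eq_zero_of_strictCompl (hG : G ≠ 0) (h1 : tnn Xs = 1)
    (hcert : ∀ i, hs (dualSlice G i) (slice Xs i) = nuc (slice Xs i))
    (hri : -G ∈ intrinsicInterior ℝ (normalCone (ball n₁ n₂ n 1) Xs)) {i : SliceIdx n}
    {v : EuclideanSpace ℂ (Fin n₂)}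
    (hv : LinearMap.adjoint (dualSlice G i) (dualSlice G i v) = v) (hXv : slice Xs i v = 0) :
    v = 0 := by
  by_contra hne
  wlog hv1 : ‖v‖ = 1 generalizing v
  · refine this (v := ((‖v‖⁻¹ : ℝ) : ℂ) • v) ?_ ?_ ?_ ?_
    · rw [map_smul, map_smul, hv]
    · rw [map_smul, hXv, smul_zero]
    · simpa using hne
    · rw [norm_smul, Complex.norm_real, norm_inv, norm_norm, inv_mul_cancel₀ (norm_ne_zero_iff.2 hne)]
  have hN := numSlices_pos i
  set g := sv (bdiag G) 0 with hg
  have hg0 : 0 < g := sv_bdiag_pos hG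
  set W := dualSlice G i with hW
  have hWc : ∀ x, ‖W x‖ ≤ ‖x‖ := norm_dualSlice_le hG i
  set e := (rankOne ℂ (W v) v : EuclideanSpace ℂ (Fin n₂) →ₗ[ℂ] EuclideanSpace ℂ (Fin n₁)) with he
  have heW : hs e W = 1 := by
    rw [he, hs_rankOne, ← LinearMap.adjoint_inner_left, hv, inner_self_eq_norm_sq_to_K, hv1]
    simp
  have hen : nuc e ≤ 1 := by
    refine (nuc_rankOne_le _ _).trans ?_
    rw [hv1, mul_one, ← hv1]
    exact hWc v
  set S := singleSlice (n := n) i e with hS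
  have hSX : inner ℝ S Xs = 0 := by
    rw [hS, inner_singleSlice, he, hs_rankOne, hXv]
    simp
  have hSG : inner ℝ S G = -(g / numSlices n) := by
    rw [hS, inner_singleSlice, slice_eq_smul_dualSlice hG, hs_smul_right, ← hW, heW]
    ring
  have hGX := inner_optimum hG h1 hcert
  -- Removing the rank-one part along `v` leaves a contraction, and costs nothing at `X*` because
  -- `X*_i v = 0`. So `-G - g S` is again normal at `X*`.
  have hmem : -G - g • S ∈ normalCone (ball n₁ n₂ n 1) Xs := by
    intro Z hZ
    have hcon : ∀ j x, ‖(if j = i then W - e else dualSlice G j) x‖ ≤ ‖x‖ := by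
      intro j x
      split_ifs
      · have : (W - e) x = W (x - inner ℂ v x • v) := by
          simp [he, LinearMap.sub_apply]
        rw [this]
        exact (hWc _).trans (norm_sub_inner_smul_le hv1 x)
      · exact norm_dualSlice_le hG j x
    have hsum : ∑ j, hs (if j = i then W - e else dualSlice G j) (slice Z j) =
        ∑ j, hs (dualSlice G j) (slice Z j) - hs e (slice Z i) := by
      have : ∀ j, hs (if j = i then W - e else dualSlice G j) (slice Z j) =
          hs (dualSlice G j) (slice Z j) - if j = i then hs e (slice Z j) else 0 := by
        intro j
        split_ifs with hj
        · subst hj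
          rw [sub_eq_add_neg, hs_add_left, hs_neg_left]; rfl
        · simp
      rw [Finset.sum_congr rfl fun j _ => this j, Finset.sum_sub_distrib, Finset.sum_ite_eq']
      simp
    have hle : (1 / (numSlices n : ℝ)) *
        ∑ j, hs (if j = i then W - e else dualSlice G j) (slice Z j) ≤ 1 := by
      refine le_trans ?_ (show tnn Z ≤ 1 from hZ)
      rw [tnn_eq_sum_nuc]
      exact mul_le_mul_of_nonneg_left (Finset.sum_le_sum fun j _ => hs_le_nuc (hcon j) _)
        (by positivity : (0 : ℝ) ≤ 1 / (numSlices n : ℝ))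
    rw [hsum] at hle
    rw [inner_sub_right, inner_sub_left, inner_sub_left, inner_neg_left, inner_neg_left,
      real_inner_smul_left, real_inner_smul_left, hSX, hGX, inner_eq_neg_mul_sum_dualSlice hG,
      hS, inner_singleSlice]
    nlinarith
  -- Relative interiority allows the opposite move, to `-G + ε g S`. Tested at `N S` in the ball,
  -- which attains `g` against `-G`, this exceeds the value `g` at `X*`: a contradiction.
  obtain ⟨ε, hε, hεm⟩ := exists_pos_add_smul_sub_mem hri hmem
  have hZ : (numSlices n : ℝ) • S ∈ ball n₁ n₂ n 1 := by
    refine (tnn_smul_le hN.le S).trans ?_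
    have := tnn_singleSlice_le i e
    have h3 : (numSlices n : ℝ) * tnn S ≤ numSlices n * ((1 / (numSlices n : ℝ)) * nuc e) :=
      mul_le_mul_of_nonneg_left this hN.le
    have h4 : (numSlices n : ℝ) * ((1 / (numSlices n : ℝ)) * nuc e) = nuc e := by field_simp
    linarith
  have h2 := hεm _ hZ
  have h3 : -G + ε • (-G - (-G - g • S)) = -G + (ε * g) • S := by module
  rw [h3, inner_sub_right, inner_add_left, inner_add_left, inner_neg_left, inner_neg_left,
    real_inner_smul_left, real_inner_smul_left, hSX, hGX, real_inner_smul_right,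
    real_inner_smul_right, real_inner_comm, hSG, real_inner_self_eq_norm_sq] at h2
  have h4 : (numSlices n : ℝ) * -(g / numSlices n) = -g := by field_simp
  rw [h4] at h2
  have h5 : S ≠ 0 := by
    intro h0
    rw [h0, inner_zero_left] at hSG
    have : 0 < g / numSlices n := by positivity
    linarith
  have h6 : 0 < ‖S‖ := norm_pos_iff.2 h5
  have h7 : 0 < ε * g * (numSlices n * ‖S‖ ^ 2) := by positivity
  linarith

/-- Under strict complementarity the optimum can be moved along the face within the ball. -/
theorem exists_pos_add_smul_mem_ball (hG : G ≠ 0) (h1 : tnn Xs = 1)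
    (hcert : ∀ i, hs (dualSlice G i) (slice Xs i) = nuc (slice Xs i))
    (hri : -G ∈ intrinsicInterior ℝ (normalCone (ball n₁ n₂ n 1) Xs)) {D : Tensor n₁ n₂ n}
    (hD : D ∈ faceSpan G) (hGD : inner ℝ G D = 0) :
    ∃ t : ℝ, 0 < t ∧ Xs + t • D ∈ ball n₁ n₂ n 1 := by
  choose K hK1 hK2 hK3 using hD
  choose H hH1 hH2 hH3 using fun i =>
    exists_factor_of_hs_eq_nuc (norm_dualSlice_le hG i) (hcert i)
  have hev : ∀ i, ∃ ε : ℝ, 0 < ε ∧ ∀ t : ℝ, 0 ≤ t → t ≤ ε →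
      (H i + (t : ℂ) • K i).IsPositive := by
    intro i
    -- `V` is the subspace where `W_i` is isometric. There `H i` is definite by strict
    -- complementarity, so adding a small multiple of `K i` keeps it positive and the perturbed
    -- slice aligned.
    refine exists_isPositive_add_smul (V := LinearMap.eqLocus
      (LinearMap.adjoint (dualSlice G i) ∘ₗ dualSlice G i) LinearMap.id) (hH1 i) (hK1 i)
      (fun x => LinearMap.congr_fun (hH3 i) x) (fun x => LinearMap.congr_fun (hK2 i) x)
      fun x hx hx0 => ?_
    refine eq_zero_of_strictCompl hG h1 hcert hri (i := i) hx ?_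
    rw [hH2 i, LinearMap.comp_apply, hx0, map_zero]
  choose ε hε0 hε using hev
  have hall : ∀ᶠ t : ℝ in nhdsWithin 0 (Set.Ioi 0), ∀ i, (H i + (t : ℂ) • K i).IsPositive := by
    rw [Filter.eventually_all]
    intro i
    filter_upwards [Ioc_mem_nhdsGT (hε0 i)] with t ht
    exact hε i t ht.1.le ht.2
  obtain ⟨t, ht, ht0⟩ := (hall.and self_mem_nhdsWithin).exists
  refine ⟨t, ht0, ?_⟩
  have hg0 : 0 < sv (bdiag G) 0 := sv_bdiag_pos hG
  have hsl : ∀ i, slice (Xs + t • D) i = dualSlice G i ∘ₗ (H i + (t : ℂ) • K i) := by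
    intro i
    rw [slice_add, slice_smul, hH2 i, hK3 i, LinearMap.comp_add, LinearMap.comp_smul]
  have h2 : tnn (Xs + t • D) ≤
      (1 / (numSlices n : ℝ)) * ∑ i, hs (dualSlice G i) (slice (Xs + t • D) i) := by
    rw [tnn_eq_sum_nuc]
    refine mul_le_mul_of_nonneg_left (Finset.sum_le_sum fun i _ => ?_)
      (by positivity : (0 : ℝ) ≤ 1 / (numSlices n : ℝ))
    rw [hsl i]
    refine nuc_comp_le_hs (norm_dualSlice_le hG i) (ht i) ?_
    rw [LinearMap.comp_add, LinearMap.comp_add, LinearMap.comp_smul, LinearMap.comp_smul,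
      hH3 i, hK2 i]
  have h3 := inner_eq_neg_mul_sum_dualSlice hG (Xs + t • D)
  rw [inner_add_right, real_inner_smul_right, hGD, inner_optimum hG h1 hcert, mul_zero,
    add_zero, neg_inj] at h3
  have h4 : (1 / (numSlices n : ℝ)) * ∑ i, hs (dualSlice G i) (slice (Xs + t • D) i) = 1 :=
    mul_left_cancel₀ hg0.ne' (h3.symm.trans (mul_one _).symm)
  exact h2.trans_eq h4

/-- Symmetrization is the orthogonal projection onto the slice families of real tensors: pairing `M`
with its image gives the squared norm of the image. -/
theorem norm_sq_ofSlices_le (M : SliceIdx n → Matrix (Fin n₁) (Fin n₂) ℂ) :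
    ‖ofSlices M‖ ^ 2 ≤ (1 / (numSlices n : ℝ)) *
      ∑ i, hs (Matrix.toEuclideanLin (M i)) (Matrix.toEuclideanLin (M i)) := by
  set O := ofSlices M with hO
  have h1 : ‖O‖ ^ 2 = (1 / (numSlices n : ℝ)) * ∑ i, hs (Matrix.toEuclideanLin (M i)) (slice O i) := by
    rw [← real_inner_self_eq_norm_sq, hO, inner_ofSlices]
  have h2 : ‖O‖ ^ 2 = (1 / (numSlices n : ℝ)) * ∑ i, hs (slice O i) (slice O i) := by
    rw [← real_inner_self_eq_norm_sq, inner_eq_sum_hs]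
  have h3 : ∀ i, hs (Matrix.toEuclideanLin (M i)) (slice O i) ≤
      (1 / 2) * hs (Matrix.toEuclideanLin (M i)) (Matrix.toEuclideanLin (M i)) +
        (1 / 2) * hs (slice O i) (slice O i) := by
    intro i
    have := hs_self_nonneg (Matrix.toEuclideanLin (M i) - slice O i)
    rw [hs_sub_right, hs_comm, hs_sub_right, hs_comm (_ - _) (slice O i), hs_sub_right,
      hs_comm (slice O i) (Matrix.toEuclideanLin (M i))] at this
    linarith
  have h4 := mul_le_mul_of_nonneg_left (Finset.sum_le_sum fun i (_ : i ∈ Finset.univ) => h3 i)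
    (by positivity : (0 : ℝ) ≤ 1 / (numSlices n : ℝ))
  rw [Finset.sum_add_distrib, ← Finset.mul_sum, ← Finset.mul_sum, mul_add] at h4
  linarith

/-- Points of the ball are close to the span of the face, with respect to their optimality gap. -/
theorem exists_faceSpan_dist_le (hG : G ≠ 0) (h1 : tnn Xs = 1)
    (hcert : ∀ i, hs (dualSlice G i) (slice Xs i) = nuc (slice Xs i)) :
    ∃ K : ℝ, 0 ≤ K ∧ ∀ X ∈ ball n₁ n₂ n 1, ∃ D ∈ faceSpan G,
      ‖X - D‖ ^ 2 ≤ K * inner ℝ G (X - Xs) := by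
  obtain ⟨-, -, ⟨i₀⟩⟩ := nonempty_of_ne_zero hG
  have hN := numSlices_pos i₀
  have hg0 : 0 < sv (bdiag G) 0 := sv_bdiag_pos hG
  choose K hK0 hK using fun i => exists_factor_dist_le (norm_dualSlice_le hG i)
  set κ := ∑ i, K i with hκ
  have hκ0 : 0 ≤ κ := Finset.sum_nonneg fun i _ => hK0 i
  refine ⟨κ * numSlices n / sv (bdiag G) 0, by positivity, fun X hX => ?_⟩
  choose H hH1 hH2 hH3 using fun i => hK i (slice X i)
  set M : SliceIdx n → Matrix (Fin n₁) (Fin n₂) ℂ := fun i =>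
    Matrix.toEuclideanLin.symm (dualSlice G i ∘ₗ H i) with hM
  have hMl : ∀ i, Matrix.toEuclideanLin (M i) = dualSlice G i ∘ₗ H i := fun i => by simp [hM]
  refine ⟨ofSlices M, fun i => ?_, ?_⟩
  · have hW : dualSlice G i = conjMap (dualSlice G (conjIdx i)) := by
      rw [← dualSlice_conjIdx, conjIdx_conjIdx]
    have hfix : LinearMap.adjoint (dualSlice G i) ∘ₗ dualSlice G i ∘ₗ conjMap (H (conjIdx i)) =
        conjMap (H (conjIdx i)) := by
      rw [hW, adjoint_conjMap, conjMap_comp, conjMap_comp, hH2]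
    -- The slicewise approximants need not come from a real tensor. Averaging with the conjugate at
    -- `-i` repairs this and keeps the factorization, since `W_{-i}` is the conjugate of `W_i`.
    refine ⟨((1 / 2 : ℝ) : ℂ) • (H i + conjMap (H (conjIdx i))),
      ((hH1 i).add (conjMap_isSymmetric (hH1 _))).smul (Complex.conj_ofReal _), ?_, ?_⟩
    · rw [LinearMap.comp_smul, LinearMap.comp_smul, LinearMap.comp_add, LinearMap.comp_add, hH2 i,
        hfix]
    · rw [slice_ofSlices, toEuclideanLin_map_conj_eq, hMl, hMl, LinearMap.comp_smul,
        LinearMap.comp_add, ← conjMap_comp, ← hW]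
  · have hsub : X - ofSlices M = ofSlices fun i => fslice X i - M i := by
      conv_lhs => rw [← ofSlices_fslice X]
      ext ⟨a, b, l⟩
      simp only [PiLp.sub_apply, ofSlices_apply, Matrix.sub_apply, sub_mul, Complex.sub_re,
        Finset.sum_sub_distrib]
      ring
    have hnuc : ∀ i, nuc (slice X i) ≤ numSlices n := by
      intro i
      have h2 : tnn X ≤ 1 := hX
      rw [tnn_eq_sum_nuc, one_div, inv_mul_le_iff₀ hN, mul_one] at h2
      exact (Finset.single_le_sum (f := fun i => nuc (slice X i)) (fun j _ => nuc_nonneg _)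
        (Finset.mem_univ i)).trans h2
    have hgap : ∀ i, 0 ≤ nuc (slice X i) - hs (dualSlice G i) (slice X i) := fun i =>
      sub_nonneg.2 (hs_le_nuc (norm_dualSlice_le hG i) _)
    have hterm : ∀ i, hs (Matrix.toEuclideanLin (fslice X i - M i))
        (Matrix.toEuclideanLin (fslice X i - M i)) ≤
        κ * numSlices n * (nuc (slice X i) - hs (dualSlice G i) (slice X i)) := by
      intro i
      rw [map_sub, hMl]
      refine (hH3 i).trans ?_
      rw [mul_assoc]
      refine mul_le_mul (Finset.single_le_sum (fun j _ => hK0 j) (Finset.mem_univ i))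
        (mul_le_mul_of_nonneg_right (hnuc i) (hgap i))
        (mul_nonneg (nuc_nonneg _) (hgap i)) hκ0
    rw [hsub]
    refine (norm_sq_ofSlices_le _).trans ?_
    have h3 := mul_le_mul_of_nonneg_left
      (Finset.sum_le_sum fun i (_ : i ∈ Finset.univ) => hterm i)
      (by positivity : (0 : ℝ) ≤ 1 / (numSlices n : ℝ))
    refine h3.trans ?_
    rw [← Finset.mul_sum, Finset.sum_sub_distrib, inner_sub_right, inner_optimum hG h1 hcert,
      inner_eq_neg_mul_sum_dualSlice hG X]
    have h4 : (1 / (numSlices n : ℝ)) * ∑ i, nuc (slice X i) ≤ 1 := by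
      rw [← tnn_eq_sum_nuc]; exact hX
    have h5 : κ * numSlices n / sv (bdiag G) 0 *
        (-(sv (bdiag G) 0 * ((1 / (numSlices n : ℝ)) * ∑ i, hs (dualSlice G i) (slice X i))) -
          -sv (bdiag G) 0) = κ * numSlices n *
        (1 - (1 / (numSlices n : ℝ)) * ∑ i, hs (dualSlice G i) (slice X i)) := by
      field_simp
      ring
    rw [h5]
    have h6 : 0 ≤ κ * numSlices n := by positivity
    nlinarith

end Face

/-! ### Quadratic growth -/

section Growth

theorem inner_gradient_add_le_of_strongConvexOn {H V : Type*} [NormedAddCommGroup H]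
    [InnerProductSpace ℝ H] [CompleteSpace H] [NormedAddCommGroup V] [NormedSpace ℝ V]
    {f : H → ℝ} {g : V → ℝ} {A : H →ₗ[ℝ] V} {C : H} {α : ℝ}
    (hg : StrongConvexOn Set.univ α g) (hf : ∀ x, f x = g (A x) + inner ℝ C x) {x : H}
    (hdiff : DifferentiableAt ℝ f x) (y : H) :
    inner ℝ (gradient f x) (y - x) + α / 2 * ‖A (y - x)‖ ^ 2 ≤ f y - f x := by
  have h := inner_gradient_le_of_forall_line_le (v := y - x) hdiff (D := f y - f x)
    (c := α / 2 * ‖A (y - x)‖ ^ 2) fun t ht0 ht1 => ?_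
  · linarith
  · have h1 := hg.2 (Set.mem_univ (A x)) (Set.mem_univ (A y)) (by linarith : 0 ≤ 1 - t) ht0.le
      (by ring)
    have h2 : A (x + t • (y - x)) = (1 - t) • A x + t • A y := by
      rw [map_add, map_smul, map_sub]
      module
    have h3 : ‖A x - A y‖ = ‖A (y - x)‖ := by rw [map_sub, norm_sub_rev]
    rw [h3] at h1
    simp only [smul_eq_mul] at h1
    rw [hf, hf, hf, h2, inner_add_right, real_inner_smul_right, inner_sub_right]
    nlinarith

/-- An injective linear map on a finite-dimensional space is bounded below. -/
theorem exists_norm_sq_le_of_injOn {E V : Type*} [NormedAddCommGroup E] [InnerProductSpace ℝ E]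
    [FiniteDimensional ℝ E] [NormedAddCommGroup V] [NormedSpace ℝ V] (L : Submodule ℝ E)
    (A : E →ₗ[ℝ] V) (G : E) (h : ∀ x ∈ L, A x = 0 → inner ℝ G x = 0 → x = 0) :
    ∃ K : ℝ, 0 ≤ K ∧ ∀ x ∈ L, ‖x‖ ^ 2 ≤ K * (‖A x‖ ^ 2 + inner ℝ G x ^ 2) := by
  set Φ : L →ₗ[ℝ] V × ℝ := (A.prod (innerₛₗ ℝ G)).domRestrict L with hΦ
  have hker : LinearMap.ker Φ = ⊥ := by
    rw [LinearMap.ker_eq_bot']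
    rintro ⟨x, hx⟩ h0
    have h1 : A x = 0 := congrArg Prod.fst h0
    have h2 : inner ℝ G x = 0 := congrArg Prod.snd h0
    exact Subtype.ext (h x hx h1 h2)
  obtain ⟨K, -, hK⟩ := Φ.exists_antilipschitzWith hker
  refine ⟨K ^ 2, by positivity, fun x hx => ?_⟩
  have h1 : ‖x‖ ≤ K * ‖Φ ⟨x, hx⟩‖ := by
    simpa [dist_eq_norm] using hK.le_mul_dist ⟨x, hx⟩ 0
  have h2 : ‖Φ ⟨x, hx⟩‖ = max ‖A x‖ |inner ℝ G x| := rfl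
  have h3 : ‖Φ ⟨x, hx⟩‖ ^ 2 ≤ ‖A x‖ ^ 2 + inner ℝ G x ^ 2 := by
    rw [h2, ← sq_abs (inner ℝ G x)]
    rcases max_cases ‖A x‖ |inner ℝ G x| with ⟨h, -⟩ | ⟨h, -⟩ <;> rw [h] <;>
      nlinarith [sq_nonneg ‖A x‖, sq_nonneg |inner ℝ G x|]
  calc ‖x‖ ^ 2 ≤ (K * ‖Φ ⟨x, hx⟩‖) ^ 2 := pow_le_pow_left₀ (norm_nonneg _) h1 2
    _ = K ^ 2 * ‖Φ ⟨x, hx⟩‖ ^ 2 := mul_pow _ _ _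
    _ ≤ _ := mul_le_mul_of_nonneg_left h3 (by positivity)

theorem norm_add_sq_le_two_mul {V : Type*} [SeminormedAddCommGroup V] (x y : V) :
    ‖x + y‖ ^ 2 ≤ 2 * ‖x‖ ^ 2 + 2 * ‖y‖ ^ 2 := by
  have h := pow_le_pow_left₀ (norm_nonneg _) (norm_add_le x y) 2
  nlinarith [sq_nonneg (‖x‖ - ‖y‖)]

variable {n₁ n₂ k : ℕ} {n : Fin k → ℕ}

/-- Strict complementarity and uniqueness of the minimizer give quadratic growth on the ball. -/
theorem quadratic_growth {f : Tensor n₁ n₂ n → ℝ}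
    (hdiff : ∀ X ∈ ball n₁ n₂ n 1, DifferentiableAt ℝ f X)
    {Xs : Tensor n₁ n₂ n} (hXs : Xs ∈ ball n₁ n₂ n 1)
    (hopt : ∀ X ∈ ball n₁ n₂ n 1, f Xs ≤ f X) (hgrad : gradient f Xs ≠ 0)
    {V : Type*} [NormedAddCommGroup V] [NormedSpace ℝ V] {α : ℝ} {g : V → ℝ}
    {A : Tensor n₁ n₂ n →ₗ[ℝ] V} {C : Tensor n₁ n₂ n}
    (hα : 0 < α) (hg : StrongConvexOn Set.univ α g) (hf : ∀ X, f X = g (A X) + inner ℝ C X)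
    (huniq : ∀ X ∈ ball n₁ n₂ n 1, f X = f Xs → X = Xs) (hsc : StrictCompl f Xs) :
    ∃ γ : ℝ, 0 < γ ∧ ∀ X ∈ ball n₁ n₂ n 1, γ * ‖X - Xs‖ ^ 2 ≤ f X - f Xs := by
  have hvi : ∀ X ∈ ball n₁ n₂ n 1, 0 ≤ inner ℝ (gradient f Xs) (X - Xs) := fun X hX =>
    inner_gradient_nonneg_of_isMin (convex_ball 1) hXs (hdiff Xs hXs) hopt hX
  obtain ⟨htnn, hcert⟩ := optimality_structure hgrad hXs hvi
  have hfo : ∀ X, inner ℝ (gradient f Xs) (X - Xs) + α / 2 * ‖A (X - Xs)‖ ^ 2 ≤ f X - f Xs :=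
    inner_gradient_add_le_of_strongConvexOn hg hf (hdiff Xs hXs)
  rw [StrictCompl] at hsc
  set G := gradient f Xs with hG
  have hline : ∀ (D : Tensor n₁ n₂ n) (t : ℝ), A D = 0 →
      f (Xs + t • D) = f Xs + t * inner ℝ C D := by
    intro D t hAD
    rw [hf, hf, map_add, map_smul, hAD, smul_zero, add_zero, inner_add_right,
      real_inner_smul_right]
    ring
  -- Along `ker A` the function is affine with slope `⟨C, D⟩`, and a short step along `D` stays in
  -- the ball. Applied to `D` and `-D` this makes the slope zero, and uniqueness then gives `D = 0`.
  have hCnonneg : ∀ D ∈ faceSpan G, A D = 0 → inner ℝ G D = 0 → 0 ≤ inner ℝ C D := by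
    intro D hD hAD hGD
    obtain ⟨t, ht, hmem⟩ := exists_pos_add_smul_mem_ball hgrad htnn hcert hsc hD hGD
    have := hopt _ hmem
    rw [hline D t hAD] at this
    nlinarith
  have hinj : ∀ D ∈ faceSpan G, A D = 0 → inner ℝ G D = 0 → D = 0 := by
    intro D hD hAD hGD
    have h1 := hCnonneg D hD hAD hGD
    have h2 := hCnonneg (-D) (neg_mem hD) (by rw [map_neg, hAD, neg_zero])
      (by rw [inner_neg_right, hGD, neg_zero])
    rw [inner_neg_right] at h2
    obtain ⟨t, ht, hmem⟩ := exists_pos_add_smul_mem_ball hgrad htnn hcert hsc hD hGD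
    have h3 : f (Xs + t • D) = f Xs := by
      rw [hline D t hAD, show inner ℝ C D = 0 by linarith, mul_zero, add_zero]
    have h4 := huniq _ hmem h3
    rw [add_eq_left, smul_eq_zero] at h4
    exact h4.resolve_left ht.ne'
  obtain ⟨K, hK0, hK⟩ := exists_norm_sq_le_of_injOn (faceSpan G) A G hinj
  obtain ⟨κ, hκ0, hκ⟩ := exists_faceSpan_dist_le hgrad htnn hcert
  set a := ‖LinearMap.toContinuousLinearMap A‖ with ha
  have hA : ∀ X, ‖A X‖ ≤ a * ‖X‖ := (LinearMap.toContinuousLinearMap A).le_opNorm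
  set σ := sv (bdiag G) 0 with hσ
  have hσ0 : 0 < σ := sv_bdiag_pos hgrad
  set c := 2 * κ + 4 * K * (a ^ 2 * κ + ‖G‖ ^ 2 * κ + 2 * σ) with hc
  set d := 4 * K * (2 / α) with hd
  have hc0 : 0 ≤ c := by positivity
  have hd0 : 0 ≤ d := by positivity
  -- `c` and `d` are the coefficients of `h` and of `α/2 ‖A (X - Xs)‖²` in `h7`; the `+ 1` keeps the
  -- denominator positive.
  refine ⟨1 / (c + d + 1), by positivity, fun X hX => ?_⟩
  obtain ⟨D, hD, hDX⟩ := hκ X hX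
  have h0 := hvi X hX
  set h := inner ℝ G (X - Xs) with hh
  -- The injectivity bound involves `h²` while only `h` is available; boundedness on the ball gives
  -- `h² ≤ 2σh`.
  have hh2 : h ≤ 2 * σ := by
    have h1 := inner_le_mul_tnn (norm_slice_le_sv_bdiag G) X
    have h2 : tnn X ≤ 1 := hX
    rw [hh, inner_sub_right, inner_optimum hgrad htnn hcert]
    nlinarith
  have hDs : D - Xs ∈ faceSpan G := sub_mem hD (optimum_mem_faceSpan hgrad hcert)
  set R := X - D with hR
  have h1 : ‖X - Xs‖ ^ 2 ≤ 2 * ‖R‖ ^ 2 + 2 * ‖D - Xs‖ ^ 2 := by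
    have := norm_add_sq_le_two_mul R (D - Xs)
    rwa [hR, sub_add_sub_cancel] at this
  have hsplit : D - Xs = (X - Xs) + -R := by rw [hR]; abel
  have h2 : ‖A (D - Xs)‖ ^ 2 ≤ 2 * ‖A (X - Xs)‖ ^ 2 + 2 * (a ^ 2 * ‖R‖ ^ 2) := by
    have h3 := norm_add_sq_le_two_mul (A (X - Xs)) (A (-R))
    rw [← map_add, ← hsplit, map_neg, norm_neg] at h3
    have h4 := pow_le_pow_left₀ (norm_nonneg _) (hA R) 2
    rw [mul_pow] at h4
    linarith
  have h3 : inner ℝ G (D - Xs) ^ 2 ≤ 2 * (2 * σ * h) + 2 * (‖G‖ ^ 2 * ‖R‖ ^ 2) := by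
    rw [hsplit, inner_add_right, inner_neg_right, ← hh]
    have h4 : inner ℝ G R ^ 2 ≤ ‖G‖ ^ 2 * ‖R‖ ^ 2 := by
      rw [← mul_pow, ← sq_abs]
      exact pow_le_pow_left₀ (abs_nonneg _) (abs_real_inner_le_norm G R) 2
    nlinarith [sq_nonneg (h + inner ℝ G R)]
  have h4 := hK _ hDs
  have h5 : ‖D - Xs‖ ^ 2 ≤ K * (2 * ‖A (X - Xs)‖ ^ 2 + 2 * (a ^ 2 * ‖R‖ ^ 2) +
      (2 * (2 * σ * h) + 2 * (‖G‖ ^ 2 * ‖R‖ ^ 2))) :=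
    h4.trans (mul_le_mul_of_nonneg_left (add_le_add h2 h3) hK0)
  have h6 : K * (2 * ‖A (X - Xs)‖ ^ 2 + 2 * (a ^ 2 * ‖R‖ ^ 2) +
      (2 * (2 * σ * h) + 2 * (‖G‖ ^ 2 * ‖R‖ ^ 2))) ≤
      K * (2 * ‖A (X - Xs)‖ ^ 2 + 2 * (a ^ 2 * (κ * h)) +
        (2 * (2 * σ * h) + 2 * (‖G‖ ^ 2 * (κ * h)))) := by
    gcongr
  have h7 : ‖X - Xs‖ ^ 2 ≤ c * h + d * (α / 2 * ‖A (X - Xs)‖ ^ 2) := by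
    have h8 : d * (α / 2 * ‖A (X - Xs)‖ ^ 2) = 4 * K * ‖A (X - Xs)‖ ^ 2 := by
      rw [hd]; field_simp
    rw [h8, hc]
    linarith
  have h8 := hfo X
  have h9 : 0 ≤ α / 2 * ‖A (X - Xs)‖ ^ 2 := by positivity
  rw [one_div, inv_mul_le_iff₀ (by positivity)]
  refine h7.trans ?_
  have h10 : (c + d + 1) * (h + α / 2 * ‖A (X - Xs)‖ ^ 2) ≤ (c + d + 1) * (f X - f Xs) :=
    mul_le_mul_of_nonneg_left h8 (by positivity)
  nlinarith [mul_nonneg hc0 h9, mul_nonneg hd0 h0]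

end Growth

end TNN

/-! ### The local convergence theorem -/

theorem mainTheorem4 {k : ℕ} (n₁ n₂ : ℕ) (n : Fin k → ℕ)
    (f : TNN.Tensor n₁ n₂ n → ℝ) (β : ℝ) (hβ : 0 < β)
    (hconv : ConvexOn ℝ Set.univ f)
    (hdiff : ∀ X ∈ TNN.ball n₁ n₂ n 1, DifferentiableAt ℝ f X)
    (hsmooth : ∀ X ∈ TNN.ball n₁ n₂ n 1, ∀ Y ∈ TNN.ball n₁ n₂ n 1,
      ‖gradient f X - gradient f Y‖ ≤ β * ‖X - Y‖)
    (Xs : TNN.Tensor n₁ n₂ n) (hXs : Xs ∈ TNN.ball n₁ n₂ n 1)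
    (hopt : ∀ X ∈ TNN.ball n₁ n₂ n 1, f Xs ≤ f X)
    (hgrad : gradient f Xs ≠ 0) :
    (∀ r : ℕ, TNN.maxTopMult (gradient f Xs) ≤ r → r < min n₁ n₂ →
      ∀ X : ℕ → TNN.Tensor n₁ n₂ n, TNN.IsPGD f β X →
        ‖X 1 - Xs‖ ≤ TNN.radius β (gradient f Xs) r →
        -- each exact projection coincides with the rank-`r` truncated projection, which exists
        -- and does not depend on the choices made in its computation
        (∀ t : ℕ, 1 ≤ t → ∀ Y : TNN.Tensor n₁ n₂ n,
          TNN.IsTruncProj r 1 (X t - (1 / β) • gradient f (X t)) Y ↔ Y = X (t + 1)) ∧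
        -- so the method with truncated projections produces the same sequence
        (∀ Z : ℕ → TNN.Tensor n₁ n₂ n, Z 1 = X 1 →
          (∀ t : ℕ, 1 ≤ t →
            TNN.IsTruncProj r 1 (Z t - (1 / β) • gradient f (Z t)) (Z (t + 1))) →
          ∀ t : ℕ, 1 ≤ t → Z t = X t) ∧
        (∀ t : ℕ, 2 ≤ t →
          f (X t) - f Xs ≤ β * ‖X 1 - Xs‖ ^ 2 / (2 * ((t : ℝ) - 1)))) ∧
    (∀ (m : ℕ) (α : ℝ) (g : EuclideanSpace ℝ (Fin m) → ℝ)
      (A : TNN.Tensor n₁ n₂ n →ₗ[ℝ] EuclideanSpace ℝ (Fin m)) (C : TNN.Tensor n₁ n₂ n),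
      0 < α → StrongConvexOn Set.univ α g →
      (∀ X, f X = g (A X) + inner ℝ C X) →
      (∀ X ∈ TNN.ball n₁ n₂ n 1, f X = f Xs → X = Xs) →
      TNN.StrictCompl f Xs →
      ∃ γ : ℝ, 0 < γ ∧
        (∀ X ∈ TNN.ball n₁ n₂ n 1, γ * ‖X - Xs‖ ^ 2 ≤ f X - f Xs) ∧
        ∀ X : ℕ → TNN.Tensor n₁ n₂ n, TNN.IsPGD f β X → ∀ t : ℕ, 2 ≤ t →
          f (X t) - f Xs ≤
            β * ‖X 1 - Xs‖ ^ 2 / 2 * (1 / (1 + 2 * γ / β)) ^ (t - 1)) := by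
  have hK : Convex ℝ (TNN.ball n₁ n₂ n 1) := TNN.convex_ball 1
  refine ⟨fun r hmr hr X hX hrad => ?_, fun m α g A C hα hg hf huniq hsc => ?_⟩
  · have key : ∀ t : ℕ, 1 ≤ t → ∀ Y : TNN.Tensor n₁ n₂ n,
        TNN.IsTruncProj r 1 (X t - (1 / β) • gradient f (X t)) Y ↔ Y = X (t + 1) := fun t ht Y =>
      TNN.isTruncProj_iff_of_radius hβ hdiff hsmooth hXs hopt hgrad hmr hr
        (TNN.pgd_mem hX.1 hX.2 t ht)
        ((TNN.pgd_dist_le hβ hK hconv hdiff hsmooth hX.1 hX.2 hXs hopt t ht).trans hrad)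
        (hX.2 t ht) Y
    refine ⟨key, fun Z hZ1 hZ t ht => ?_,
      TNN.pgd_sublinear hβ hK hconv hdiff hsmooth hX.1 hX.2 hXs⟩
    induction t, ht using Nat.le_induction with
    | base => exact hZ1
    | succ t ht ih =>
      have h := hZ t ht
      rw [ih] at h
      exact (key t ht _).1 h
  · obtain ⟨γ, hγ, hgrow⟩ :=
      TNN.quadratic_growth hdiff hXs hopt hgrad hα hg hf huniq hsc
    -- Growth survives shrinking `γ`; the cap `β/390` is what `pgd_linear` needs for the exponent `t
    -- - 1`.
    refine ⟨min γ (β / 390), by positivity, ?_⟩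
    have hgrow' : ∀ X ∈ TNN.ball n₁ n₂ n 1,
        min γ (β / 390) * ‖X - Xs‖ ^ 2 ≤ f X - f Xs := fun X hX =>
      (mul_le_mul_of_nonneg_right (min_le_left _ _) (sq_nonneg _)).trans (hgrow X hX)
    exact ⟨hgrow', fun X hX => TNN.pgd_linear hβ hK hconv hdiff hsmooth hX.1 hX.2 hXs
      (by positivity) (min_le_right _ _) hgrow'⟩
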